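/- Let $d\in\{2,3\}$ and, for a fixed choice of sign, let $K(x)=\pm\frac1{2\pi}\log|x|$ on $\mathbb R^2$ if $d=2$ and $K(x)=\pm\frac{e^{-\kappa|x|}}{4\pi|x|}$ on $\mathbb R^3$ with a fixed $\kappa>0$ if $d=3$. For $T>0$ and an external magnetic field $B$ on $[0,T]\times\mathbb R^d$ consider $$\partial_t f+v\cdot\nabla_x f-\big(\nabla K\star\rho_f+v\wedge B(t,x)\big)\cdot\nabla_v f=0,\qquad \rho_f(t,x)=\int_{\mathbb R^d} f(t,x,v)\,dv,\qquad f|_{t=0}=f^{\mathrm{in}},$$ where $(\nabla K\star\rho_f)(t,x)=\int_{\mathbb R^d}\nabla K(x-y)\rho_f(t,y)\,dy$. For $d=3$, $B$ takes values in $\mathbb R^3$ and $\wedge$ is the vector product; for $d=2$, $B$ is a scalar (the strength of a field orthogonal to the plane) and $v\wedge B=(Bv_2,-Bv_1)$. A classical solution on $[0,T]$ is a function $f\ge 0$ that is $C^1$ on $[0,T]\times\mathbb R^d\times\mathbb R^d$, with $f(t,\cdot)\in L^1\cap L^\infty(\mathbb R^d\times\mathbb R^d)$ for every $t$, for which the integrals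 defining $\rho_f$ and $\nabla K\star\rho_f$ converge absolutely at every $(t,x)\in[0,T]\times\mathbb R^d$, $\nabla K\star\rho_f$ is bounded on $[0,T]\times\mathbb R^d$, and the equation and the initial condition hold pointwise. For $n\in\mathbb N$ set $$M_n(t)=\int_{\mathbb R^{2d}}|v|^n f(t,x,v)\,dx\,dv,\qquad N_n(t)=\int_{\mathbb R^{2d}}|x|^n f(t,x,v)\,dx\,dv,$$ and write $\|g\|_{L^\infty\cap L^1}=\|g\|_{L^\infty}+\|g\|_{L^1}$. **Theorem.** Let $0\le f^{\mathrm{in}}\in L^1\cap L^\infty(\mathbb R^d\times\mathbb R^d)$, let $n\in\mathbb N$, and let $\mathbf M^{\mathrm{in}}_k>0$ be constants with $M_k(0)\le\mathbf M^{\mathrm{in}}_k$ for all integers $0\le k\le n$. Let $f$ be a classical solution on $[0,T]$ with initial datum $f^{\mathrm{in}}$. (i) If $d=2$, then, with no hypothesis on $B$, $$M_n(t)\le\Phi_n\big(\|f^{\mathrm{in}}\|_{L^\infty\cap L^1},\mathbf M^{\mathrm{in}}_n,t\big)\quad\text{for all }t\in[0,T],$$ where the function $\Phi_n$ depends only on $n$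 (and the sign of $K$), and is continuous in $t$. (ii) If $d=3$, assume in addition that $n\ge4$, that for some $c\in(\frac75,\frac32)$, $a=\frac3c-1$ and $B_0>0$ $$\|x\wedge B(t,x)\|_{L^\infty_x}\le B_0t^{-a}\quad\text{and}\quad\|B(t,\cdot)\|_{L^\infty}\le B_0t^{-a}\qquad\text{for all }t\in(0,T],$$ and that there are constants $\mathbf N^{\mathrm{in}}_k>0$ with $N_k(0)\le\mathbf N^{\mathrm{in}}_k$ for all integers $0\le k\le n$. There is a constant $\varepsilon_0>0$, depending only on $B_0$ (and on $K$ and $c$), such that if $$\|f^{\mathrm{in}}\|_{L^\infty\cap L^1}+M_4(0)+N_4(0)\le\varepsilon_0,$$ then $$M_n(t)\le\Phi_n\ \text{ and }\ N_n(t)\le\Phi_n,\qquad \Phi_n=\Phi_n\big(\|f^{\mathrm{in}}\|_{L^\infty\cap L^1},\mathbf M^{\mathrm{in}}_n,\mathbf N^{\mathrm{in}}_n,t\big),\quad\text{for all }t\in[0,T],$$ where the function $\Phi_n$ depends only on $n$, $B_0$, $K$ and $c$, and is continuous in $t$. -/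

import Mathlib

open MeasureTheory Set

namespace MagneticVlasov

noncomputable section

/-- The Euclidean space `ℝ^d`. -/
abbrev Space (d : ℕ) : Type := EuclideanSpace ℝ (Fin d)

/-- The phase space of pairs `(x, v)`, with its Lebesgue measure. -/
abbrev Phase (d : ℕ) : Type := Space d × Space d

/-- The Coulomb potential in dimension two, `σ = 1` or `σ = -1` being the sign. -/
def coulombKernel (σ : ℝ) (x : Space 2) : ℝ :=
  σ * (1 / (2 * Real.pi) * Real.log ‖x‖)

/-- The screened Coulomb (Yukawa) potential in dimension three. -/
def screenedKernel (σ κ : ℝ) (x : Space 3) : ℝ :=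
  σ * (Real.exp (-κ * ‖x‖) / (4 * Real.pi * ‖x‖))

/-- The vector product in dimension three. -/
def wedge (v w : Space 3) : Space 3 :=
  WithLp.toLp 2 (crossProduct (WithLp.ofLp v) (WithLp.ofLp w))

/-- The planar vector product with a magnetic field of (signed) strength `β` that is orthogonal to
the plane: `(v₁, v₂, 0) ∧ (0, 0, β) = (β v₂, -β v₁, 0)`. -/
def planarWedge (v : Space 2) (β : ℝ) : Space 2 :=
  !₂[β * v 1, -(β * v 0)]

variable {d : ℕ}

/-- The spatial density of a phase space density. -/
def density (g : Phase d → ℝ) (x : Space d) : ℝ :=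
  ∫ v, g (x, v)

/-- The field `∇K ⋆ ρ_g`. -/
def field (K : Space d → ℝ) (g : Phase d → ℝ) (x : Space d) : Space d :=
  ∫ y, density g y • gradient K (x - y)

/-- The velocity moment of order `n`, with values in `[0, ∞]`. -/
def velocityMoment (n : ℕ) (g : Phase d → ℝ) : ENNReal :=
  ∫⁻ z, ENNReal.ofReal (‖z.2‖ ^ n * g z)

/-- The position moment of order `n`, with values in `[0, ∞]`. -/
def positionMoment (n : ℕ) (g : Phase d → ℝ) : ENNReal :=
  ∫⁻ z, ENNReal.ofReal (‖z.1‖ ^ n * g z)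

/-- The norm of `L^∞ ∩ L^1`. -/
def normLinfL1 (g : Phase d → ℝ) : ENNReal :=
  eLpNorm g ⊤ volume + eLpNorm g 1 volume

/-- `f` is a classical solution on `[0, T]`, with initial datum `fin`, of
`∂ₜ f + v · ∇ₓ f - (∇K ⋆ ρ_f + v ∧ B) · ∇ᵥ f = 0`.
The magnetic term `v ∧ B(t, x)` is the argument `mag t x v`. -/
structure IsClassicalSolution (K : Space d → ℝ) (mag : ℝ → Space d → Space d → Space d) (T : ℝ)
    (fin : Phase d → ℝ) (f : ℝ → Phase d → ℝ) : Prop where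
  /-- `f` is continuously differentiable on `[0, T] × ℝ^d × ℝ^d`. -/
  contDiffOn : ContDiffOn ℝ 1 (fun p : ℝ × Phase d => f p.1 p.2) (Icc 0 T ×ˢ univ)
  nonneg : ∀ t ∈ Icc 0 T, ∀ z, 0 ≤ f t z
  memL1 : ∀ t ∈ Icc 0 T, MemLp (f t) 1 volume
  memLinf : ∀ t ∈ Icc 0 T, MemLp (f t) ⊤ volume
  /-- The spatial density exists. -/
  density_exists : ∀ t ∈ Icc 0 T, ∀ x, Integrable (fun v => f t (x, v))
  /-- The integral that defines the self-consistent field converges. -/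
  field_exists : ∀ t ∈ Icc 0 T, ∀ x,
    Integrable (fun y => density (f t) y • gradient K (x - y))
  /-- The self-consistent field is bounded on `[0, T] × ℝ^d`. -/
  field_bounded : ∃ C : ℝ, ∀ t ∈ Icc 0 T, ∀ x, ‖field K (f t) x‖ ≤ C
  /-- The equation; the time derivative is one-sided at `0` and at `T`. -/
  equation : ∀ t ∈ Icc 0 T, ∀ x v : Space d,
    derivWithin (fun s => f s (x, v)) (Icc 0 T) t
      + inner ℝ v (gradient (fun y => f t (y, v)) x)
      - inner ℝ (field K (f t) x + mag t x v) (gradient (fun w => f t (x, w)) v) = 0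
  initial : f 0 = fin

/-- The decay hypothesis on a magnetic field on `[0, T] × ℝ³`, with exponent `a = 3 / c - 1`. -/
def MagneticDecay (c B₀ T : ℝ) (B : ℝ → Space 3 → Space 3) : Prop :=
  ∀ t ∈ Ioc 0 T,
    (∀ᵐ x, ‖wedge x (B t x)‖ ≤ B₀ * t ^ (-(3 / c - 1))) ∧
    (∀ᵐ x, ‖B t x‖ ≤ B₀ * t ^ (-(3 / c - 1)))

end

end MagneticVlasov

namespace MagneticVlasov

open Filter Topology
open scoped ENNReal

/-! ### Integrals of divergences -/

section Divergence

variable {d : ℕ}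

/-! At fixed x the electric field is constant in v and the magnetic term is linear and skew in v, so
the force has zero divergence in v; free transport has zero divergence in x. Integrating by parts
first in v at fixed x, then in x, avoids characteristics and requires no regularity of the magnetic
field. Testing the equation with a C^1 weight times a cutoff that decreases along the transport
gives the basic inequality `Transported.lintegral_weight_le`. The L^1 bound, the maximum principle
and integral inequalities for all moments follow from it. Because the field is bounded, moments that
are finite initially stay finite; this qualitative bound makes the later Gronwall and barrier
arguments legitimate.

The magnetic force does no work, so the growth of the velocity moment of order k+1 is controlled by
the integral of the local moment of order k against the modulus of the field. Kinetic interpolation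
in v followed by a trilinear Young inequality in x (`interaction_le`) bounds this by powers of
higher moments. The velocity weight may be any function above |v - a(x)|, which allows both ⟨v⟩ and
|v - x/t|.

In dimension two the kernel 1/|z| is cut at a radius depending on the moment itself. Near and far
parts are then both linear in the moment (`planar_interaction_le`), and Gronwall applies.

In dimension three, interpolation with the fourth moment as the only data gives a term of degree
9/7, so smallness is needed. Up to time one a barrier keeps the fourth velocity moment small.
Afterwards the moment of |x - tv|^4 is used: the field contributes with the factor t^(-8/7). The
magnetic term only enters through x ∧ B, because (x - tv) · (tv ∧ B) = (x - tv) · (x ∧ B), and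
contributes t^(-a). Both rates are integrable at infinity since 1 < a ≤ 8/7, so a second barrier
keeps the spread moment below one (`exists_smallness_threshold`). The amplitude of the magnetic
field need not be small: its term is of degree three in x - tv and is absorbed using the small mass.
The resulting uniform control of the density makes the inequality for higher velocity moments
linear, first up to order seven, then, with the seventh moment as input, for all orders
(`exists_isVelocityBound`). Position moments follow from velocity moments by Gronwall. -/

theorem integrable_of_continuous_of_forall_eq_zero {X : Type*} [TopologicalSpace X]
    [MeasurableSpace X] [OpensMeasurableSpace X] [R1Space X] {μ : Measure X}
    [IsFiniteMeasureOnCompacts μ]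
    {u : X → ℝ} (hu : Continuous u) {k : Set X} (hk : IsCompact k) (h0 : ∀ x ∉ k, u x = 0) :
    Integrable u μ :=
  hu.integrable_of_hasCompactSupport (HasCompactSupport.intro hk h0)

theorem integral_fderiv_eq_zero {E : Type*} [NormedAddCommGroup E] [NormedSpace ℝ E]
    [FiniteDimensional ℝ E] [MeasurableSpace E] [BorelSpace E] {μ : Measure E}
    [μ.IsAddHaarMeasure] {h : E → ℝ} (hh : ContDiff ℝ 1 h)
    (hs : HasCompactSupport h) (c : E) : ∫ v, fderiv ℝ h v c ∂μ = 0 := by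
  have hc : Continuous (fun v => fderiv ℝ h v c) :=
    (hh.continuous_fderiv one_ne_zero).clm_apply continuous_const
  have hcs : HasCompactSupport (fun v => fderiv ℝ h v c) := hs.fderiv_apply (𝕜 := ℝ) c
  have := integral_mul_fderiv_eq_neg_fderiv_mul_of_integrable (μ := μ) (f := fun _ : E => (1 : ℝ))
    (g := h) (v := c) (by simp) (by simpa using hc.integrable_of_hasCompactSupport hcs)
    (by simpa using hh.continuous.integrable_of_hasCompactSupport hs)
    (fun x _ => differentiableAt_const _) (fun x _ => hh.differentiable one_ne_zero x)
  simpa using this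

/-- The divergence of a linear field is its trace, and a skew map has zero diagonal in an
orthonormal basis. This is what removes the magnetic force from the balance laws. -/
theorem integral_fderiv_skew_eq_zero {h : Space d → ℝ} (hh : ContDiff ℝ 1 h)
    (hs : HasCompactSupport h) (J : Space d →L[ℝ] Space d) (hJ : ∀ v, inner ℝ (J v) v = 0) :
    ∫ v, fderiv ℝ h v (J v) = 0 := by
  let b := EuclideanSpace.basisFun (Fin d) ℝ
  have hexp : ∀ v, fderiv ℝ h v (J v) = ∑ i, (inner ℝ (b i) (J v)) * fderiv ℝ h v (b i) := by
    intro v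
    conv_lhs => rw [← b.sum_repr' (J v)]
    simp [map_sum]
  have hlin : ∀ i, ContDiff ℝ 1 (fun v => inner ℝ (b i) (J v)) := fun i =>
    contDiff_const.inner ℝ J.contDiff
  have hci : ∀ i, Continuous (fun v => inner ℝ (b i) (J v) * fderiv ℝ h v (b i)) := fun i =>
    (hlin i).continuous.mul ((hh.continuous_fderiv one_ne_zero).clm_apply continuous_const)
  have hint : ∀ i, Integrable (fun v => inner ℝ (b i) (J v) * fderiv ℝ h v (b i)) := fun i =>
    (hci i).integrable_of_hasCompactSupport ((hs.fderiv_apply (𝕜 := ℝ) (b i)).mul_left)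
  simp_rw [hexp]
  rw [integral_finsetSum _ (fun i _ => hint i)]
  refine Finset.sum_eq_zero fun i _ => ?_
  -- The i-th diagonal entry of `J`, which is zero by skewness.
  have hder : ∀ v, fderiv ℝ (fun v => inner ℝ (b i) (J v)) v (b i) = 0 := by
    intro v
    have : HasFDerivAt (fun v => inner ℝ (b i) (J v))
        ((innerSL ℝ (b i)).comp J) v := ((innerSL ℝ (b i)).comp J).hasFDerivAt
    rw [this.fderiv]
    simpa [real_inner_comm] using hJ (b i)
  rw [integral_mul_fderiv_eq_neg_fderiv_mul_of_integrable]
  · simp [hder]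
  · simp [hder]
  · exact hint i
  · exact ((hlin i).continuous.mul hh.continuous).integrable_of_hasCompactSupport hs.mul_left
  · exact fun x _ => (hlin i).differentiable one_ne_zero x
  · exact fun x _ => hh.differentiable one_ne_zero x

theorem contDiff_prodMk_right' {E F : Type*} [NormedAddCommGroup E] [NormedSpace ℝ E]
    [NormedAddCommGroup F] [NormedSpace ℝ F] (x : E) : ContDiff ℝ 1 (fun v : F => (x, v)) :=
  contDiff_const.prodMk contDiff_id

theorem hasFDerivAt_slice_right {E F : Type*} [NormedAddCommGroup E] [NormedSpace ℝ E]
    [NormedAddCommGroup F] [NormedSpace ℝ F] {h : E × F → ℝ} {h' : E × F →L[ℝ] ℝ} {x : E} {v : F}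
    (hh : HasFDerivAt h h' (x, v)) :
    HasFDerivAt (fun w => h (x, w)) (h'.comp (ContinuousLinearMap.inr ℝ E F)) v :=
  hh.comp v (hasFDerivAt_prodMk_right x v)

theorem hasFDerivAt_slice_left {E F : Type*} [NormedAddCommGroup E] [NormedSpace ℝ E]
    [NormedAddCommGroup F] [NormedSpace ℝ F] {h : E × F → ℝ} {h' : E × F →L[ℝ] ℝ} {x : E} {v : F}
    (hh : HasFDerivAt h h' (x, v)) :
    HasFDerivAt (fun y => h (y, v)) (h'.comp (ContinuousLinearMap.inl ℝ E F)) x :=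
  hh.comp x (hasFDerivAt_prodMk_left x v)

theorem hasCompactSupport_slice_right {E F : Type*} [NormedAddCommGroup E] 
    [NormedAddCommGroup F] {h : E × F → ℝ} (hs : HasCompactSupport h) (x : E) :
    HasCompactSupport (fun v => h (x, v)) :=
  HasCompactSupport.intro (hs.isCompact.image continuous_snd) fun v hv => by
    by_contra hne
    exact hv ⟨(x, v), subset_tsupport _ hne, rfl⟩

theorem hasCompactSupport_slice_left {E F : Type*} [NormedAddCommGroup E] 
    [NormedAddCommGroup F] {h : E × F → ℝ} (hs : HasCompactSupport h) (v : F) :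
    HasCompactSupport (fun x => h (x, v)) :=
  HasCompactSupport.intro (hs.isCompact.image continuous_fst) fun x hx => by
    by_contra hne
    exact hx ⟨(x, v), subset_tsupport _ hne, rfl⟩

theorem integral_freeTransport_eq_zero {h : Phase d → ℝ} (hh : ContDiff ℝ 1 h)
    (hs : HasCompactSupport h) : ∫ z, fderiv ℝ h z (z.2, 0) = 0 := by
  have hc : Continuous (fun z : Phase d => fderiv ℝ h z (z.2, 0)) :=
    (hh.continuous_fderiv one_ne_zero).clm_apply (by fun_prop)
  have hcs : HasCompactSupport (fun z : Phase d => fderiv ℝ h z (z.2, 0)) :=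
    (hs.fderiv (𝕜 := ℝ)).mono' fun z hz => subset_tsupport _ fun h0 => hz (by simp [h0])
  rw [show (volume : Measure (Phase d)) = volume.prod volume from rfl, integral_prod_symm]
  · refine integral_eq_zero_of_ae (Eventually.of_forall fun v => ?_)
    have h1 : ∀ x, fderiv ℝ h (x, v) (v, 0) = fderiv ℝ (fun y => h (y, v)) x v := by
      intro x
      rw [(hasFDerivAt_slice_left (hh.differentiable one_ne_zero (x, v)).hasFDerivAt).fderiv]
      simp
    simp only [h1, Pi.zero_apply]
    exact integral_fderiv_eq_zero (hh.comp (contDiff_id.prodMk contDiff_const))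
      (hasCompactSupport_slice_left hs v) v
  · exact hc.integrable_of_hasCompactSupport hcs

/-- Holds with no measurability, since the Bochner integral of a non-integrable function is zero. It
is used for integrands that involve the magnetic field. -/
theorem ofReal_integral_le_lintegral {α : Type*} [MeasurableSpace α] {μ : Measure α} (u : α → ℝ) :
    ENNReal.ofReal (∫ x, u x ∂μ) ≤ ∫⁻ x, ENNReal.ofReal (u x) ∂μ := by
  by_cases hu : Integrable u μ
  · rw [integral_eq_lintegral_pos_part_sub_lintegral_neg_part hu]
    refine (ENNReal.ofReal_le_ofReal (sub_le_self _ ENNReal.toReal_nonneg)).trans ?_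
    exact ENNReal.ofReal_toReal_le
  · simp [integral_undef hu]

end Divergence

/-! ### Balance laws along the transport field -/

section Balance

variable {d : ℕ}

theorem continuous_slice_of_contDiffOn {X : Type*} [NormedAddCommGroup X] [NormedSpace ℝ X]
    {T τ : ℝ} {h : ℝ × X → ℝ}
    (hh : ContinuousOn h (Icc 0 T ×ˢ univ)) (hτ : τ ∈ Icc 0 T) : Continuous fun z => h (τ, z) :=
  hh.comp_continuous (by fun_prop) fun z => ⟨hτ, mem_univ z⟩

theorem slab_mem_nhds {X : Type*} [TopologicalSpace X] {T τ : ℝ} (hτ : τ ∈ Ioo 0 T) (z : X) :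
    Icc 0 T ×ˢ univ ∈ 𝓝 (τ, z) :=
  prod_mem_nhds (Icc_mem_nhds hτ.1 hτ.2) univ_mem

theorem differentiableAt_of_contDiffOn_slab {X : Type*} [NormedAddCommGroup X] [NormedSpace ℝ X]
    {T τ : ℝ} {h : ℝ × X → ℝ} (hh : ContDiffOn ℝ 1 h (Icc 0 T ×ˢ univ)) (hτ : τ ∈ Ioo 0 T)
    (z : X) : DifferentiableAt ℝ h (τ, z) :=
  (hh.contDiffAt (slab_mem_nhds hτ z)).differentiableAt one_ne_zero

theorem contDiff_slice_of_contDiffOn {X : Type*} [NormedAddCommGroup X] [NormedSpace ℝ X]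
    {T τ : ℝ} {h : ℝ × X → ℝ} (hh : ContDiffOn ℝ 1 h (Icc 0 T ×ˢ univ)) (hτ : τ ∈ Icc 0 T) :
    ContDiff ℝ 1 fun z => h (τ, z) := by
  rw [← contDiffOn_univ]
  exact hh.comp (contDiffOn_const.prodMk contDiffOn_id) fun z _ => ⟨hτ, mem_univ _⟩

/-- The time derivative of the integral of a `C^1` function with compact support in phase space. -/
theorem integral_sub_eq_of_compactSupport {X : Type*} [NormedAddCommGroup X] [NormedSpace ℝ X]
    [MeasurableSpace X] [BorelSpace X] [SecondCountableTopology X] {μ : Measure X}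
    [IsFiniteMeasureOnCompacts μ]
    {T : ℝ} {h : ℝ × X → ℝ} (hh : ContDiffOn ℝ 1 h (Icc 0 T ×ˢ univ))
    {k : Set X} (hk : IsCompact k) (h0 : ∀ t ∈ Icc 0 T, ∀ z ∉ k, h (t, z) = 0)
    {s t : ℝ} (hs : 0 ≤ s) (hst : s ≤ t) (ht : t ≤ T) :
    ∫ z, h (t, z) ∂μ - ∫ z, h (s, z) ∂μ
      = ∫ τ in s..t, ∫ z, fderiv ℝ h (τ, z) (1, 0) ∂μ := by
  rcases hst.eq_or_lt with rfl | hst'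
  · simp
  have hT : 0 < T := by linarith
  set S : Set (ℝ × X) := Icc 0 T ×ˢ univ with hS
  have hu : UniqueDiffOn ℝ S := (uniqueDiffOn_Icc hT).prod uniqueDiffOn_univ
  have hkn : ∀ z ∉ k, kᶜ ∈ 𝓝 z := fun z hz => hk.isClosed.isOpen_compl.mem_nhds hz
  -- The derivative within the slab is continuous up to the end times and agrees with `fderiv` at
  -- interior times.
  have hcw : ContinuousOn (fun p => fderivWithin ℝ h S p (1, 0)) S :=
    (hh.continuousOn_fderivWithin hu le_rfl).clm_apply continuousOn_const
  have hw0 : ∀ τ ∈ Icc 0 T, ∀ z ∉ k, fderivWithin ℝ h S (τ, z) (1, 0) = 0 := by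
    intro τ hτ z hz
    have : h =ᶠ[𝓝[S] (τ, z)] fun _ => 0 := by
      have h1 : (univ ×ˢ kᶜ : Set (ℝ × X)) ∈ 𝓝 (τ, z) := prod_mem_nhds univ_mem (hkn z hz)
      filter_upwards [mem_nhdsWithin_of_mem_nhds h1, self_mem_nhdsWithin] with p hp hpS
      exact h0 p.1 hpS.1 p.2 hp.2
    rw [this.fderivWithin_eq (h0 τ hτ z hz)]
    simp
  have heq : ∀ τ ∈ Ioo 0 T, ∀ z, fderivWithin ℝ h S (τ, z) = fderiv ℝ h (τ, z) :=
    fun τ hτ z => fderivWithin_of_mem_nhds (slab_mem_nhds hτ z)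
  have hIoo : Ioo s t ⊆ Ioo 0 T := Ioo_subset_Ioo hs ht
  have hcA : ContinuousOn (fun τ => ∫ z, h (τ, z) ∂μ) (Icc 0 T) :=
    continuousOn_integral_of_compact_support hk (f := fun τ z => h (τ, z)) hh.continuousOn
      fun p x hp hx => h0 p hp x hx
  have hcA' : ContinuousOn (fun τ => ∫ z, fderivWithin ℝ h S (τ, z) (1, 0) ∂μ) (Icc 0 T) :=
    continuousOn_integral_of_compact_support hk
      (f := fun τ z => fderivWithin ℝ h S (τ, z) (1, 0)) hcw
      fun p x hp hx => hw0 p hp x hx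
  have hsub : Icc s t ⊆ Icc 0 T := Icc_subset_Icc hs ht
  have hint : IntervalIntegrable (fun τ => ∫ z, fderivWithin ℝ h S (τ, z) (1, 0) ∂μ) volume s t :=
    (hcA'.mono (by rwa [uIcc_of_le hst])).intervalIntegrable
  obtain ⟨C, hC⟩ := ((isCompact_Icc (a := (0 : ℝ)) (b := T)).prod hk).exists_bound_of_continuousOn
    (hcw.mono (prod_mono le_rfl (subset_univ k)))
  have hder : ∀ τ ∈ Ioo s t, HasDerivAt (fun τ => ∫ z, h (τ, z) ∂μ)
      (∫ z, fderivWithin ℝ h S (τ, z) (1, 0) ∂μ) τ := by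
    intro τ hτ
    refine (hasDerivAt_integral_of_dominated_loc_of_deriv_le (s := Ioo 0 T)
      (F := fun τ z => h (τ, z)) (F' := fun τ z => fderivWithin ℝ h S (τ, z) (1, 0))
      (bound := k.indicator fun _ => C)
      (Ioo_mem_nhds (hIoo hτ).1 (hIoo hτ).2) ?_ ?_ ?_ ?_ ?_ ?_).2
    · filter_upwards [Ioo_mem_nhds (hIoo hτ).1 (hIoo hτ).2] with r hr
      exact (continuous_slice_of_contDiffOn hh.continuousOn
        (Ioo_subset_Icc_self hr)).aestronglyMeasurable
    · exact integrable_of_continuous_of_forall_eq_zero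
        (continuous_slice_of_contDiffOn hh.continuousOn (Ioo_subset_Icc_self (hIoo hτ))) hk
        (h0 τ (Ioo_subset_Icc_self (hIoo hτ)))
    · exact (continuous_slice_of_contDiffOn (h := fun p => fderivWithin ℝ h S p (1, 0)) hcw
        (Ioo_subset_Icc_self (hIoo hτ))).aestronglyMeasurable
    · refine Eventually.of_forall fun z r hr => ?_
      by_cases hz : z ∈ k
      · simpa [hz] using hC (r, z) ⟨Ioo_subset_Icc_self hr, hz⟩
      · simp [hz, hw0 r (Ioo_subset_Icc_self hr) z hz]
    · exact (integrable_indicator_iff hk.measurableSet).2 (integrableOn_const hk.measure_ne_top)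
    · refine Eventually.of_forall fun z r hr => ?_
      rw [heq r hr]
      have h1 := (differentiableAt_of_contDiffOn_slab hh hr z).hasFDerivAt
      have h2 : HasDerivAt (fun r : ℝ => (r, z)) ((1, 0) : ℝ × X) r :=
        (hasDerivAt_id r).prodMk (hasDerivAt_const r z)
      exact h1.comp_hasDerivAt r h2
  rw [← intervalIntegral.integral_eq_sub_of_hasDerivAt_of_le hst (hcA.mono hsub) hder hint]
  rw [intervalIntegral.integral_of_le hst, intervalIntegral.integral_of_le hst,
    integral_Ioc_eq_integral_Ioo, integral_Ioc_eq_integral_Ioo]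
  refine setIntegral_congr_fun measurableSet_Ioo fun τ hτ => ?_
  simp only [heq τ (hIoo hτ)]

/-- Integral form of the balance law along a vector field `(v, -(e + J v))` on phase space with
skew-symmetric `J`, for functions with compact support. No regularity of the coefficients is
needed. -/
theorem integral_le_of_transport {T : ℝ} {h : ℝ × Phase d → ℝ}
    (hh : ContDiffOn ℝ 1 h (Icc 0 T ×ˢ univ))
    {k : Set (Phase d)} (hk : IsCompact k) (h0 : ∀ t ∈ Icc 0 T, ∀ z ∉ k, h (t, z) = 0)
    {e : ℝ → Space d → Space d} {J : ℝ → Space d → Space d →L[ℝ] Space d}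
    (hJ : ∀ t x v, inner ℝ (J t x v) v = 0) {G : ℝ → Phase d → ℝ}
    {s t : ℝ} (hs : 0 ≤ s) (hst : s ≤ t) (ht : t ≤ T)
    (hG : ∀ τ ∈ Ioo s t, ∀ᵐ x, ∀ v,
      fderiv ℝ h (τ, (x, v)) (1, (v, -(e τ x + J τ x v))) ≤ G τ (x, v)) :
    ENNReal.ofReal (∫ z, h (t, z)) ≤ ENNReal.ofReal (∫ z, h (s, z))
      + ∫⁻ τ in Ioo s t, ∫⁻ x, ∫⁻ v, ENNReal.ofReal (G τ (x, v)) := by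
  have key : ∀ τ ∈ Ioo s t, ENNReal.ofReal (∫ z, fderiv ℝ h (τ, z) (1, 0))
      ≤ ∫⁻ x, ∫⁻ v, ENNReal.ofReal (G τ (x, v)) := by
    intro τ hτ
    have hτ0 : τ ∈ Ioo 0 T := Ioo_subset_Ioo hs ht hτ
    have hτ1 := Ioo_subset_Icc_self hτ0
    have hsl := contDiff_slice_of_contDiffOn hh hτ1
    have hslc : HasCompactSupport fun z => h (τ, z) := HasCompactSupport.intro hk (h0 τ hτ1)
    have hfd : ∀ z, HasFDerivAt (fun z => h (τ, z))
        ((fderiv ℝ h (τ, z)).comp (ContinuousLinearMap.inr ℝ ℝ (Phase d))) z := fun z =>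
      hasFDerivAt_slice_right (differentiableAt_of_contDiffOn_slab hh hτ0 z).hasFDerivAt
    have hcd : Continuous fun z => fderiv ℝ h (τ, z) := by
      have h1 : ContinuousOn (fderiv ℝ h) (Ioo 0 T ×ˢ univ) :=
        (hh.mono (prod_mono Ioo_subset_Icc_self le_rfl)).continuousOn_fderiv_of_isOpen
          (isOpen_Ioo.prod isOpen_univ) le_rfl
      exact h1.comp_continuous (by fun_prop) fun z => ⟨hτ0, mem_univ z⟩
    have hz0 : ∀ z ∉ k, fderiv ℝ h (τ, z) = 0 := by
      intro z hz
      have : h =ᶠ[𝓝 (τ, z)] fun _ => 0 := by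
        filter_upwards [prod_mem_nhds (Icc_mem_nhds hτ0.1 hτ0.2)
          (hk.isClosed.isOpen_compl.mem_nhds hz)] with p hp
        exact h0 p.1 hp.1 p.2 hp.2
      rw [this.fderiv_eq]
      simp
    have hcu : Continuous fun z : Phase d => fderiv ℝ h (τ, z) (1, (z.2, 0)) :=
      hcd.clm_apply (by fun_prop)
    have hiu : Integrable fun z : Phase d => fderiv ℝ h (τ, z) (1, (z.2, 0)) :=
      integrable_of_continuous_of_forall_eq_zero hcu hk fun z hz => by simp [hz0 z hz]
    have hi1 : Integrable fun z : Phase d => fderiv ℝ h (τ, z) (1, 0) :=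
      integrable_of_continuous_of_forall_eq_zero (hcd.clm_apply (by fun_prop)) hk
        fun z hz => by simp [hz0 z hz]
    have hi2 : Integrable fun z : Phase d => fderiv ℝ h (τ, z) (0, (z.2, 0)) :=
      integrable_of_continuous_of_forall_eq_zero (hcd.clm_apply (by fun_prop)) hk
        fun z hz => by simp [hz0 z hz]
    -- Free transport integrates to zero over phase space, so it may be added to the time
    -- derivative.
    have e1 : ∫ z, fderiv ℝ h (τ, z) (1, 0)
        = ∫ z : Phase d, fderiv ℝ h (τ, z) (1, (z.2, 0)) := by
      have h1 : ∀ z : Phase d, fderiv ℝ h (τ, z) (1, (z.2, 0))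
          = fderiv ℝ h (τ, z) (1, 0) + fderiv ℝ h (τ, z) (0, (z.2, 0)) := by
        intro z
        rw [← map_add]
        simp
      have h2 : ∫ z : Phase d, fderiv ℝ h (τ, z) (0, (z.2, 0)) = 0 := by
        refine Eq.trans ?_ (integral_freeTransport_eq_zero hsl hslc)
        refine integral_congr_ae (Eventually.of_forall fun z => ?_)
        simp [(hfd z).fderiv]
      simp_rw [h1]
      rw [integral_add hi1 hi2, h2, add_zero]
    rw [e1, show (volume : Measure (Phase d)) = volume.prod volume from rfl, integral_prod _ hiu]
    refine (ofReal_integral_le_lintegral _).trans (lintegral_mono_ae ?_)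
    filter_upwards [hG τ hτ] with x hx
    have hsv : ContDiff ℝ 1 fun v => h (τ, (x, v)) :=
      hsl.comp (contDiff_prodMk_right' x)
    have hsvc : HasCompactSupport fun v => h (τ, (x, v)) := hasCompactSupport_slice_right hslc x
    have hfv : ∀ v w, fderiv ℝ (fun v => h (τ, (x, v))) v w = fderiv ℝ h (τ, (x, v)) (0, (0, w)) := by
      intro v w
      rw [(hasFDerivAt_slice_right (hfd (x, v))).fderiv]
      simp
    have hcv : Continuous fun v => fderiv ℝ (fun v => h (τ, (x, v))) v :=
      hsv.continuous_fderiv one_ne_zero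
    have hcs : HasCompactSupport fun v => fderiv ℝ (fun v => h (τ, (x, v))) v :=
      hsvc.fderiv (𝕜 := ℝ)
    have hie : Integrable fun v => fderiv ℝ (fun v => h (τ, (x, v))) v (e τ x) :=
      (hcv.clm_apply continuous_const).integrable_of_hasCompactSupport
        (hcs.mono' fun v hv => subset_tsupport _ fun hv0 => hv (by simp [hv0]))
    have hiJ : Integrable fun v => fderiv ℝ (fun v => h (τ, (x, v))) v (J τ x v) :=
      (hcv.clm_apply (J τ x).continuous).integrable_of_hasCompactSupport
        (hcs.mono' fun v hv => subset_tsupport _ fun hv0 => hv (by simp [hv0]))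
    have hixu : Integrable fun v => fderiv ℝ h (τ, (x, v)) (1, (v, 0)) :=
      (hcu.comp (by fun_prop : Continuous fun v : Space d => (x, v))).integrable_of_hasCompactSupport
        (hasCompactSupport_slice_right (h := fun z : Phase d => fderiv ℝ h (τ, z) (1, (z.2, 0)))
          (HasCompactSupport.intro hk fun z hz => by simp [hz0 z hz]) x)
    -- The force terms are added at fixed x, where `e` is a constant and `J` a fixed linear map;
    -- their dependence on x is never integrated as an equality.
    have e2 : ∫ v, fderiv ℝ h (τ, (x, v)) (1, (v, 0))
        = ∫ v, fderiv ℝ h (τ, (x, v)) (1, (v, -(e τ x + J τ x v))) := by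
      have h1 : ∀ v, fderiv ℝ h (τ, (x, v)) (1, (v, -(e τ x + J τ x v)))
          = fderiv ℝ h (τ, (x, v)) (1, (v, 0))
            - (fderiv ℝ (fun v => h (τ, (x, v))) v (e τ x)
              + fderiv ℝ (fun v => h (τ, (x, v))) v (J τ x v)) := by
        intro v
        rw [hfv, hfv, ← map_add, ← map_sub]
        simp
      simp_rw [h1]
      have h2 : ∫ v, (fderiv ℝ (fun v => h (τ, (x, v))) v (e τ x)
          + fderiv ℝ (fun v => h (τ, (x, v))) v (J τ x v)) = 0 := by
        rw [integral_add hie hiJ, integral_fderiv_eq_zero hsv hsvc,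
          integral_fderiv_skew_eq_zero hsv hsvc _ (hJ τ x), add_zero]
      have h3 := integral_sub hixu (hie.add hiJ)
      simp only [Pi.add_apply] at h3
      rw [h3, h2, sub_zero]
    rw [e2]
    refine (ofReal_integral_le_lintegral _).trans (lintegral_mono fun v => ?_)
    exact ENNReal.ofReal_le_ofReal (hx v)
  have hmain := integral_sub_eq_of_compactSupport (μ := (volume : Measure (Phase d))) hh hk h0 hs hst ht
  have : ∫ z, h (t, z) = (∫ z, h (s, z)) + ∫ τ in s..t, ∫ z, fderiv ℝ h (τ, z) (1, 0) := by
    linarith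
  rw [this, intervalIntegral.integral_of_le hst, integral_Ioc_eq_integral_Ioo]
  refine ENNReal.ofReal_add_le.trans (add_le_add le_rfl ?_)
  exact (ofReal_integral_le_lintegral _).trans (setLIntegral_mono_ae' measurableSet_Ioo
    (Eventually.of_forall key))

end Balance

/-! ### Smooth weights and derivatives along lines -/

section Weights

/-- The square of the positive part, a nonnegative nondecreasing `C^1` function. -/
noncomputable def posSq (x : ℝ) : ℝ := max x 0 ^ 2

theorem hasDerivAt_posSq (x : ℝ) : HasDerivAt posSq (2 * max x 0) x := by
  rcases lt_trichotomy x 0 with hx | rfl | hx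
  · rw [max_eq_right hx.le]
    refine ((hasDerivAt_const x (0 : ℝ)).congr_of_eventuallyEq ?_).congr_deriv (by simp)
    filter_upwards [Iio_mem_nhds hx] with y hy
    simp [posSq, max_eq_right (le_of_lt (mem_Iio.1 hy))]
  · rw [hasDerivAt_iff_isLittleO_nhds_zero]
    refine Asymptotics.IsLittleO.congr' (f₁ := fun y : ℝ => max y 0 ^ 2) (g₁ := fun y : ℝ => y) ?_
      (by filter_upwards with y; simp [posSq]) (by rfl)
    refine Asymptotics.IsBigO.trans_isLittleO (g := fun y : ℝ => y ^ 2) ?_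
      (by simpa using Asymptotics.isLittleO_pow_id (𝕜 := ℝ) (n := 2) (by norm_num))
    refine Asymptotics.IsBigO.of_bound 1 (Eventually.of_forall fun y => ?_)
    rw [one_mul, Real.norm_of_nonneg (sq_nonneg _), Real.norm_of_nonneg (sq_nonneg _)]
    rcases le_total y 0 with h | h
    · rw [max_eq_right h]
      nlinarith [sq_nonneg y]
    · rw [max_eq_left h]
  · rw [max_eq_left hx.le]
    refine ((hasDerivAt_pow 2 x).congr_of_eventuallyEq ?_).congr_deriv (by simp)
    filter_upwards [Ioi_mem_nhds hx] with y hy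
    simp [posSq, max_eq_left (le_of_lt (mem_Ioi.1 hy))]

theorem contDiff_posSq : ContDiff ℝ 1 posSq := by
  rw [contDiff_one_iff_deriv]
  refine ⟨fun x => (hasDerivAt_posSq x).differentiableAt, ?_⟩
  rw [show deriv posSq = fun x => 2 * max x 0 from funext fun x => (hasDerivAt_posSq x).deriv]
  fun_prop

theorem posSq_nonneg (x : ℝ) : 0 ≤ posSq x := sq_nonneg _

theorem posSq_le_one {x : ℝ} (hx : x ≤ 1) : posSq x ≤ 1 := by
  unfold posSq
  have h1 : max x 0 ≤ 1 := max_le hx zero_le_one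
  exact pow_le_one₀ (le_max_right x 0) h1

theorem posSq_eq_zero_iff {x : ℝ} : posSq x = 0 ↔ x ≤ 0 := by
  simp [posSq]

variable {E : Type*} [NormedAddCommGroup E]

/-- The Japanese bracket `⟨x⟩ = √(1 + |x|²)`. -/
noncomputable def bracket (x : E) : ℝ := √(1 + ‖x‖ ^ 2)

theorem one_le_bracket (x : E) : 1 ≤ bracket x := by
  rw [bracket, Real.one_le_sqrt]
  nlinarith [sq_nonneg ‖x‖]

theorem bracket_pos (x : E) : 0 < bracket x := zero_lt_one.trans_le (one_le_bracket x)

theorem norm_le_bracket (x : E) : ‖x‖ ≤ bracket x :=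
  Real.le_sqrt_of_sq_le (by linarith)

variable [InnerProductSpace ℝ E]

theorem contDiff_bracket : ContDiff ℝ 1 (bracket : E → ℝ) :=
  (contDiff_const.add (contDiff_norm_sq ℝ)).sqrt fun x => by positivity

theorem continuous_bracket : Continuous (bracket : E → ℝ) := contDiff_bracket.continuous

theorem hasDerivAt_bracket {u : ℝ → E} {u' : E} {s : ℝ} (hu : HasDerivAt u u' s) :
    HasDerivAt (fun r => bracket (u r)) (inner ℝ (u s) u' / bracket (u s)) s := by
  have h1 : HasDerivAt (fun r => 1 + ‖u r‖ ^ 2) (2 * inner ℝ (u s) u') s :=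
    (hu.norm_sq).const_add 1
  refine (h1.sqrt (by positivity)).congr_deriv ?_
  unfold bracket
  rw [mul_div_mul_left _ _ two_ne_zero]

theorem abs_inner_div_bracket_le (x y : E) : |inner ℝ x y / bracket x| ≤ ‖y‖ := by
  rw [abs_div, abs_of_pos (bracket_pos x), div_le_iff₀ (bracket_pos x), mul_comm]
  exact (abs_real_inner_le_norm x y).trans
    (mul_le_mul_of_nonneg_right (norm_le_bracket x) (norm_nonneg y))

theorem fderiv_eq_of_hasDerivAt_line {F : Type*} [NormedAddCommGroup F] [NormedSpace ℝ F]
    {φ : F → ℝ} {q w : F} {c : ℝ} (hφ : DifferentiableAt ℝ φ q)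
    (hc : HasDerivAt (fun s : ℝ => φ (q + s • w)) c 0) : fderiv ℝ φ q w = c := by
  have h1 : HasDerivAt (fun s : ℝ => q + s • w) w 0 := by
    simpa using ((hasDerivAt_id (0 : ℝ)).smul_const w).const_add q
  have h2 : HasFDerivAt φ (fderiv ℝ φ q) ((fun s : ℝ => q + s • w) 0) := by
    simpa using hφ.hasFDerivAt
  exact (h2.comp_hasDerivAt 0 h1).unique hc

theorem hasDerivAt_line (x y : E) : HasDerivAt (fun s : ℝ => x + s • y) y 0 := by
  simpa using ((hasDerivAt_id (0 : ℝ)).smul_const y).const_add x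

end Weights

/-! ### Cutoff in phase space and the weighted inequality -/

section Cutoff

variable {d : ℕ}

/-- A cutoff in phase space that decreases along every transport with force at most `C`. -/
noncomputable def cutoff (C R : ℝ) (p : ℝ × Phase d) : ℝ :=
  posSq (1 - (bracket p.2.2 + C * p.1) / R) * posSq (1 - (bracket p.2.1 + R * p.1) / R ^ 2)

theorem contDiff_cutoff (C R : ℝ) : ContDiff ℝ 1 (cutoff (d := d) C R) := by
  unfold cutoff
  have h1 : ContDiff ℝ 1 (fun p : ℝ × Phase d => bracket p.2.2) :=
    contDiff_bracket.comp (contDiff_snd.comp contDiff_snd)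
  have h2 : ContDiff ℝ 1 (fun p : ℝ × Phase d => bracket p.2.1) :=
    contDiff_bracket.comp (contDiff_fst.comp contDiff_snd)
  refine (contDiff_posSq.comp ?_).mul (contDiff_posSq.comp ?_)
  · exact contDiff_const.sub ((h1.add (contDiff_const.mul contDiff_fst)).div_const _)
  · exact contDiff_const.sub ((h2.add (contDiff_const.mul contDiff_fst)).div_const _)

theorem cutoff_nonneg (C R : ℝ) (p : ℝ × Phase d) : 0 ≤ cutoff C R p :=
  mul_nonneg (posSq_nonneg _) (posSq_nonneg _)

theorem cutoff_le_one {C R : ℝ} (hC : 0 ≤ C) (hR : 0 < R) {p : ℝ × Phase d} (hp : 0 ≤ p.1) :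
    cutoff C R p ≤ 1 := by
  refine mul_le_one₀ (posSq_le_one ?_) (posSq_nonneg _) (posSq_le_one ?_)
  · have := bracket_pos p.2.2
    have : 0 ≤ (bracket p.2.2 + C * p.1) / R := by positivity
    linarith
  · have := bracket_pos p.2.1
    have : 0 ≤ (bracket p.2.1 + R * p.1) / R ^ 2 := by positivity
    linarith

theorem cutoff_eq_zero {C R : ℝ} (hC : 0 ≤ C) (hR : 0 < R) {t : ℝ} (ht : 0 ≤ t) {z : Phase d}
    (hz : z ∉ Metric.closedBall (0 : Space d) (R ^ 2) ×ˢ Metric.closedBall (0 : Space d) R) :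
    cutoff C R (t, z) = 0 := by
  simp only [mem_prod, Metric.mem_closedBall, dist_zero_right, not_and_or, not_le] at hz
  unfold cutoff
  rcases hz with h | h
  · refine mul_eq_zero_of_right _ (posSq_eq_zero_iff.2 ?_)
    rw [sub_nonpos, one_le_div (by positivity)]
    have := norm_le_bracket z.1
    have : 0 ≤ R * t := by positivity
    dsimp only
    linarith
  · refine mul_eq_zero_of_left (posSq_eq_zero_iff.2 ?_) _
    rw [sub_nonpos, one_le_div (by positivity)]
    have := norm_le_bracket z.2
    have : 0 ≤ C * t := by positivity
    dsimp only
    linarith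

theorem tendsto_cutoff (C : ℝ) (p : ℝ × Phase d) :
    Tendsto (fun n : ℕ => cutoff C ((n : ℝ) + 1) p) atTop (𝓝 1) := by
  have hn : Tendsto (fun n : ℕ => ((n : ℝ) + 1)⁻¹) atTop (𝓝 0) :=
    tendsto_inv_atTop_zero.comp (tendsto_atTop_add_const_right _ _ tendsto_natCast_atTop_atTop)
  have hp : ContinuousAt posSq 1 := contDiff_posSq.continuous.continuousAt
  have hp1 : posSq 1 = 1 := by simp [posSq]
  have h1 : Tendsto (fun n : ℕ => 1 - (bracket p.2.2 + C * p.1) / ((n : ℝ) + 1)) atTop (𝓝 1) := by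
    simpa [div_eq_mul_inv] using (hn.const_mul (bracket p.2.2 + C * p.1)).const_sub 1
  have h2 : Tendsto (fun n : ℕ => 1 - (bracket p.2.1 + ((n : ℝ) + 1) * p.1) / ((n : ℝ) + 1) ^ 2)
      atTop (𝓝 1) := by
    have h3 : Tendsto (fun n : ℕ => 1 - (bracket p.2.1 * (((n : ℝ) + 1)⁻¹ * ((n : ℝ) + 1)⁻¹)
        + p.1 * ((n : ℝ) + 1)⁻¹)) atTop (𝓝 1) := by
      simpa using (((hn.mul hn).const_mul (bracket p.2.1)).add (hn.const_mul p.1)).const_sub 1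
    refine h3.congr fun n => ?_
    field_simp
  have h4 := (hp.tendsto.comp h1).mul (hp.tendsto.comp h2)
  rw [hp1, one_mul] at h4
  exact h4

/-- Along the transport ⟨v⟩ changes at rate at most C, the skew force doing no work, so ⟨v⟩ + Ct
does not decrease. Likewise ⟨x⟩ changes at rate at most |v|, so ⟨x⟩ + Rt does not decrease as long
as |v| ≤ R. -/
theorem fderiv_cutoff_nonpos {C R : ℝ} (hC : 0 ≤ C) (hR : 0 < R) {t : ℝ} (ht : 0 ≤ t)
    {x v e j : Space d} (he : ‖e‖ ≤ C) (hj : inner ℝ j v = 0) :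
    fderiv ℝ (cutoff C R) (t, (x, v)) (1, (v, -(e + j))) ≤ 0 := by
  have hline : HasDerivAt (fun s : ℝ => cutoff C R ((t, (x, v)) + s • ((1 : ℝ), (v, -(e + j)))))
      (2 * max (1 - (bracket v + C * t) / R) 0
          * (-((inner ℝ v (-(e + j)) / bracket v + C) / R))
          * posSq (1 - (bracket x + R * t) / R ^ 2)
        + posSq (1 - (bracket v + C * t) / R)
          * (2 * max (1 - (bracket x + R * t) / R ^ 2) 0
            * (-((inner ℝ x v / bracket x + R) / R ^ 2)))) 0 := by
    unfold cutoff
    have ht' : HasDerivAt (fun s : ℝ => t + s * 1) 1 0 := by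
      simpa using ((hasDerivAt_id (0 : ℝ)).const_add t)
    have hv := hasDerivAt_bracket (hasDerivAt_line v (-(e + j)))
    have hx := hasDerivAt_bracket (hasDerivAt_line x v)
    have h1 := ((hv.add (ht'.const_mul C)).div_const R).const_sub 1
    have h2 := ((hx.add (ht'.const_mul R)).div_const (R ^ 2)).const_sub 1
    have h3 := (hasDerivAt_posSq _).comp 0 h1
    have h4 := (hasDerivAt_posSq _).comp 0 h2
    have h5 := h3.mul h4
    simp only [zero_smul, add_zero, mul_one, Function.comp_def, Pi.add_apply] at h5
    simp only [Prod.smul_mk, Prod.mk_add_mk, smul_eq_mul, mul_one]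
    exact h5
  rw [fderiv_eq_of_hasDerivAt_line ((contDiff_cutoff C R).differentiable one_ne_zero _) hline]
  have hin : inner ℝ v (-(e + j)) = inner ℝ v (-e) := by
    rw [inner_neg_right, inner_neg_right, inner_add_right, real_inner_comm j v, hj, add_zero]
  have h1 : 0 ≤ inner ℝ v (-(e + j)) / bracket v + C := by
    have := (abs_le.1 (abs_inner_div_bracket_le v (-e))).1
    rw [norm_neg] at this
    rw [hin]
    linarith
  refine add_nonpos ?_ ?_
  · refine mul_nonpos_of_nonpos_of_nonneg ?_ (posSq_nonneg _)
    refine mul_nonpos_of_nonneg_of_nonpos (by positivity) (neg_nonpos.2 (by positivity))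
  -- Where the velocity factor vanishes nothing is required of the position factor; elsewhere |v| ≤
  -- ⟨v⟩ ≤ R.
  · by_cases hv : posSq (1 - (bracket v + C * t) / R) = 0
    · simp [hv]
    · have hv2 : bracket v ≤ R := by
        rw [posSq_eq_zero_iff, not_le, sub_pos, div_lt_one hR] at hv
        have : 0 ≤ C * t := by positivity
        linarith
      have h2 : 0 ≤ inner ℝ x v / bracket x + R := by
        have := (abs_le.1 (abs_inner_div_bracket_le x v)).1
        have := norm_le_bracket v
        linarith
      refine mul_nonpos_of_nonneg_of_nonpos (posSq_nonneg _) ?_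
      exact mul_nonpos_of_nonneg_of_nonpos (by positivity) (neg_nonpos.2 (by positivity))

/-- A nonnegative `C^1` function `g` that is constant along the vector field
`(v, -(e + J v))` on phase space, where `e` is bounded by `C` and `J` is skew-symmetric. -/
structure Transported (T C : ℝ) (e : ℝ → Space d → Space d)
    (J : ℝ → Space d → Space d →L[ℝ] Space d) (g : ℝ × Phase d → ℝ) : Prop where
  contDiffOn : ContDiffOn ℝ 1 g (Icc 0 T ×ˢ univ)
  nonneg : ∀ t ∈ Icc 0 T, ∀ z, 0 ≤ g (t, z)
  skew : ∀ t x v, inner ℝ (J t x v) v = 0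
  bound_nonneg : 0 ≤ C
  bound : ∀ t ∈ Icc 0 T, ∀ x, ‖e t x‖ ≤ C
  transport : ∀ t ∈ Ioo 0 T, ∀ x v, fderiv ℝ g (t, (x, v)) (1, (v, -(e t x + J t x v))) = 0

/-- The balance law is applied to `g * W` times the cutoff: `g` is constant along the transport, the
cutoff decreases and is at most one, so only the derivative of `W` survives. The cutoff is removed
at the end by Fatou's lemma. The bound is needed only for almost every x, matching the essential
bounds on the magnetic field. -/
theorem Transported.lintegral_weight_le {T C : ℝ} {e : ℝ → Space d → Space d}
    {J : ℝ → Space d → Space d →L[ℝ] Space d} {g : ℝ × Phase d → ℝ} (hg : Transported T C e J g)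
    {W : ℝ × Phase d → ℝ} (hW : ContDiffOn ℝ 1 W (Icc 0 T ×ˢ univ))
    (hW0 : ∀ t ∈ Icc 0 T, ∀ z, 0 ≤ W (t, z)) {s t : ℝ} (hs : 0 ≤ s) (hst : s ≤ t) (ht : t ≤ T)
    {G : ℝ → Phase d → ℝ} (hG0 : ∀ τ ∈ Ioo s t, ∀ z, 0 ≤ G τ z)
    (hG : ∀ τ ∈ Ioo s t, ∀ᵐ x, ∀ v,
      fderiv ℝ W (τ, (x, v)) (1, (v, -(e τ x + J τ x v))) ≤ G τ (x, v)) :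
    ∫⁻ z, ENNReal.ofReal (g (t, z) * W (t, z)) ≤ (∫⁻ z, ENNReal.ofReal (g (s, z) * W (s, z)))
      + ∫⁻ τ in Ioo s t, ∫⁻ x, ∫⁻ v, ENNReal.ofReal (g (τ, (x, v)) * G τ (x, v)) := by
  have hsT : s ∈ Icc 0 T := ⟨hs, hst.trans ht⟩
  have htT : t ∈ Icc 0 T := ⟨hs.trans hst, ht⟩
  have hcut : ∀ n : ℕ, ∫⁻ z, ENNReal.ofReal (g (t, z) * W (t, z) * cutoff C ((n : ℝ) + 1) (t, z))
      ≤ (∫⁻ z, ENNReal.ofReal (g (s, z) * W (s, z)))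
      + ∫⁻ τ in Ioo s t, ∫⁻ x, ∫⁻ v, ENNReal.ofReal (g (τ, (x, v)) * G τ (x, v)) := by
    intro n
    have hR : (0 : ℝ) < (n : ℝ) + 1 := by positivity
    set R : ℝ := (n : ℝ) + 1
    set φ : ℝ × Phase d → ℝ := cutoff C R with hφ
    set k : Set (Phase d) :=
      Metric.closedBall (0 : Space d) (R ^ 2) ×ˢ Metric.closedBall (0 : Space d) R
    have hk : IsCompact k := (isCompact_closedBall _ _).prod (isCompact_closedBall _ _)
    have hh : ContDiffOn ℝ 1 (fun p => g p * W p * φ p) (Icc 0 T ×ˢ univ) :=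
      (hg.contDiffOn.mul hW).mul (contDiff_cutoff C R).contDiffOn
    have h0 : ∀ r ∈ Icc 0 T, ∀ z ∉ k, g (r, z) * W (r, z) * φ (r, z) = 0 := fun r hr z hz => by
      rw [hφ, cutoff_eq_zero hg.bound_nonneg hR hr.1 hz, mul_zero]
    have hn : ∀ r ∈ Icc 0 T, ∀ z, 0 ≤ g (r, z) * W (r, z) * φ (r, z) := fun r hr z =>
      mul_nonneg (mul_nonneg (hg.nonneg r hr z) (hW0 r hr z)) (cutoff_nonneg _ _ _)
    have hint : ∀ r ∈ Icc 0 T, Integrable fun z => g (r, z) * W (r, z) * φ (r, z) := fun r hr =>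
      integrable_of_continuous_of_forall_eq_zero
        (continuous_slice_of_contDiffOn hh.continuousOn hr) hk (h0 r hr)
    have hle : ∀ r ∈ Icc 0 T, ∀ z, φ (r, z) ≤ 1 := fun r hr z =>
      cutoff_le_one hg.bound_nonneg hR hr.1
    have key := integral_le_of_transport hh hk h0 (e := e) hg.skew
      (G := fun τ z => g (τ, z) * G τ z) hs hst ht ?_
    · rw [ofReal_integral_eq_lintegral_ofReal (hint t htT) (Eventually.of_forall (hn t htT)),
        ofReal_integral_eq_lintegral_ofReal (hint s hsT) (Eventually.of_forall (hn s hsT))] at key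
      refine key.trans (add_le_add (lintegral_mono fun z => ENNReal.ofReal_le_ofReal ?_) le_rfl)
      exact mul_le_of_le_one_right (mul_nonneg (hg.nonneg s hsT z) (hW0 s hsT z)) (hle s hsT z)
    · intro τ hτ
      filter_upwards [hG τ hτ] with x hx v
      have hτ0 : τ ∈ Ioo 0 T := Ioo_subset_Ioo hs ht hτ
      have hτ1 := Ioo_subset_Icc_self hτ0
      have d1 := (differentiableAt_of_contDiffOn_slab hg.contDiffOn hτ0 (x, v)).hasFDerivAt
      have d2 := (differentiableAt_of_contDiffOn_slab hW hτ0 (x, v)).hasFDerivAt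
      have d3 : HasFDerivAt φ _ (τ, (x, v)) :=
        ((contDiff_cutoff C R).differentiable one_ne_zero (τ, (x, v))).hasFDerivAt
      have d4 := ((d1.mul d2).mul d3).fderiv
      rw [show (fun p => g p * W p * φ p) = (g * W) * φ from rfl, d4]
      have a1 := hg.transport τ hτ0 x v
      have a2 := fderiv_cutoff_nonpos (R := R) hg.bound_nonneg hR hτ1.1 (hg.bound τ hτ1 x)
        (hg.skew τ x v) (x := x)
      have a3 := hx v
      have b1 := hg.nonneg τ hτ1 (x, v)
      have b2 := hW0 τ hτ1 (x, v)
      have b3 : 0 ≤ φ (τ, (x, v)) := cutoff_nonneg _ _ _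
      have b4 := hle τ hτ1 (x, v)
      have b5 := hG0 τ hτ (x, v)
      simp only [add_apply, smul_apply, smul_eq_mul, a1,
        Pi.mul_apply, mul_zero, add_zero]
      have c1 := mul_nonpos_of_nonneg_of_nonpos (mul_nonneg b1 b2) a2
      have c2 := mul_le_mul_of_nonneg_left a3 (mul_nonneg b3 b1)
      have c3 : φ (τ, (x, v)) * (g (τ, (x, v)) * G τ (x, v)) ≤ g (τ, (x, v)) * G τ (x, v) :=
        mul_le_of_le_one_left (mul_nonneg b1 b5) b4
      linarith
  have hlim : ∀ z, Tendsto (fun n : ℕ =>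
      ENNReal.ofReal (g (t, z) * W (t, z) * cutoff C ((n : ℝ) + 1) (t, z))) atTop
      (𝓝 (ENNReal.ofReal (g (t, z) * W (t, z)))) := fun z => by
    simpa using ENNReal.tendsto_ofReal ((tendsto_cutoff C (t, z)).const_mul (g (t, z) * W (t, z)))
  -- Fatou's lemma, as the cutoffs tend to one pointwise.
  calc ∫⁻ z, ENNReal.ofReal (g (t, z) * W (t, z))
      = ∫⁻ z, liminf (fun n : ℕ =>
        ENNReal.ofReal (g (t, z) * W (t, z) * cutoff C ((n : ℝ) + 1) (t, z))) atTop :=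
        lintegral_congr fun z => (hlim z).liminf_eq.symm
    _ ≤ liminf (fun n : ℕ => ∫⁻ z,
        ENNReal.ofReal (g (t, z) * W (t, z) * cutoff C ((n : ℝ) + 1) (t, z))) atTop := by
        refine lintegral_liminf_le fun n => Continuous.measurable ?_
        exact ENNReal.continuous_ofReal.comp
          (((continuous_slice_of_contDiffOn hg.contDiffOn.continuousOn htT).mul
            (continuous_slice_of_contDiffOn hW.continuousOn htT)).mul
            ((contDiff_cutoff _ _).continuous.comp (by fun_prop)))
    _ ≤ _ := liminf_le_of_le (by isBoundedDefault) fun b hb => by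
        obtain ⟨n, hn⟩ := hb.exists
        exact hn.trans (hcut n)

end Cutoff

/-! ### Classical solutions: mass and supremum bounds -/

section Solution

variable {d : ℕ}

theorem real_inner_gradient {E : Type*} [NormedAddCommGroup E] [InnerProductSpace ℝ E]
    [CompleteSpace E] (u : E → ℝ) (x w : E) : inner ℝ w (gradient u x) = fderiv ℝ u x w := by
  rw [real_inner_comm, gradient, InnerProductSpace.toDual_symm_apply]

theorem IsClassicalSolution.exists_transported {K : Space d → ℝ}
    {mag : ℝ → Space d → Space d → Space d} {T : ℝ} {fin : Phase d → ℝ} {f : ℝ → Phase d → ℝ}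
    (hf : IsClassicalSolution K mag T fin f) {J : ℝ → Space d → Space d →L[ℝ] Space d}
    (hJ : ∀ t x v, mag t x v = J t x v) (hskew : ∀ t x v, inner ℝ (J t x v) v = 0) :
    ∃ C, Transported T C (fun t => field K (f t)) J (fun p => f p.1 p.2) := by
  obtain ⟨C, hC⟩ := hf.field_bounded
  refine ⟨max C 0, hf.contDiffOn, hf.nonneg, hskew, le_max_right _ _,
    fun t ht x => (hC t ht x).trans (le_max_left _ _), fun t ht x v => ?_⟩
  have hd := (differentiableAt_of_contDiffOn_slab hf.contDiffOn ht (x, v)).hasFDerivAt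
  set D := fderiv ℝ (fun p : ℝ × Phase d => f p.1 p.2) (t, (x, v))
  have heq := hf.equation t (Ioo_subset_Icc_self ht) x v
  rw [derivWithin_of_mem_nhds (Icc_mem_nhds ht.1 ht.2), hJ, real_inner_gradient,
    real_inner_gradient] at heq
  have h1 : deriv (fun s => f s (x, v)) t = D (1, (0, 0)) := by
    have := (hasFDerivAt_slice_left hd).hasDerivAt.deriv
    simpa [Prod.zero_eq_mk] using this
  have hd2 := hasFDerivAt_slice_right hd
  have h2 := (hasFDerivAt_slice_left hd2).fderiv
  have h3 := (hasFDerivAt_slice_right hd2).fderiv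
  dsimp only at h2 h3
  rw [h1, h2, h3] at heq
  simp only [ContinuousLinearMap.comp_apply, ContinuousLinearMap.inl_apply,
    ContinuousLinearMap.inr_apply] at heq
  rw [← map_add, ← map_sub] at heq
  simpa using heq

/-- Any C^1 function of a transported quantity is transported. This one is made for the maximum
principle: it vanishes exactly where `g ≤ A`. -/
theorem Transported.comp_posSq {T C : ℝ} {e : ℝ → Space d → Space d}
    {J : ℝ → Space d → Space d →L[ℝ] Space d} {g : ℝ × Phase d → ℝ} (hg : Transported T C e J g)
    (A : ℝ) : Transported T C e J (fun p => posSq (g p - A)) := by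
  refine ⟨contDiff_posSq.comp_contDiffOn (hg.contDiffOn.sub contDiffOn_const),
    fun _ _ _ => posSq_nonneg _, hg.skew, hg.bound_nonneg, hg.bound, fun t ht x v => ?_⟩
  have hd := (differentiableAt_of_contDiffOn_slab hg.contDiffOn ht (x, v)).hasFDerivAt
  have h1 := (hasDerivAt_posSq (g (t, (x, v)) - A)).comp_hasFDerivAt (t, (x, v)) (hd.sub_const A)
  have h2 := h1.fderiv
  simp only [Function.comp_def] at h2
  rw [h2, smul_apply, hg.transport t ht x v, smul_zero]

theorem Transported.continuous_slice {T C : ℝ} {e : ℝ → Space d → Space d}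
    {J : ℝ → Space d → Space d →L[ℝ] Space d} {g : ℝ × Phase d → ℝ} (hg : Transported T C e J g)
    {t : ℝ} (ht : t ∈ Icc 0 T) : Continuous fun z => g (t, z) :=
  continuous_slice_of_contDiffOn hg.contDiffOn.continuousOn ht

theorem Transported.lintegral_le {T C : ℝ} {e : ℝ → Space d → Space d}
    {J : ℝ → Space d → Space d →L[ℝ] Space d} {g : ℝ × Phase d → ℝ} (hg : Transported T C e J g)
    {t : ℝ} (ht : t ∈ Icc 0 T) :
    ∫⁻ z, ENNReal.ofReal (g (t, z)) ≤ ∫⁻ z, ENNReal.ofReal (g (0, z)) := by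
  simpa using hg.lintegral_weight_le (W := fun _ => 1) contDiffOn_const (fun _ _ _ => zero_le_one)
    le_rfl ht.1 ht.2 (G := fun _ _ => 0) (fun _ _ _ => le_rfl) (fun τ _ => by simp)

theorem Transported.le_of_ae_le {T C : ℝ} {e : ℝ → Space d → Space d}
    {J : ℝ → Space d → Space d →L[ℝ] Space d} {g : ℝ × Phase d → ℝ} (hg : Transported T C e J g)
    {A : ℝ} (hA : ∀ᵐ z, g (0, z) ≤ A) {t : ℝ} (ht : t ∈ Icc 0 T) (z : Phase d) :
    g (t, z) ≤ A := by
  have h1 := (hg.comp_posSq A).lintegral_le ht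
  have h2 : ∫⁻ z, ENNReal.ofReal (posSq (g (0, z) - A)) = 0 := by
    rw [lintegral_eq_zero_iff' ?_]
    · filter_upwards [hA] with z hz
      simp [posSq_eq_zero_iff.2 (sub_nonpos.2 hz)]
    · exact (ENNReal.continuous_ofReal.comp ((hg.comp_posSq A).continuous_slice
        ⟨le_rfl, ht.1.trans ht.2⟩)).aemeasurable
  have hc : Continuous fun z => ENNReal.ofReal (posSq (g (t, z) - A)) :=
    ENNReal.continuous_ofReal.comp ((hg.comp_posSq A).continuous_slice ht)
  rw [h2, nonpos_iff_eq_zero, lintegral_eq_zero_iff hc.measurable] at h1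
  -- A continuous function that vanishes almost everywhere vanishes everywhere, so the bound is
  -- pointwise.
  have h3 := (hc.ae_eq_iff_eq volume continuous_const).1 h1
  have h4 : ENNReal.ofReal (posSq (g (t, z) - A)) = 0 := congrFun h3 z
  rw [ENNReal.ofReal_eq_zero] at h4
  exact sub_nonpos.1 (posSq_eq_zero_iff.1 (le_antisymm h4 (posSq_nonneg _)))

theorem IsClassicalSolution.bounds {K : Space d → ℝ}
    {mag : ℝ → Space d → Space d → Space d} {T : ℝ} {fin : Phase d → ℝ} {f : ℝ → Phase d → ℝ}
    (hf : IsClassicalSolution K mag T fin f) {J : ℝ → Space d → Space d →L[ℝ] Space d}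
    (hJ : ∀ t x v, mag t x v = J t x v) (hskew : ∀ t x v, inner ℝ (J t x v) v = 0)
    (h1 : MemLp fin 1 volume) (h2 : MemLp fin ⊤ volume) {t : ℝ} (ht : t ∈ Icc 0 T) :
    (∀ z, f t z ≤ (normLinfL1 fin).toReal) ∧
      ∫⁻ z, ENNReal.ofReal (f t z) ≤ ENNReal.ofReal (normLinfL1 fin).toReal := by
  obtain ⟨C, hg⟩ := hf.exists_transported hJ hskew
  have hfin : normLinfL1 fin ≠ ⊤ := ENNReal.add_ne_top.2 ⟨h2.2.ne, h1.2.ne⟩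
  refine ⟨fun z => hg.le_of_ae_le ?_ ht z, (hg.lintegral_le ht).trans ?_⟩
  · have h3 := ae_le_eLpNormEssSup (f := fin) (μ := volume)
    filter_upwards [h3] with z hz
    rw [hf.initial]
    refine (le_abs_self _).trans ?_
    rw [← ENNReal.ofReal_le_iff_le_toReal hfin, ← Real.enorm_eq_ofReal_abs]
    exact hz.trans (by rw [normLinfL1, eLpNorm_exponent_top]; exact le_self_add)
  · dsimp only
    rw [ENNReal.ofReal_toReal hfin, hf.initial]
    refine le_trans ?_ (le_add_self : eLpNorm fin 1 volume ≤ normLinfL1 fin)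
    rw [eLpNorm_one_eq_lintegral_enorm]
    refine lintegral_mono fun z => ?_
    rw [Real.enorm_eq_ofReal_abs]
    exact ENNReal.ofReal_le_ofReal (le_abs_self _)

end Solution

/-! ### Integral inequalities and finiteness of moments -/

section Moments

variable {d : ℕ}

theorem hasDerivAt_bracket_pow {E : Type*} [NormedAddCommGroup E] [InnerProductSpace ℝ E] (n : ℕ)
    (x w : E) : HasDerivAt (fun s : ℝ => bracket (x + s • w) ^ n)
      (n * bracket x ^ (n - 1) * (inner ℝ x w / bracket x)) 0 := by
  have := (hasDerivAt_bracket (hasDerivAt_line x w)).pow n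
  simp only [zero_smul, add_zero] at this
  exact this

theorem contDiff_bracket_snd_pow (n : ℕ) :
    ContDiff ℝ 1 fun p : ℝ × Phase d => bracket p.2.2 ^ n :=
  (contDiff_bracket.comp (contDiff_snd.comp contDiff_snd)).pow n

theorem contDiff_bracket_fst_pow (n : ℕ) :
    ContDiff ℝ 1 fun p : ℝ × Phase d => bracket p.2.1 ^ n :=
  (contDiff_bracket.comp (contDiff_fst.comp contDiff_snd)).pow n

theorem fderiv_bracket_snd_pow (n : ℕ) (t a : ℝ) (x v b w : Space d) :
    fderiv ℝ (fun p : ℝ × Phase d => bracket p.2.2 ^ n) (t, (x, v)) (a, (b, w))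
      = n * bracket v ^ (n - 1) * (inner ℝ v w / bracket v) :=
  fderiv_eq_of_hasDerivAt_line ((contDiff_bracket_snd_pow n).differentiable one_ne_zero _)
    (hasDerivAt_bracket_pow n v w)

theorem fderiv_bracket_fst_pow (n : ℕ) (t a : ℝ) (x v b w : Space d) :
    fderiv ℝ (fun p : ℝ × Phase d => bracket p.2.1 ^ n) (t, (x, v)) (a, (b, w))
      = n * bracket x ^ (n - 1) * (inner ℝ x b / bracket x) :=
  fderiv_eq_of_hasDerivAt_line ((contDiff_bracket_fst_pow n).differentiable one_ne_zero _)
    (hasDerivAt_bracket_pow n x b)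

theorem inner_neg_add_skew {v e j : Space d} (hj : inner ℝ j v = 0) :
    inner ℝ v (-(e + j)) = inner ℝ v (-e) := by
  rw [inner_neg_right, inner_neg_right, inner_add_right, real_inner_comm j v, hj, add_zero]

/-- The magnetic force is orthogonal to v, hence the bound involves the electric field alone. -/
theorem fderiv_bracket_snd_pow_le (n : ℕ) (t : ℝ) {x v e j : Space d} (hj : inner ℝ j v = 0) :
    fderiv ℝ (fun p : ℝ × Phase d => bracket p.2.2 ^ n) (t, (x, v)) (1, (v, -(e + j)))
      ≤ n * bracket v ^ (n - 1) * ‖e‖ := by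
  rw [fderiv_bracket_snd_pow, inner_neg_add_skew hj]
  have := bracket_pos v
  refine mul_le_mul_of_nonneg_left ?_ (by positivity)
  simpa using (le_abs_self _).trans (abs_inner_div_bracket_le v (-e))

theorem pow_pred_mul_le {a b : ℝ} (ha : 0 ≤ a) (hb : 0 ≤ b) (n : ℕ) :
    n * a ^ (n - 1) * b ≤ n * (a ^ n + b ^ n) := by
  rcases n with _ | n
  · simp
  rw [mul_assoc]
  refine mul_le_mul_of_nonneg_left ?_ (by positivity)
  simp only [Nat.add_sub_cancel]
  rcases le_total a b with h | h
  · have := mul_le_mul_of_nonneg_right (pow_le_pow_left₀ ha h n) hb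
    have h2 : 0 ≤ a ^ (n + 1) := by positivity
    rw [pow_succ b]
    linarith
  · have := mul_le_mul_of_nonneg_left h (pow_nonneg ha n)
    have h2 : 0 ≤ b ^ (n + 1) := by positivity
    rw [pow_succ a]
    linarith

/-- The weight depends on x only, so the force `w` is arbitrary; the product ⟨x⟩^(n-1) |v| is split
into pure powers. -/
theorem fderiv_bracket_fst_pow_le (n : ℕ) (t : ℝ) (x v w : Space d) :
    fderiv ℝ (fun p : ℝ × Phase d => bracket p.2.1 ^ n) (t, (x, v)) (1, (v, w))
      ≤ n * (bracket x ^ n + bracket v ^ n) := by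
  rw [fderiv_bracket_fst_pow]
  have hx := bracket_pos x
  refine le_trans (mul_le_mul_of_nonneg_left ?_ (by positivity))
    (pow_pred_mul_le hx.le (bracket_pos v).le n)
  exact ((le_abs_self _).trans (abs_inner_div_bracket_le x v)).trans (norm_le_bracket v)

/-- The moment of order `n` in the Japanese bracket of the velocity. -/
noncomputable def vMoment (n : ℕ) (g : Phase d → ℝ) : ℝ≥0∞ :=
  ∫⁻ z, ENNReal.ofReal (g z * bracket z.2 ^ n)

/-- The moment of order `n` in the Japanese bracket of the position. -/
noncomputable def xMoment (n : ℕ) (g : Phase d → ℝ) : ℝ≥0∞ :=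
  ∫⁻ z, ENNReal.ofReal (g z * bracket z.1 ^ n)

theorem Transported.vMoment_le {T C : ℝ} {e : ℝ → Space d → Space d}
    {J : ℝ → Space d → Space d →L[ℝ] Space d} {g : ℝ × Phase d → ℝ} (hg : Transported T C e J g)
    (n : ℕ) {s t : ℝ} (hs : 0 ≤ s) (hst : s ≤ t) (ht : t ≤ T) :
    vMoment n (fun z => g (t, z)) ≤ vMoment n (fun z => g (s, z))
      + ∫⁻ τ in Ioo s t, ∫⁻ x, ∫⁻ v,
        ENNReal.ofReal (g (τ, (x, v)) * (n * bracket v ^ (n - 1) * ‖e τ x‖)) :=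
  hg.lintegral_weight_le (contDiff_bracket_snd_pow n).contDiffOn
    (fun _ _ z => pow_nonneg (bracket_pos z.2).le n) hs hst ht
    (G := fun τ z => n * bracket z.2 ^ (n - 1) * ‖e τ z.1‖)
    (fun τ _ z => by have := bracket_pos z.2; positivity)
    (fun τ _ => Eventually.of_forall fun x v => fderiv_bracket_snd_pow_le n τ (hg.skew τ x v))

theorem Transported.xMoment_le {T C : ℝ} {e : ℝ → Space d → Space d}
    {J : ℝ → Space d → Space d →L[ℝ] Space d} {g : ℝ × Phase d → ℝ} (hg : Transported T C e J g)
    (n : ℕ) {s t : ℝ} (hs : 0 ≤ s) (hst : s ≤ t) (ht : t ≤ T) :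
    xMoment n (fun z => g (t, z)) ≤ xMoment n (fun z => g (s, z))
      + ∫⁻ τ in Ioo s t, (n * (xMoment n (fun z => g (τ, z)) + vMoment n (fun z => g (τ, z)))) := by
  refine (hg.lintegral_weight_le (contDiff_bracket_fst_pow n).contDiffOn
    (fun _ _ z => pow_nonneg (bracket_pos z.1).le n) hs hst ht
    (G := fun τ z => n * (bracket z.1 ^ n + bracket z.2 ^ n))
    (fun τ _ z => by have := bracket_pos z.1; have := bracket_pos z.2; positivity)
    (fun τ _ => Eventually.of_forall fun x v => fderiv_bracket_fst_pow_le n τ x v _)).trans ?_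
  refine add_le_add le_rfl (setLIntegral_mono' measurableSet_Ioo fun τ hτ => ?_)
  have hτ' : τ ∈ Icc 0 T := ⟨hs.trans hτ.1.le, hτ.2.le.trans ht⟩
  have hc := hg.continuous_slice hτ'
  have hb1 : Continuous fun z : Phase d => bracket z.1 ^ n :=
    (continuous_bracket.comp continuous_fst).pow n
  have hb2 : Continuous fun z : Phase d => bracket z.2 ^ n :=
    (continuous_bracket.comp continuous_snd).pow n
  have hm : Measurable fun z : Phase d =>
      ENNReal.ofReal (g (τ, z) * (n * (bracket z.1 ^ n + bracket z.2 ^ n))) :=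
    (ENNReal.continuous_ofReal.comp (hc.mul (continuous_const.mul (hb1.add hb2)))).measurable
  have hm1 : Measurable fun z : Phase d => ENNReal.ofReal (g (τ, z) * bracket z.1 ^ n) :=
    (ENNReal.continuous_ofReal.comp (hc.mul hb1)).measurable
  rw [← lintegral_prod (fun z : Phase d =>
      ENNReal.ofReal (g (τ, z) * (n * (bracket z.1 ^ n + bracket z.2 ^ n)))) hm.aemeasurable,
    xMoment, vMoment, ← lintegral_add_left hm1, ← lintegral_const_mul' _ _ (by simp)]
  refine lintegral_mono fun z => ?_
  have h0 := hg.nonneg τ hτ' z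
  have h1 : 0 ≤ bracket z.1 ^ n := pow_nonneg (bracket_pos z.1).le n
  have h2 : 0 ≤ bracket z.2 ^ n := pow_nonneg (bracket_pos z.2).le n
  rw [← ENNReal.ofReal_add (by positivity) (by positivity), ← ENNReal.ofReal_natCast,
    ← ENNReal.ofReal_mul (by positivity)]
  exact ENNReal.ofReal_le_ofReal (le_of_eq (by ring))

/-- Exponential growth of an integral with a weight that grows at most exponentially along the
transport. -/
theorem Transported.lintegral_weight_le_exp {T C : ℝ} {e : ℝ → Space d → Space d}
    {J : ℝ → Space d → Space d →L[ℝ] Space d} {g : ℝ × Phase d → ℝ} (hg : Transported T C e J g)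
    {W : Phase d → ℝ} (hW : ContDiff ℝ 1 fun p : ℝ × Phase d => W p.2) (hW0 : ∀ z, 0 ≤ W z)
    {c : ℝ} (hc0 : 0 ≤ c)
    (hD : ∀ τ ∈ Icc 0 T, ∀ x v, fderiv ℝ (fun p : ℝ × Phase d => W p.2) (τ, (x, v))
      (1, (v, -(e τ x + J τ x v))) ≤ c * W (x, v)) {t : ℝ} (ht : t ∈ Icc 0 T) :
    ∫⁻ z, ENNReal.ofReal (g (t, z) * W z)
      ≤ ENNReal.ofReal (Real.exp (c * T)) * ∫⁻ z, ENNReal.ofReal (g (0, z) * W z) := by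
  have hE : ContDiff ℝ 1 fun p : ℝ × Phase d => Real.exp (-c * p.1) :=
    (contDiff_const.mul contDiff_fst).exp
  -- The weight multiplied by exp(-ct) does not increase along the transport.
  have key : ∫⁻ z : Phase d, ENNReal.ofReal (g (t, z) * (Real.exp (-c * t) * W z))
      ≤ ∫⁻ z, ENNReal.ofReal (g (0, z) * W z) := by
    have := hg.lintegral_weight_le
      (W := fun p : ℝ × Phase d => Real.exp (-c * p.1) * W p.2)
      (hE.mul hW).contDiffOn
      (fun t _ z => mul_nonneg (Real.exp_pos _).le (hW0 z))
      le_rfl ht.1 ht.2 (G := fun _ _ => 0) (fun _ _ _ => le_rfl) ?_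
    · simpa using this
    · refine fun τ hτ => Eventually.of_forall fun x v => ?_
      have hτ' : τ ∈ Icc 0 T := ⟨hτ.1.le, hτ.2.le.trans ht.2⟩
      have d1 := (hE.differentiable one_ne_zero (τ, (x, v))).hasFDerivAt
      have d2 := (hW.differentiable one_ne_zero (τ, (x, v))).hasFDerivAt
      have d3 : ∀ w : Phase d, fderiv ℝ (fun p : ℝ × Phase d => Real.exp (-c * p.1)) (τ, (x, v)) (1, w)
          = -c * Real.exp (-c * τ) := by
        intro w
        refine fderiv_eq_of_hasDerivAt_line (hE.differentiable one_ne_zero _) ?_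
        have : HasDerivAt (fun s : ℝ => -c * (τ + s * 1)) (-c) 0 := by
          simpa using ((hasDerivAt_id (0 : ℝ)).const_add τ).const_mul (-c)
        refine this.exp.congr_deriv ?_
        simp [mul_comm]
      have d4 := (d1.mul d2).fderiv
      rw [show (fun p : ℝ × Phase d => Real.exp (-c * p.1) * W p.2)
        = (fun p => Real.exp (-c * p.1)) * (fun p => W p.2) from rfl, d4]
      simp only [add_apply, smul_apply, smul_eq_mul, d3]
      have h4 := mul_le_mul_of_nonneg_left (hD τ hτ' x v) (Real.exp_pos (-c * τ)).le
      linarith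
  refine le_trans ?_ (mul_le_mul' le_rfl key)
  rw [← lintegral_const_mul' _ _ (by simp)]
  refine lintegral_mono fun z => ?_
  rw [← ENNReal.ofReal_mul (Real.exp_pos _).le]
  refine ENNReal.ofReal_le_ofReal ?_
  have h1 : 1 ≤ Real.exp (c * T) * Real.exp (-c * t) := by
    rw [← Real.exp_add, Real.one_le_exp_iff]
    nlinarith [ht.2]
  have h2 : 0 ≤ g (t, z) * W z := mul_nonneg (hg.nonneg t ht z) (hW0 z)
  nlinarith

theorem Transported.fderiv_bracket_snd_pow_le_mul {T C : ℝ} {e : ℝ → Space d → Space d}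
    {J : ℝ → Space d → Space d →L[ℝ] Space d} {g : ℝ × Phase d → ℝ} (hg : Transported T C e J g)
    (n : ℕ) {τ : ℝ} (hτ : τ ∈ Icc 0 T) (x v : Space d) :
    fderiv ℝ (fun p : ℝ × Phase d => bracket p.2.2 ^ n) (τ, (x, v))
      (1, (v, -(e τ x + J τ x v))) ≤ n * C * bracket v ^ n := by
  refine (fderiv_bracket_snd_pow_le n τ (x := x) (e := e τ x) (hg.skew τ x v)).trans ?_
  have hbv := one_le_bracket v
  have h2 : bracket v ^ (n - 1) ≤ bracket v ^ n := pow_le_pow_right₀ hbv (Nat.sub_le n 1)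
  have h3 := hg.bound τ hτ x
  calc n * bracket v ^ (n - 1) * ‖e τ x‖ ≤ n * bracket v ^ n * C := by
        gcongr
    _ = n * C * bracket v ^ n := by ring

/-- The bound depends on the supremum of the field and so is not quantitative; its role is to supply
the finiteness that `gronwall_lintegral` and `barrier_lintegral` assume. -/
theorem Transported.exists_vMoment_bound {T C : ℝ} {e : ℝ → Space d → Space d}
    {J : ℝ → Space d → Space d →L[ℝ] Space d} {g : ℝ × Phase d → ℝ} (hg : Transported T C e J g)
    {n : ℕ} (h0 : vMoment n (fun z => g (0, z)) ≠ ⊤) :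
    ∃ A : ℝ≥0∞, A ≠ ⊤ ∧ ∀ t ∈ Icc 0 T, vMoment n (fun z => g (t, z)) ≤ A :=
  ⟨_, ENNReal.mul_ne_top ENNReal.ofReal_ne_top h0, fun _ ht =>
    hg.lintegral_weight_le_exp (W := fun z => bracket z.2 ^ n) (contDiff_bracket_snd_pow n)
      (fun z => pow_nonneg (bracket_pos z.2).le n)
      (mul_nonneg (Nat.cast_nonneg n) hg.bound_nonneg)
      (fun _ hτ x v => hg.fderiv_bracket_snd_pow_le_mul n hτ x v) ht⟩

/-- The position weight alone does not control its own derivative, but the sum ⟨x⟩^n + ⟨v⟩^n does.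
-/
theorem Transported.exists_xMoment_bound {T C : ℝ} {e : ℝ → Space d → Space d}
    {J : ℝ → Space d → Space d →L[ℝ] Space d} {g : ℝ × Phase d → ℝ} (hg : Transported T C e J g)
    {n : ℕ} (h0 : vMoment n (fun z => g (0, z)) ≠ ⊤) (h1 : xMoment n (fun z => g (0, z)) ≠ ⊤) :
    ∃ A : ℝ≥0∞, A ≠ ⊤ ∧ ∀ t ∈ Icc 0 T, xMoment n (fun z => g (t, z)) ≤ A := by
  have hp1 : ∀ z : Phase d, 0 ≤ bracket z.1 ^ n := fun z => pow_nonneg (bracket_pos z.1).le n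
  have hp2 : ∀ z : Phase d, 0 ≤ bracket z.2 ^ n := fun z => pow_nonneg (bracket_pos z.2).le n
  refine ⟨_, ENNReal.mul_ne_top ENNReal.ofReal_ne_top (ENNReal.add_ne_top.2 ⟨h1, h0⟩),
    fun t ht => le_trans ?_ ((hg.lintegral_weight_le_exp
      (W := fun z => bracket z.1 ^ n + bracket z.2 ^ n)
      ((contDiff_bracket_fst_pow n).add (contDiff_bracket_snd_pow n))
      (fun z => add_nonneg (hp1 z) (hp2 z)) (c := n * (1 + C))
      (mul_nonneg (Nat.cast_nonneg n) (by linarith [hg.bound_nonneg])) ?_ ht).trans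
      (mul_le_mul' le_rfl ?_))⟩
  · exact lintegral_mono fun z => ENNReal.ofReal_le_ofReal
      (mul_le_mul_of_nonneg_left (le_add_of_nonneg_right (hp2 z)) (hg.nonneg t ht z))
  · intro τ hτ x v
    have d1 := ((contDiff_bracket_fst_pow (d := d) n).differentiable one_ne_zero
      (τ, (x, v))).hasFDerivAt
    have d2 := ((contDiff_bracket_snd_pow (d := d) n).differentiable one_ne_zero
      (τ, (x, v))).hasFDerivAt
    have d4 := (d1.add d2).fderiv
    rw [show (fun p : ℝ × Phase d => bracket p.2.1 ^ n + bracket p.2.2 ^ n)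
      = (fun p => bracket p.2.1 ^ n) + (fun p => bracket p.2.2 ^ n) from rfl, d4, add_apply]
    have h2 := hg.fderiv_bracket_snd_pow_le_mul n hτ x v
    have h3 := fderiv_bracket_fst_pow_le n τ x v (-(e τ x + J τ x v))
    have h4 : 0 ≤ n * C * bracket x ^ n :=
      mul_nonneg (mul_nonneg (Nat.cast_nonneg n) hg.bound_nonneg) (hp1 (x, v))
    dsimp only
    linarith
  · have ht0 : (0 : ℝ) ∈ Icc 0 T := ⟨le_rfl, ht.1.trans ht.2⟩
    have hm1 : Measurable fun z : Phase d => ENNReal.ofReal (g (0, z) * bracket z.1 ^ n) :=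
      (ENNReal.continuous_ofReal.comp ((hg.continuous_slice ht0).mul
        ((continuous_bracket.comp continuous_fst).pow n))).measurable
    rw [xMoment, vMoment, ← lintegral_add_left hm1]
    refine lintegral_mono fun z => ?_
    rw [mul_add]
    exact ENNReal.ofReal_add_le

end Moments

/-! ### Trilinear Young inequality -/

section Young

variable {d : ℕ}

/-- Young's inequality for the trilinear convolution form. -/
theorem lintegral_mul_convolution_le {u v w : Space d → ℝ≥0∞} (hu : Measurable u)
    (hv : Measurable v) (hw : Measurable w) {α β γ : ℝ}
    (hα1 : α ≤ 1) (hβ1 : β ≤ 1) (hγ1 : γ ≤ 1) (hsum : α + β + γ = 2) :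
    ∫⁻ x, u x ^ α * ∫⁻ y, v (x - y) ^ β * w y ^ γ
      ≤ (∫⁻ x, u x) ^ α * (∫⁻ x, v x) ^ β * (∫⁻ x, w x) ^ γ := by
  set U := ∫⁻ x, u x
  set V := ∫⁻ x, v x
  set Wt := ∫⁻ x, w x
  -- Hölder with three factors on the product space: since the exponents sum to 2, u^α v^β w^γ =
  -- (vw)^(1-α) (uw)^(1-β) (uv)^(1-γ), and each pairwise product has a factorised integral.
  let a : Fin 3 → Phase d → ℝ≥0∞ :=
    ![fun z => v (z.1 - z.2) * w z.2, fun z => u z.1 * w z.2, fun z => u z.1 * v (z.1 - z.2)]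
  let p : Fin 3 → ℝ := ![1 - α, 1 - β, 1 - γ]
  have hvm : Measurable fun z : Phase d => v (z.1 - z.2) :=
    hv.comp (measurable_fst.sub measurable_snd)
  have hum : Measurable fun z : Phase d => u z.1 := hu.comp measurable_fst
  have hwm : Measurable fun z : Phase d => w z.2 := hw.comp measurable_snd
  have hH := ENNReal.lintegral_prod_norm_pow_le (μ := (volume : Measure (Phase d))) Finset.univ
    (f := a) (p := p) ?_ ?_ ?_
  rotate_left
  · intro i _
    fin_cases i
    · exact (hvm.mul hwm).aemeasurable
    · exact (hum.mul hwm).aemeasurable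
    · exact (hum.mul hvm).aemeasurable
  · simp [Fin.sum_univ_three, p]
    linarith
  · intro i _
    fin_cases i <;> simp [p] <;> assumption
  have i0 : ∫⁻ z : Phase d, v (z.1 - z.2) * w z.2 = V * Wt := by
    rw [show (volume : Measure (Phase d)) = volume.prod volume from rfl,
      lintegral_prod_symm (fun z : Phase d => v (z.1 - z.2) * w z.2) (hvm.mul hwm).aemeasurable]
    have : ∀ y, ∫⁻ x, v (x - y) * w y = V * w y := fun y => by
      have hm : Measurable fun x => v (x - y) := hv.comp (measurable_id.sub_const y)
      rw [lintegral_mul_const _ hm,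
        lintegral_sub_right_eq_self v y]
    simp only [this]
    rw [lintegral_const_mul _ hw]
  have i1 : ∫⁻ z : Phase d, u z.1 * w z.2 = U * Wt := by
    rw [show (volume : Measure (Phase d)) = volume.prod volume from rfl,
      lintegral_prod (fun z : Phase d => u z.1 * w z.2) (hum.mul hwm).aemeasurable]
    have : ∀ x, ∫⁻ y, u x * w y = u x * Wt := fun x => by rw [lintegral_const_mul _ hw]
    simp only [this]
    rw [lintegral_mul_const _ hu]
  have i2 : ∫⁻ z : Phase d, u z.1 * v (z.1 - z.2) = U * V := by
    rw [show (volume : Measure (Phase d)) = volume.prod volume from rfl,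
      lintegral_prod (fun z : Phase d => u z.1 * v (z.1 - z.2)) (hum.mul hvm).aemeasurable]
    have : ∀ x, ∫⁻ y, u x * v (x - y) = u x * V := fun x => by
      have hm : Measurable fun y => v (x - y) := hv.comp (measurable_const.sub measurable_id)
      rw [lintegral_const_mul _ hm, lintegral_sub_left_eq_self v x]
    simp only [this]
    rw [lintegral_mul_const _ hu]
  have hlhs : ∫⁻ x, u x ^ α * ∫⁻ y, v (x - y) ^ β * w y ^ γ
      = ∫⁻ z, ∏ i, a i z ^ p i := by
    have hm : Measurable fun z : Phase d => u z.1 ^ α * (v (z.1 - z.2) ^ β * w z.2 ^ γ) :=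
      (hum.pow_const _).mul ((hvm.pow_const _).mul (hwm.pow_const _))
    have h1 : ∀ z : Phase d, ∏ i, a i z ^ p i
        = u z.1 ^ α * (v (z.1 - z.2) ^ β * w z.2 ^ γ) := by
      intro z
      simp only [Fin.prod_univ_three, a, p, Matrix.cons_val_zero, Matrix.cons_val_one,
        Matrix.cons_val]
      rw [ENNReal.mul_rpow_of_nonneg _ _ (by linarith), ENNReal.mul_rpow_of_nonneg _ _ (by linarith),
        ENNReal.mul_rpow_of_nonneg _ _ (by linarith)]
      rw [show α = (1 - β) + (1 - γ) by linarith,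
        ENNReal.rpow_add_of_nonneg _ _ (by linarith) (by linarith),
        show v (z.1 - z.2) ^ β = v (z.1 - z.2) ^ ((1 - α) + (1 - γ)) by congr 1; linarith,
        ENNReal.rpow_add_of_nonneg _ _ (by linarith) (by linarith),
        show w z.2 ^ γ = w z.2 ^ ((1 - α) + (1 - β)) by congr 1; linarith,
        ENNReal.rpow_add_of_nonneg _ _ (by linarith) (by linarith),
        show (1 - β + (1 - γ)) = α by linarith]
      ring
    simp only [h1]
    rw [show (volume : Measure (Phase d)) = volume.prod volume from rfl,
      lintegral_prod _ hm.aemeasurable]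
    refine lintegral_congr fun x => ?_
    have hm' : Measurable fun y => v (x - y) ^ β * w y ^ γ :=
      ((hv.comp (measurable_const.sub measurable_id)).pow_const _).mul (hw.pow_const _)
    exact (lintegral_const_mul _ hm').symm
  rw [hlhs]
  refine hH.trans (le_of_eq ?_)
  simp only [Fin.prod_univ_three, a, p, Matrix.cons_val_zero, Matrix.cons_val_one,
    Matrix.cons_val, i0, i1, i2]
  rw [ENNReal.mul_rpow_of_nonneg _ _ (by linarith), ENNReal.mul_rpow_of_nonneg _ _ (by linarith),
    ENNReal.mul_rpow_of_nonneg _ _ (by linarith)]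
  rw [show U ^ α = U ^ ((1 - β) + (1 - γ)) by congr 1; linarith,
    ENNReal.rpow_add_of_nonneg _ _ (by linarith) (by linarith),
    show V ^ β = V ^ ((1 - α) + (1 - γ)) by congr 1; linarith,
    ENNReal.rpow_add_of_nonneg _ _ (by linarith) (by linarith),
    show Wt ^ γ = Wt ^ ((1 - α) + (1 - β)) by congr 1; linarith,
    ENNReal.rpow_add_of_nonneg _ _ (by linarith) (by linarith)]
  ring

end Young

/-! ### Kinetic interpolation in velocity -/

section Interpolation

variable {d : ℕ}

/-- The constant of the kinetic interpolation inequality. -/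
noncomputable def interpConst (d : ℕ) : ℝ≥0∞ := volume (Metric.closedBall (0 : Space d) 1) + 1

theorem interpConst_ne_top (d : ℕ) : interpConst d ≠ ⊤ :=
  ENNReal.add_ne_top.2 ⟨(isCompact_closedBall _ _).measure_ne_top, by simp⟩

/-- Where ω ≤ R the point lies in the ball of radius R about `a`, and φ ω^k ≤ A R^k; where ω ≥ R one
trades ω^k for R^(-l) ω^(k+l). -/
theorem lintegral_weight_le_of_radius {φ : Space d → ℝ} (hφ : Measurable φ) (h0 : ∀ v, 0 ≤ φ v)
    {A : ℝ} (hA : ∀ v, φ v ≤ A) {ω : Space d → ℝ} (hω : Measurable ω) {a : Space d}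
    (hωa : ∀ v, ‖v - a‖ ≤ ω v) (k l : ℕ) {R : ℝ} (hR : 0 < R) :
    ∫⁻ v, ENNReal.ofReal (φ v * ω v ^ k)
      ≤ ENNReal.ofReal R ^ (k + d) * (ENNReal.ofReal A * volume (Metric.closedBall (0 : Space d) 1))
        + (ENNReal.ofReal R ^ l)⁻¹ * ∫⁻ v, ENNReal.ofReal (φ v * ω v ^ (k + l)) := by
  have hω0 : ∀ v, 0 ≤ ω v := fun v => (norm_nonneg _).trans (hωa v)
  have hA0 : 0 ≤ A := (h0 a).trans (hA a)
  have hpt : ∀ v, ENNReal.ofReal (φ v * ω v ^ k)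
      ≤ (Metric.closedBall a R).indicator (fun _ => ENNReal.ofReal (A * R ^ k)) v
        + (ENNReal.ofReal R ^ l)⁻¹ * ENNReal.ofReal (φ v * ω v ^ (k + l)) := by
    intro v
    rcases le_total (ω v) R with h | h
    · have hv : v ∈ Metric.closedBall a R := by
        rw [Metric.mem_closedBall, dist_eq_norm]
        exact (hωa v).trans h
      rw [indicator_of_mem hv]
      refine le_add_right (ENNReal.ofReal_le_ofReal ?_)
      exact mul_le_mul (hA v) (pow_le_pow_left₀ (hω0 v) h k) (pow_nonneg (hω0 v) k) hA0
    · refine le_add_left ?_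
      rw [← ENNReal.ofReal_pow hR.le, ← ENNReal.ofReal_inv_of_pos (by positivity),
        ← ENNReal.ofReal_mul (by positivity)]
      refine ENNReal.ofReal_le_ofReal ?_
      have h1 : R ^ l ≤ ω v ^ l := pow_le_pow_left₀ hR.le h l
      have h2 : 0 ≤ φ v * ω v ^ k := mul_nonneg (h0 v) (pow_nonneg (hω0 v) k)
      rw [inv_mul_eq_div, le_div_iff₀ (by positivity), pow_add, ← mul_assoc]
      exact mul_le_mul_of_nonneg_left h1 h2
  have hm : Measurable fun v => ENNReal.ofReal (φ v * ω v ^ (k + l)) :=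
    (hφ.mul (hω.pow_const _)).ennreal_ofReal
  refine (lintegral_mono hpt).trans ?_
  rw [lintegral_add_left (measurable_const.indicator Metric.isClosed_closedBall.measurableSet),
    lintegral_indicator_const Metric.isClosed_closedBall.measurableSet,
    lintegral_const_mul _ hm]
  refine add_le_add (le_of_eq ?_) le_rfl
  rw [Measure.addHaar_closedBall' _ _ hR.le, finrank_euclideanSpace_fin, ENNReal.ofReal_mul hA0,
    ENNReal.ofReal_pow hR.le, ENNReal.ofReal_pow hR.le, pow_add]
  ring

/-- Interpolation of a velocity moment between the supremum of the density and a higher moment. -/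
theorem lintegral_weight_le_interp {φ : Space d → ℝ} (hφ : Measurable φ) (h0 : ∀ v, 0 ≤ φ v)
    {A : ℝ} (hApos : 0 < A) (hA : ∀ v, φ v ≤ A) {ω : Space d → ℝ} (hω : Measurable ω) {a : Space d}
    (hωa : ∀ v, ‖v - a‖ ≤ ω v) (k l : ℕ) (hd : 0 < k + d) :
    ∫⁻ v, ENNReal.ofReal (φ v * ω v ^ k)
      ≤ interpConst d * ENNReal.ofReal A ^ ((l : ℝ) / (k + l + d))
        * (∫⁻ v, ENNReal.ofReal (φ v * ω v ^ (k + l))) ^ (((k : ℝ) + d) / (k + l + d)) := by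
  set m := ∫⁻ v, ENNReal.ofReal (φ v * ω v ^ (k + l))
  set B := ENNReal.ofReal A with hB
  have hB0 : B ≠ 0 := by simpa [hB] using hApos
  have hBt : B ≠ ⊤ := ENNReal.ofReal_ne_top
  set s : ℝ := (k : ℝ) + l + d with hs
  have hkd : (0 : ℝ) < (k : ℝ) + d := by exact_mod_cast hd
  have hs0 : 0 < s := by
    have : (0 : ℝ) ≤ l := Nat.cast_nonneg l
    linarith
  -- Stated for every finite positive upper bound of the moment, so that a vanishing moment is
  -- reached by a limit.
  have key : ∀ m' : ℝ≥0∞, m ≤ m' → m' ≠ 0 → m' ≠ ⊤ → ∫⁻ v, ENNReal.ofReal (φ v * ω v ^ k)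
      ≤ interpConst d * B ^ ((l : ℝ) / s) * m' ^ (((k : ℝ) + d) / s) := by
    intro m' hm h0' ht'
    -- The optimal radius: it balances R^(k+d) B against R^(-l) m'.
    set Q := (m' / B) ^ (1 / s) with hQ
    have hq0 : m' / B ≠ 0 := ENNReal.div_ne_zero.2 ⟨h0', hBt⟩
    have hqt : m' / B ≠ ⊤ := ENNReal.div_ne_top ht' hB0
    have hQt : Q ≠ ⊤ := ENNReal.rpow_ne_top_of_nonneg (by positivity) hqt
    have hQ0 : Q ≠ 0 := by
      rw [hQ, Ne, ENNReal.rpow_eq_zero_iff]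
      simp [hq0, hqt]
    have h := lintegral_weight_le_of_radius hφ h0 hA hω hωa k l (R := Q.toReal)
      (ENNReal.toReal_pos hQ0 hQt)
    rw [ENNReal.ofReal_toReal hQt] at h
    refine h.trans ((add_le_add le_rfl (mul_le_mul' le_rfl hm)).trans (le_of_eq ?_))
    have hBinv0 : B⁻¹ ≠ 0 := ENNReal.inv_ne_zero.2 hBt
    have hBinvt : B⁻¹ ≠ ⊤ := ENNReal.inv_ne_top.2 hB0
    have e1 : Q ^ (k + d) * B = B ^ ((l : ℝ) / s) * m' ^ (((k : ℝ) + d) / s) := by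
      rw [hQ, ← ENNReal.rpow_natCast, ← ENNReal.rpow_mul, ENNReal.div_eq_inv_mul,
        ENNReal.mul_rpow_of_ne_top hBinvt ht', ENNReal.inv_rpow, ← ENNReal.rpow_neg]
      have e3 : (1 / s * ((k + d : ℕ) : ℝ)) = ((k : ℝ) + d) / s := by
        push_cast; ring
      have e4 : B ^ (-(((k : ℝ) + d) / s)) * B = B ^ ((l : ℝ) / s) := by
        nth_rewrite 2 [← ENNReal.rpow_one B]
        rw [← ENNReal.rpow_add _ _ hB0 hBt]
        congr 1
        field_simp
        rw [hs]
        ring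
      rw [e3, ← e4]
      ring
    have e2 : (Q ^ l)⁻¹ * m' = B ^ ((l : ℝ) / s) * m' ^ (((k : ℝ) + d) / s) := by
      rw [hQ, ← ENNReal.rpow_natCast, ← ENNReal.rpow_mul, ENNReal.div_eq_inv_mul,
        ENNReal.mul_rpow_of_ne_top hBinvt ht', ENNReal.inv_rpow, ← ENNReal.rpow_neg,
        ENNReal.mul_inv (Or.inr ?_) (Or.inr ?_), ← ENNReal.rpow_neg, ← ENNReal.rpow_neg, neg_neg,
        mul_assoc]
      · have e3 : (1 / s * ((l : ℕ) : ℝ)) = (l : ℝ) / s := by ring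
        have e4 : m' ^ (-((l : ℝ) / s)) * m' = m' ^ (((k : ℝ) + d) / s) := by
          nth_rewrite 2 [← ENNReal.rpow_one m']
          rw [← ENNReal.rpow_add _ _ h0' ht']
          congr 1
          field_simp
          rw [hs]
          ring
        rw [e3, e4]
      · exact ENNReal.rpow_ne_top_of_nonneg (by positivity) ht'
      · simp [ENNReal.rpow_eq_zero_iff, h0', ht']
    rw [e2, ← mul_assoc, e1, interpConst]
    ring
  have hθ : 0 < ((k : ℝ) + d) / s := by positivity
  rcases eq_or_ne m ⊤ with hm | hm
  · rw [hm, ENNReal.top_rpow_of_pos hθ, ENNReal.mul_top]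
    · exact le_top
    · refine mul_ne_zero (by simp [interpConst]) ?_
      simp [ENNReal.rpow_eq_zero_iff, hB0, hBt]
  rcases eq_or_ne m 0 with hm0 | hm0
  · have hlim : Tendsto (fun m' : ℝ≥0∞ => interpConst d * B ^ ((l : ℝ) / s)
        * m' ^ (((k : ℝ) + d) / s)) (𝓝[>] m) (𝓝 (interpConst d * B ^ ((l : ℝ) / s)
        * m ^ (((k : ℝ) + d) / s))) := by
      refine (ENNReal.Tendsto.const_mul ?_ (Or.inr ?_)).mono_left nhdsWithin_le_nhds
      · exact (ENNReal.continuous_rpow_const.tendsto m)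
      · exact ENNReal.mul_ne_top (interpConst_ne_top d)
          (ENNReal.rpow_ne_top_of_nonneg (by positivity) hBt)
    have : (𝓝[>] m).NeBot := by rw [hm0]; infer_instance
    refine ge_of_tendsto hlim ?_
    have hlt : ∀ᶠ m' in 𝓝[>] m, m' < ⊤ :=
      nhdsWithin_le_nhds (Iio_mem_nhds (hm0 ▸ ENNReal.zero_lt_top))
    filter_upwards [self_mem_nhdsWithin, hlt] with m' h1 h2
    exact key m' (le_of_lt h1) (ne_bot_of_gt h1) h2.ne
  · exact key m le_rfl hm0 hm

end Interpolation

/-! ### Gronwall and barrier inequalities in `[0, ∞]` -/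

section Gronwall

/-- Doubling the rate in the exponential produces the factor 1/2 that makes the Gronwall map a
contraction. -/
theorem lintegral_exp_le {c s t : ℝ} (hc : 0 < c) (hst : s ≤ t) :
    ENNReal.ofReal c * ∫⁻ τ in Ioo s t, ENNReal.ofReal (Real.exp (2 * c * (τ - s)))
      ≤ ENNReal.ofReal (Real.exp (2 * c * (t - s))) / 2 := by
  have hcont : Continuous fun τ : ℝ => Real.exp (2 * c * (τ - s)) := by fun_prop
  have hint : ∫ τ in Ioo s t, Real.exp (2 * c * (τ - s))
      = (Real.exp (2 * c * (t - s)) - 1) / (2 * c) := by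
    rw [← integral_Ioc_eq_integral_Ioo, ← intervalIntegral.integral_of_le hst]
    have hder : ∀ τ ∈ uIcc s t, HasDerivAt (fun τ : ℝ => Real.exp (2 * c * (τ - s)) / (2 * c))
        (Real.exp (2 * c * (τ - s))) τ := by
      intro τ _
      have h1 : HasDerivAt (fun τ : ℝ => 2 * c * (τ - s)) (2 * c) τ := by
        simpa using ((hasDerivAt_id τ).sub_const s).const_mul (2 * c)
      refine (h1.exp.div_const (2 * c)).congr_deriv ?_
      field_simp
    rw [intervalIntegral.integral_eq_sub_of_hasDerivAt hder (hcont.intervalIntegrable _ _)]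
    simp only [sub_self, mul_zero, Real.exp_zero]
    ring
  rw [← ofReal_integral_eq_lintegral_ofReal
    ((hcont.integrableOn_Icc (a := s) (b := t)).mono_set Ioo_subset_Icc_self)
    (Eventually.of_forall fun τ => (Real.exp_pos _).le), hint, ← ENNReal.ofReal_mul hc.le,
    ← ENNReal.ofReal_ofNat 2, ← ENNReal.ofReal_div_of_pos (by norm_num)]
  refine ENNReal.ofReal_le_ofReal ?_
  rw [← mul_div_assoc, mul_comm 2 c, mul_div_mul_left _ _ hc.ne']
  linarith

/-- A Gronwall inequality for bounded functions with values in `[0, ∞]`, without any measurability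
assumption. -/
theorem gronwall_lintegral {M : ℝ → ℝ≥0∞} {s T c : ℝ} {a A : ℝ≥0∞} (hc : 0 < c) (hA : A ≠ ⊤)
    (hMA : ∀ t ∈ Icc s T, M t ≤ A)
    (hM : ∀ t ∈ Icc s T, M t ≤ a + ∫⁻ τ in Ioo s t, ENNReal.ofReal c * M τ) :
    ∀ t ∈ Icc s T, M t ≤ 2 * a * ENNReal.ofReal (Real.exp (2 * c * (t - s))) := by
  set E : ℝ → ℝ≥0∞ := fun t => ENNReal.ofReal (Real.exp (2 * c * (t - s))) with hE
  have hE0 : ∀ t, E t ≠ 0 := fun t => by simp [hE, Real.exp_pos]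
  have hEt : ∀ t, E t ≠ ⊤ := fun t => ENNReal.ofReal_ne_top
  have hE1 : ∀ t ∈ Icc s T, 1 ≤ E t := fun t ht => by
    rw [hE, ENNReal.one_le_ofReal, Real.one_le_exp_iff]
    nlinarith [ht.1]
  -- The norm of `M` weighted by exp(-2c(t - s)). The hypothesis yields N ≤ a + N/2, and N is finite
  -- by the a priori bound, so N ≤ 2a.
  set N : ℝ≥0∞ := ⨆ t ∈ Icc s T, M t / E t with hN
  have hMN : ∀ t ∈ Icc s T, M t ≤ N * E t := fun t ht => by
    rw [← ENNReal.div_le_iff (hE0 t) (hEt t)]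
    exact le_iSup₂ (f := fun t (_ : t ∈ Icc s T) => M t / E t) t ht
  have hNt : N ≠ ⊤ := by
    refine ne_top_of_le_ne_top hA (iSup₂_le fun t ht => ?_)
    exact (ENNReal.div_le_of_le_mul ((hMA t ht).trans (le_mul_of_one_le_right' (hE1 t ht))))
  have hN2 : N ≤ a + N / 2 := by
    refine iSup₂_le fun t ht => ?_
    rw [ENNReal.div_le_iff (hE0 t) (hEt t)]
    have h1 : ∫⁻ τ in Ioo s t, ENNReal.ofReal c * M τ ≤ N * (E t / 2) := by
      calc ∫⁻ τ in Ioo s t, ENNReal.ofReal c * M τ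
          ≤ ∫⁻ τ in Ioo s t, N * (ENNReal.ofReal c * E τ) := by
            refine setLIntegral_mono' measurableSet_Ioo fun τ hτ => ?_
            rw [mul_left_comm]
            exact mul_le_mul' le_rfl (hMN τ ⟨hτ.1.le, hτ.2.le.trans ht.2⟩)
        _ = N * (ENNReal.ofReal c * ∫⁻ τ in Ioo s t, E τ) := by
            rw [lintegral_const_mul' _ _ hNt, lintegral_const_mul' _ _ ENNReal.ofReal_ne_top]
        _ ≤ N * (E t / 2) := mul_le_mul' le_rfl (lintegral_exp_le hc ht.1)
    refine (hM t ht).trans ?_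
    rw [add_mul]
    refine add_le_add (le_mul_of_one_le_right' (hE1 t ht)) (h1.trans (le_of_eq ?_))
    rw [ENNReal.div_eq_inv_mul, ENNReal.div_eq_inv_mul]
    ring
  have hN3 : N ≤ 2 * a := by
    have h4 : N / 2 + N / 2 ≤ a + N / 2 := by rwa [ENNReal.add_halves]
    have h5 : N / 2 ≤ a :=
      (ENNReal.add_le_add_iff_right (ENNReal.div_ne_top hNt two_ne_zero)).1 h4
    rw [ENNReal.div_le_iff two_ne_zero (by simp)] at h5
    rwa [mul_comm]
  exact fun t ht => (hMN t ht).trans (mul_le_mul' hN3 le_rfl)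

/-- A bound for solutions of a nonlinear integral inequality by a barrier. -/
theorem barrier_lintegral {M : ℝ → ℝ≥0∞} {s T : ℝ} {θ : ℝ → ℝ≥0∞} {H : ℝ≥0∞ → ℝ≥0∞}
    {a A δ Θ : ℝ≥0∞} (hH : Monotone H) (hθ : ∀ τ ∈ Ioo s T, θ τ ≤ 1)
    (hΘ : ∫⁻ τ in Ioo s T, θ τ ≤ Θ)
    (hHA : H A ≠ ⊤) (hHδ : H δ ≠ ⊤) (hMA : ∀ t ∈ Icc s T, M t ≤ A)
    (hM : ∀ t ∈ Icc s T, M t ≤ a + ∫⁻ τ in Ioo s t, θ τ * H (M τ))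
    (hlt : a + Θ * H δ < δ) : ∀ t ∈ Icc s T, M t ≤ δ := by
  -- The slack in the strict inequality fixes a step length on which even the crude bound `H A`
  -- costs less than the slack. Continuity of `M` is thus not required.
  obtain ⟨h, hh0, hh⟩ : ∃ h : ℝ, 0 < h ∧ a + Θ * H δ + ENNReal.ofReal h * H A ≤ δ := by
    have hlim : Tendsto (fun h : ℝ => a + Θ * H δ + ENNReal.ofReal h * H A) (𝓝[>] 0)
        (𝓝 (a + Θ * H δ)) := by
      have h1 : Tendsto (fun h : ℝ => ENNReal.ofReal h * H A) (𝓝[>] 0) (𝓝 (0 * H A)) := by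
        refine ENNReal.Tendsto.mul_const ?_ (Or.inr hHA)
        have := (ENNReal.continuous_ofReal.tendsto 0).mono_left (nhdsWithin_le_nhds (s := Ioi 0))
        simpa using this
      simpa using h1.const_add (a + Θ * H δ)
    obtain ⟨h, h1, h2⟩ := ((hlim.eventually (gt_mem_nhds hlt)).and self_mem_nhdsWithin).exists
    exact ⟨h, h2, h1.le⟩
  have step : ∀ k : ℕ, ∀ t ∈ Icc s T, t ≤ s + k * h → M t ≤ δ := by
    intro k
    induction k with
    | zero =>
      intro t ht htk
      have : t = s := le_antisymm (by simpa using htk) ht.1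
      have h1 := hM t ht
      rw [this] at h1 ⊢
      simp only [Ioo_self, Measure.restrict_empty, lintegral_zero_measure, add_zero] at h1
      exact h1.trans ((le_self_add : a ≤ a + Θ * H δ).trans hlt.le)
    | succ k ih =>
      intro t ht htk
      refine (hM t ht).trans (le_trans ?_ hh)
      rw [add_assoc]
      refine add_le_add le_rfl ?_
      -- Before time r the induction hypothesis gives M ≤ δ; on the new step only M ≤ A is known.
      set r := s + k * h
      have hsub : Ioo s t ⊆ (Ioo s T ∩ Iic r) ∪ Ioo r (r + h) := by
        intro τ hτ
        have h2 : r + h = s + (k + 1 : ℕ) * h := by push_cast; ring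
        rcases le_or_gt τ r with h3 | h3
        · exact Or.inl ⟨⟨hτ.1, hτ.2.trans_le ht.2⟩, h3⟩
        · exact Or.inr ⟨h3, by rw [h2]; exact hτ.2.trans_le htk⟩
      have hθH : ∀ τ ∈ Ioo s T, θ τ * H (M τ) ≤ H A := fun τ hτ =>
        (mul_le_mul' (hθ τ hτ) (hH (hMA τ (Ioo_subset_Icc_self hτ)))).trans (by rw [one_mul])
      calc ∫⁻ τ in Ioo s t, θ τ * H (M τ)
          ≤ ∫⁻ τ in (Ioo s T ∩ Iic r) ∪ (Ioo r (r + h) ∩ Ioo s t), θ τ * H (M τ) := by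
            refine lintegral_mono_set fun τ hτ => ?_
            rcases hsub hτ with h4 | h4
            · exact Or.inl h4
            · exact Or.inr ⟨h4, hτ⟩
        _ ≤ (∫⁻ τ in Ioo s T ∩ Iic r, θ τ * H (M τ))
            + ∫⁻ τ in Ioo r (r + h) ∩ Ioo s t, θ τ * H (M τ) :=
            lintegral_union_le _ _ _
        _ ≤ Θ * H δ + ENNReal.ofReal h * H A := by
            refine add_le_add ?_ ?_
            · calc ∫⁻ τ in Ioo s T ∩ Iic r, θ τ * H (M τ)
                  ≤ ∫⁻ τ in Ioo s T ∩ Iic r, θ τ * H δ := by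
                    refine setLIntegral_mono' (measurableSet_Ioo.inter measurableSet_Iic)
                      fun τ hτ => mul_le_mul' le_rfl
                        (hH (ih τ (Ioo_subset_Icc_self hτ.1) hτ.2))
                _ ≤ ∫⁻ τ in Ioo s T, θ τ * H δ := lintegral_mono_set inter_subset_left
                _ = (∫⁻ τ in Ioo s T, θ τ) * H δ := lintegral_mul_const' _ _ hHδ
                _ ≤ Θ * H δ := mul_le_mul' hΘ le_rfl
            · calc ∫⁻ τ in Ioo r (r + h) ∩ Ioo s t, θ τ * H (M τ)
                  ≤ ∫⁻ τ in Ioo r (r + h) ∩ Ioo s t, H A := by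
                    refine setLIntegral_mono' (measurableSet_Ioo.inter measurableSet_Ioo)
                      fun τ hτ => hθH τ ⟨hτ.2.1, hτ.2.2.trans_le ht.2⟩
                _ ≤ ∫⁻ τ in Ioo r (r + h), H A := lintegral_mono_set inter_subset_left
                _ = ENNReal.ofReal h * H A := by
                    rw [setLIntegral_const, Real.volume_Ioo, mul_comm]
                    congr 2
                    ring
  intro t ht
  obtain ⟨k, hk⟩ := exists_nat_ge ((t - s) / h)
  refine step k t ht ?_
  rw [div_le_iff₀ hh0] at hk
  linarith

end Gronwall

/-! ### Gradients of the Coulomb and screened kernels -/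

section Kernels

variable {d : ℕ}

theorem norm_gradient_radial_le {E : Type*} [NormedAddCommGroup E] [InnerProductSpace ℝ E]
    [CompleteSpace E] {φ : ℝ → ℝ} {φ' : ℝ} {z : E} (hz : z ≠ 0) (hφ : HasDerivAt φ φ' ‖z‖) :
    ‖gradient (fun x : E => φ ‖x‖) z‖ ≤ |φ'| := by
  have hn : DifferentiableAt ℝ (fun x : E => ‖x‖) z := differentiableAt_id.norm ℝ hz
  have h1 := (hφ.comp_hasFDerivAt z hn.hasFDerivAt).fderiv
  simp only [Function.comp_def] at h1
  rw [gradient, LinearIsometryEquiv.norm_map, h1, norm_smul, Real.norm_eq_abs]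
  refine mul_le_of_le_one_right (abs_nonneg _) ?_
  simpa using norm_fderiv_le_of_lipschitz ℝ (x₀ := z) (lipschitzWith_one_norm (E := E))

theorem measurable_gradient {E : Type*} [NormedAddCommGroup E] [InnerProductSpace ℝ E]
    [CompleteSpace E] [MeasurableSpace E] [BorelSpace E] (K : E → ℝ) :
    Measurable (gradient K) :=
  (InnerProductSpace.toDual ℝ E).symm.continuous.measurable.comp (measurable_fderiv ℝ K)

/-- At the origin the right-hand side is infinite, so the bound holds at every point. -/
theorem enorm_gradient_coulombKernel_le {σ : ℝ} (hσ : σ = 1 ∨ σ = -1) (z : Space 2) :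
    ‖gradient (coulombKernel σ) z‖ₑ ≤ ‖z‖ₑ⁻¹ := by
  rcases eq_or_ne z 0 with rfl | hz
  · simp
  have hn : 0 < ‖z‖ := norm_pos_iff.2 hz
  have h1 := norm_gradient_radial_le hz
    (((Real.hasDerivAt_log hn.ne').const_mul (1 / (2 * Real.pi))).const_mul σ)
  rw [← ofReal_norm, ← ofReal_norm, ← ENNReal.ofReal_inv_of_pos hn]
  refine ENNReal.ofReal_le_ofReal (h1.trans ?_)
  have hσ1 : |σ| = 1 := by rcases hσ with rfl | rfl <;> simp
  rw [abs_mul, hσ1, one_mul, abs_of_nonneg (by positivity)]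
  refine mul_le_of_le_one_left (by positivity) ?_
  rw [div_le_one (by positivity)]
  linarith [Real.pi_gt_three]

/-- Half of the exponential decay is spent on absorbing the factor 1 + κr from the derivative. -/
theorem norm_gradient_screenedKernel_le {σ κ : ℝ} (hσ : σ = 1 ∨ σ = -1) (hκ : 0 < κ)
    {z : Space 3} (hz : z ≠ 0) :
    ‖gradient (screenedKernel σ κ) z‖ ≤ ‖z‖ ^ (-2 : ℝ) * Real.exp (-(κ / 2) * ‖z‖) := by
  have hn : 0 < ‖z‖ := norm_pos_iff.2 hz
  set r := ‖z‖ with hr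
  have hd : HasDerivAt (fun r : ℝ => σ * (Real.exp (-κ * r) / (4 * Real.pi * r)))
      (σ * ((Real.exp (-κ * r) * (-κ) * (4 * Real.pi * r) - Real.exp (-κ * r) * (4 * Real.pi))
        / (4 * Real.pi * r) ^ 2)) r := by
    have h1 : HasDerivAt (fun r : ℝ => Real.exp (-κ * r)) (Real.exp (-κ * r) * (-κ)) r := by
      simpa using ((hasDerivAt_id r).const_mul (-κ)).exp
    have h2 : HasDerivAt (fun r : ℝ => 4 * Real.pi * r) (4 * Real.pi) r := by
      simpa using (hasDerivAt_id r).const_mul (4 * Real.pi)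
    exact (h1.div h2 (by positivity)).const_mul σ
  refine (norm_gradient_radial_le hz hd).trans ?_
  have hσ1 : |σ| = 1 := by rcases hσ with rfl | rfl <;> simp
  rw [abs_mul, hσ1, one_mul, Real.rpow_neg hn.le, Real.rpow_two]
  have e1 : (Real.exp (-κ * r) * (-κ) * (4 * Real.pi * r) - Real.exp (-κ * r) * (4 * Real.pi))
      / (4 * Real.pi * r) ^ 2 = -((r ^ 2)⁻¹ * ((1 + κ * r) * Real.exp (-κ * r) / (4 * Real.pi))) := by
    field_simp
    ring
  rw [e1, abs_neg, abs_of_nonneg (by positivity)]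
  refine mul_le_mul_of_nonneg_left ?_ (by positivity)
  rw [div_le_iff₀ (by positivity)]
  have e2 : Real.exp (-κ * r) = Real.exp (-(κ / 2) * r) * Real.exp (-(κ / 2) * r) := by
    rw [← Real.exp_add]; congr 1; ring
  have e3 : (1 + κ / 2 * r) * Real.exp (-(κ / 2) * r) ≤ 1 := by
    have := Real.add_one_le_exp (κ / 2 * r)
    calc (1 + κ / 2 * r) * Real.exp (-(κ / 2) * r)
        ≤ Real.exp (κ / 2 * r) * Real.exp (-(κ / 2) * r) := by gcongr; linarith
      _ = 1 := by rw [← Real.exp_add]; simp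
  have e4 : (1 + κ * r) * Real.exp (-(κ / 2) * r) ≤ 2 := by
    have := Real.exp_pos (-(κ / 2) * r)
    nlinarith
  rw [e2]
  have hp := Real.pi_gt_three
  have h0 := Real.exp_pos (-(κ / 2) * r)
  nlinarith

/-- In polar coordinates the integrand is r^(2-2q) times an exponential: q < 3/2 gives integrability
at the origin, and the screening gives it at infinity, also for q close to 1. -/
theorem lintegral_screenedKernel_ne_top {σ κ : ℝ} (hσ : σ = 1 ∨ σ = -1) (hκ : 0 < κ) {q : ℝ}
    (hq0 : 0 < q) (hq : q < 3 / 2) :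
    ∫⁻ z : Space 3, ‖gradient (screenedKernel σ κ) z‖ₑ ^ q ≠ ⊤ := by
  have hint : Integrable fun z : Space 3 =>
      (fun r : ℝ => r ^ (-2 * q) * Real.exp (-(κ / 2 * q) * r)) ‖z‖ := by
    refine (integrable_fun_norm_addHaar volume
      (f := fun r : ℝ => r ^ (-2 * q) * Real.exp (-(κ / 2 * q) * r))).2 ?_
    have h1 := integrableOn_rpow_mul_exp_neg_mul_rpow (s := 2 + -2 * q) (p := 1) (b := κ / 2 * q)
      (by linarith) one_pos (by positivity)
    refine h1.congr_fun (fun r hr => ?_) measurableSet_Ioi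
    have hr : (0 : ℝ) < r := hr
    simp only [finrank_euclideanSpace_fin, smul_eq_mul]
    rw [Real.rpow_add hr, Real.rpow_one, Real.rpow_two, mul_assoc]
  refine ne_top_of_le_ne_top hint.2.ne (lintegral_mono_ae ?_)
  have hae : ∀ᵐ z : Space 3, z ≠ 0 := by
    simp [ae_iff]
  filter_upwards [hae] with z hz
  have hn : 0 < ‖z‖ := norm_pos_iff.2 hz
  rw [← ofReal_norm, ENNReal.ofReal_rpow_of_nonneg (norm_nonneg _) hq0.le, Real.enorm_eq_ofReal_abs]
  refine ENNReal.ofReal_le_ofReal (le_trans ?_ (le_abs_self _))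
  refine (Real.rpow_le_rpow (norm_nonneg _) (norm_gradient_screenedKernel_le hσ hκ hz)
    hq0.le).trans (le_of_eq ?_)
  rw [Real.mul_rpow (by positivity) (by positivity), ← Real.rpow_mul hn.le, ← Real.exp_mul]
  congr 2
  ring

theorem lintegral_ball_norm_inv_rpow_le {q : ℝ} (hq : q < 2) :
    ∃ C : ℝ, 0 ≤ C ∧ ∀ R : ℝ, 0 < R → ∫⁻ z in Metric.ball (0 : Space 2) R, (‖z‖ₑ⁻¹) ^ q
      ≤ ENNReal.ofReal (C * R ^ (2 - q)) := by
  set V : ℝ := (volume : Measure (Space 2)).real (Metric.ball 0 1)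
  refine ⟨2 * V / (2 - q), div_nonneg (by positivity) (by linarith), fun R hR => ?_⟩
  have hI : IntegrableOn (fun y : ℝ => y ^ (1 - q)) (Ioo 0 R) := by
    rw [← intervalIntegrable_iff_integrableOn_Ioo_of_le hR.le]
    exact intervalIntegral.intervalIntegrable_rpow' (by linarith)
  have hpow : ∀ y ∈ Ioo 0 R, y ^ (1 - q) = y ^ (2 - 1) • y ^ (-q) := fun y hy => by
    rw [show 1 - q = 1 + -q by ring, Real.rpow_add hy.1, Real.rpow_one]
    simp
  have hint : IntegrableOn (fun z : Space 2 => (fun r : ℝ => r ^ (-q)) ‖z‖) (Metric.ball 0 R) := by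
    refine (integrableOn_fun_norm_addHaar volume (f := fun r : ℝ => r ^ (-q))).2 ?_
    simp only [finrank_euclideanSpace_fin]
    exact hI.congr_fun hpow measurableSet_Ioo
  have hval : ∫ z in Metric.ball (0 : Space 2) R, ‖z‖ ^ (-q) = 2 * V / (2 - q) * R ^ (2 - q) := by
    have h1 : ∫ z in Metric.ball (0 : Space 2) R, ‖z‖ ^ (-q)
        = ∫ z : Space 2, (Iio R).indicator (fun r : ℝ => r ^ (-q)) ‖z‖ := by
      rw [← integral_indicator Metric.isOpen_ball.measurableSet]
      refine integral_congr_ae (Eventually.of_forall fun z => ?_)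
      simp [indicator]
    rw [h1, integral_fun_norm_addHaar]
    simp only [finrank_euclideanSpace_fin]
    have h2 : ∫ y in Ioi (0 : ℝ), y ^ (2 - 1) • (Iio R).indicator (fun r : ℝ => r ^ (-q)) y
        = ∫ y in Ioo 0 R, y ^ (1 - q) := by
      have h3 : ∀ y : ℝ, y ^ (2 - 1) • (Iio R).indicator (fun r : ℝ => r ^ (-q)) y
          = (Iio R).indicator (fun r : ℝ => r ^ (2 - 1) • r ^ (-q)) y := fun y => by
        by_cases hy : y ∈ Iio R <;> simp [hy]
      simp only [h3]
      rw [setIntegral_indicator measurableSet_Iio, Ioi_inter_Iio]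
      exact setIntegral_congr_fun measurableSet_Ioo fun y hy => (hpow y hy).symm
    rw [h2, ← integral_Ioc_eq_integral_Ioo, ← intervalIntegral.integral_of_le hR.le,
      integral_rpow (Or.inl (by linarith)), show 1 - q + 1 = 2 - q by ring,
      Real.zero_rpow (by linarith)]
    simp only [nsmul_eq_mul, smul_eq_mul, Nat.cast_ofNat, sub_zero]
    ring
  rw [← hval, ofReal_integral_eq_lintegral_ofReal hint
    (Eventually.of_forall fun z => Real.rpow_nonneg (norm_nonneg _) _)]
  have hae : ∀ᵐ z : Space 2, z ≠ 0 := by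
    simp [ae_iff]
  refine lintegral_mono_ae (ae_restrict_of_ae ?_)
  filter_upwards [hae] with z hz
  have hn : 0 < ‖z‖ := norm_pos_iff.2 hz
  rw [← ofReal_norm, ← ENNReal.ofReal_inv_of_pos hn, ENNReal.ofReal_rpow_of_pos (by positivity),
    Real.inv_rpow hn.le, Real.rpow_neg hn.le]

end Kernels

/-! ### Interaction of a moment with the field -/

section Trilinear

variable {d : ℕ}

/-- The interaction of a velocity moment with the modulus of a convolution field. -/
noncomputable def interaction (κ : Space d → ℝ≥0∞) (g ω : Phase d → ℝ) (k : ℕ) : ℝ≥0∞ :=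
  ∫⁻ x, (∫⁻ v, ENNReal.ofReal (g (x, v) * ω (x, v) ^ k))
    * ∫⁻ y, κ (x - y) * ∫⁻ v, ENNReal.ofReal (g (y, v))

theorem lintegral_phase_eq {u : Phase d → ℝ≥0∞} (hu : Measurable u) :
    ∫⁻ z, u z = ∫⁻ x, ∫⁻ v, u (x, v) :=
  lintegral_prod _ hu.aemeasurable

/-- Interpolation at fixed x bounds the local moment of order k by a power of the one of order k+1,
and the density by a power of the local moment of order j, possibly with another weight. The
trilinear Young inequality then needs the kernel in L^(1/β), with β fixed by the requirement that
the exponents sum to 2. -/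
theorem interaction_le {g : Phase d → ℝ} (hg : Continuous g) (h0 : ∀ z, 0 ≤ g z)
    {A : ℝ} (hApos : 0 < A) (hA : ∀ z, g z ≤ A) {ω ω' : Phase d → ℝ} (hω : Continuous ω)
    (hω' : Continuous ω') {a a' : Space d → Space d} (hωa : ∀ x v, ‖v - a x‖ ≤ ω (x, v))
    (hωa' : ∀ x v, ‖v - a' x‖ ≤ ω' (x, v)) {κ : Space d → ℝ≥0∞} (hκ : Measurable κ)
    (k j : ℕ) (hd : 0 < d) {β : ℝ} (hβ0 : 0 < β) (hβ1 : β ≤ 1)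
    (hβ : ((k : ℝ) + d) / (k + 1 + d) + β + (d : ℝ) / (j + d) = 2) :
    interaction κ g ω k
      ≤ interpConst d ^ 2 * (ENNReal.ofReal A ^ (1 / ((k : ℝ) + 1 + d))
          * ENNReal.ofReal A ^ ((j : ℝ) / (j + d)))
        * ((∫⁻ z, ENNReal.ofReal (g z * ω z ^ (k + 1))) ^ (((k : ℝ) + d) / (k + 1 + d))
          * (∫⁻ z, κ z ^ (1 / β)) ^ β
          * (∫⁻ z, ENNReal.ofReal (g z * ω' z ^ j)) ^ ((d : ℝ) / (j + d))) := by
  have hd' : (0 : ℝ) < d := by exact_mod_cast hd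
  have hs : ∀ x : Space d, Continuous fun v : Space d => (x, v) := fun x => by fun_prop
  set u : Space d → ℝ≥0∞ := fun x => ∫⁻ v, ENNReal.ofReal (g (x, v) * ω (x, v) ^ (k + 1))
  set w : Space d → ℝ≥0∞ := fun x => ∫⁻ v, ENNReal.ofReal (g (x, v) * ω' (x, v) ^ j)
  have hum' : Measurable fun z : Phase d => ENNReal.ofReal (g z * ω z ^ (k + 1)) :=
    (hg.mul (hω.pow _)).measurable.ennreal_ofReal
  have hwm' : Measurable fun z : Phase d => ENNReal.ofReal (g z * ω' z ^ j) :=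
    (hg.mul (hω'.pow _)).measurable.ennreal_ofReal
  have hum : Measurable u := hum'.lintegral_prod_right'
  have hwm : Measurable w := hwm'.lintegral_prod_right'
  set α : ℝ := ((k : ℝ) + d) / (k + 1 + d) with hα
  set γ : ℝ := (d : ℝ) / (j + d) with hγ
  set c₁ : ℝ≥0∞ := interpConst d * ENNReal.ofReal A ^ (1 / ((k : ℝ) + 1 + d)) with hc₁
  set c₂ : ℝ≥0∞ := interpConst d * ENNReal.ofReal A ^ ((j : ℝ) / (j + d)) with hc₂
  have h1 : ∀ x, ∫⁻ v, ENNReal.ofReal (g (x, v) * ω (x, v) ^ k) ≤ c₁ * u x ^ α := fun x => by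
    rw [hc₁, one_div]
    simpa using lintegral_weight_le_interp (φ := fun v => g (x, v)) (ω := fun v => ω (x, v))
      (hg.comp (hs x)).measurable (fun v => h0 _) hApos (fun v => hA _)
      (hω.comp (hs x)).measurable (hωa x) k 1 (by omega)
  have h2 : ∀ y, ∫⁻ v, ENNReal.ofReal (g (y, v)) ≤ c₂ * w y ^ γ := fun y => by
    simpa using lintegral_weight_le_interp (φ := fun v => g (y, v)) (ω := fun v => ω' (y, v))
      (hg.comp (hs y)).measurable (fun v => h0 _) hApos (fun v => hA _)
      (hω'.comp (hs y)).measurable (hωa' y) 0 j (by omega)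
  have hc₁t : c₁ ≠ ⊤ := ENNReal.mul_ne_top (interpConst_ne_top d)
    (ENNReal.rpow_ne_top_of_nonneg (by positivity) ENNReal.ofReal_ne_top)
  have hc₂t : c₂ ≠ ⊤ := ENNReal.mul_ne_top (interpConst_ne_top d)
    (ENNReal.rpow_ne_top_of_nonneg (by positivity) ENNReal.ofReal_ne_top)
  have hκβ : ∀ z, (κ z ^ (1 / β)) ^ β = κ z := fun z => by
    rw [← ENNReal.rpow_mul, one_div_mul_cancel hβ0.ne', ENNReal.rpow_one]
  have hα1 : α ≤ 1 := by
    rw [hα, div_le_one (by positivity)]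
    linarith
  have hγ1 : γ ≤ 1 := by
    rw [hγ, div_le_one (by positivity)]
    linarith [Nat.cast_nonneg (α := ℝ) j]
  calc interaction κ g ω k
      ≤ ∫⁻ x, (c₁ * c₂) * (u x ^ α * ∫⁻ y, (κ (x - y) ^ (1 / β)) ^ β * w y ^ γ) := by
        refine lintegral_mono fun x => ?_
        calc _ ≤ (c₁ * u x ^ α) * ∫⁻ y, κ (x - y) * (c₂ * w y ^ γ) :=
              mul_le_mul' (h1 x) (lintegral_mono fun y => mul_le_mul' le_rfl (h2 y))
          _ = (c₁ * u x ^ α) * (c₂ * ∫⁻ y, (κ (x - y) ^ (1 / β)) ^ β * w y ^ γ) := by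
              rw [← lintegral_const_mul' _ _ hc₂t]
              congr 1
              refine lintegral_congr fun y => ?_
              rw [hκβ]
              ring
          _ = _ := by ring
    _ = (c₁ * c₂) * ∫⁻ x, u x ^ α * ∫⁻ y, (κ (x - y) ^ (1 / β)) ^ β * w y ^ γ :=
        lintegral_const_mul' _ _ (ENNReal.mul_ne_top hc₁t hc₂t)
    _ ≤ (c₁ * c₂) * ((∫⁻ x, u x) ^ α * (∫⁻ x, κ x ^ (1 / β)) ^ β * (∫⁻ x, w x) ^ γ) :=
        mul_le_mul' le_rfl (lintegral_mul_convolution_le hum (hκ.pow_const _) hwm hα1 hβ1 hγ1 hβ)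
    _ = _ := by
        rw [lintegral_phase_eq hum', lintegral_phase_eq hwm', hc₁, hc₂]
        ring

theorem enorm_field_le {K : Space d → ℝ} {g : Phase d → ℝ} (h0 : ∀ z, 0 ≤ g z) (x : Space d) :
    ‖field K g x‖ₑ ≤ ∫⁻ y, ‖gradient K (x - y)‖ₑ * ∫⁻ v, ENNReal.ofReal (g (y, v)) := by
  refine (enorm_integral_le_lintegral_enorm _).trans (lintegral_mono fun y => ?_)
  rw [enorm_smul, mul_comm]
  refine mul_le_mul' le_rfl ?_
  rw [density, Real.enorm_eq_ofReal (integral_nonneg fun v => h0 _)]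
  exact ofReal_integral_le_lintegral _

theorem lintegral_weight_mul_field_le {K : Space d → ℝ} {g : Phase d → ℝ}
    (h0 : ∀ z, 0 ≤ g z) {ω : Phase d → ℝ} {c : ℝ} (hc : 0 ≤ c) (k : ℕ) :
    ∫⁻ x, ∫⁻ v, ENNReal.ofReal (g (x, v) * (c * ω (x, v) ^ k * ‖field K g x‖))
      ≤ ENNReal.ofReal c * interaction (fun z => ‖gradient K z‖ₑ) g ω k := by
  rw [interaction, ← lintegral_const_mul' _ _ ENNReal.ofReal_ne_top]
  refine lintegral_mono fun x => ?_
  have h1 : ∀ v, ENNReal.ofReal (g (x, v) * (c * ω (x, v) ^ k * ‖field K g x‖))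
      = (ENNReal.ofReal c * ‖field K g x‖ₑ) * ENNReal.ofReal (g (x, v) * ω (x, v) ^ k) := fun v => by
    rw [← ofReal_norm, ← ENNReal.ofReal_mul hc, ← ENNReal.ofReal_mul (by positivity)]
    congr 1
    ring
  simp only [h1]
  rw [lintegral_const_mul' _ _ (ENNReal.mul_ne_top ENNReal.ofReal_ne_top enorm_ne_top), mul_assoc]
  refine mul_le_mul' le_rfl ?_
  rw [mul_comm]
  exact mul_le_mul' le_rfl (enorm_field_le h0 x)

end Trilinear

/-! ### Comparison of weights and splitting of kernels -/

section General

variable {d : ℕ}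

theorem norm_sub_zero_le_bracket (x v : Space d) : ‖v - (fun _ : Space d => (0 : Space d)) x‖
    ≤ bracket v := by
  simpa using norm_le_bracket v

theorem continuous_bracket_snd : Continuous fun z : Phase d => bracket z.2 :=
  continuous_bracket.comp continuous_snd

theorem continuous_bracket_fst : Continuous fun z : Phase d => bracket z.1 :=
  continuous_bracket.comp continuous_fst

theorem bracket_pow_le {E : Type*} [NormedAddCommGroup E] (n : ℕ) (x : E) :
    bracket x ^ n ≤ 2 ^ n * (1 + ‖x‖ ^ n) := by
  have h1 : bracket x ≤ 2 * max 1 ‖x‖ := by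
    have h2 : bracket x ≤ 1 + ‖x‖ := by
      rw [bracket, Real.sqrt_le_left (by positivity)]
      nlinarith [norm_nonneg x]
    linarith [le_max_left 1 ‖x‖, le_max_right 1 ‖x‖]
  refine (pow_le_pow_left₀ (bracket_pos x).le h1 n).trans ?_
  rw [mul_pow]
  refine mul_le_mul_of_nonneg_left ?_ (by positivity)
  have : 0 ≤ ‖x‖ ^ n := by positivity
  rcases le_total 1 ‖x‖ with h | h
  · rw [max_eq_right h]
    linarith
  · rw [max_eq_left h, one_pow]
    linarith

theorem lintegral_bracket_le {g : Phase d → ℝ} (hg : Measurable g) (h0 : ∀ z, 0 ≤ g z) (n : ℕ)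
    (π : Phase d → Space d) :
    ∫⁻ z, ENNReal.ofReal (g z * bracket (π z) ^ n)
      ≤ 2 ^ n * ((∫⁻ z, ENNReal.ofReal (g z)) + ∫⁻ z, ENNReal.ofReal (‖π z‖ ^ n * g z)) := by
  rw [← lintegral_add_left hg.ennreal_ofReal, ← lintegral_const_mul' _ _ (by simp)]
  refine lintegral_mono fun z => ?_
  have h2 : (2 : ℝ≥0∞) ^ n = ENNReal.ofReal (2 ^ n) := by simp [ENNReal.ofReal_pow]
  rw [← ENNReal.ofReal_add (h0 z) (mul_nonneg (by positivity) (h0 z)), h2,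
    ← ENNReal.ofReal_mul (by positivity)]
  refine ENNReal.ofReal_le_ofReal ?_
  have := mul_le_mul_of_nonneg_left (bracket_pow_le n (π z)) (h0 z)
  linarith

theorem velocityMoment_le_vMoment {g : Phase d → ℝ} (h0 : ∀ z, 0 ≤ g z) (n : ℕ) :
    velocityMoment n g ≤ vMoment n g :=
  lintegral_mono fun z => ENNReal.ofReal_le_ofReal <| by
    rw [mul_comm]
    exact mul_le_mul_of_nonneg_left (pow_le_pow_left₀ (norm_nonneg _) (norm_le_bracket _) n) (h0 z)

theorem positionMoment_le_xMoment {g : Phase d → ℝ} (h0 : ∀ z, 0 ≤ g z) (n : ℕ) :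
    positionMoment n g ≤ xMoment n g :=
  lintegral_mono fun z => ENNReal.ofReal_le_ofReal <| by
    rw [mul_comm]
    exact mul_le_mul_of_nonneg_left (pow_le_pow_left₀ (norm_nonneg _) (norm_le_bracket _) n) (h0 z)

/-- A bounded part of the kernel sees the density only through the total mass. -/
theorem interaction_add_const_le {g : Phase d → ℝ} (hg : Continuous g) {ω : Phase d → ℝ}
    (hω : Continuous ω) {κ κ₁ : Space d → ℝ≥0∞} {c : ℝ≥0∞} (hκ₁ : Measurable κ₁)
    (hc : c ≠ ⊤) (hκ : ∀ z, κ z ≤ κ₁ z + c) (k : ℕ) :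
    interaction κ g ω k ≤ interaction κ₁ g ω k
      + c * ((∫⁻ z, ENNReal.ofReal (g z)) * ∫⁻ z, ENNReal.ofReal (g z * ω z ^ k)) := by
  have hgm : Measurable fun z : Phase d => ENNReal.ofReal (g z) := hg.measurable.ennreal_ofReal
  have hgω : Measurable fun z : Phase d => ENNReal.ofReal (g z * ω z ^ k) :=
    (hg.mul (hω.pow k)).measurable.ennreal_ofReal
  have hm : Measurable fun x => ∫⁻ v, ENNReal.ofReal (g (x, v) * ω (x, v) ^ k) :=
    hgω.lintegral_prod_right'
  have hρ : Measurable fun y => ∫⁻ v, ENNReal.ofReal (g (y, v)) := hgm.lintegral_prod_right'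
  have hin : ∀ x, ∫⁻ y, κ (x - y) * ∫⁻ v, ENNReal.ofReal (g (y, v))
      ≤ (∫⁻ y, κ₁ (x - y) * ∫⁻ v, ENNReal.ofReal (g (y, v)))
        + c * ∫⁻ z, ENNReal.ofReal (g z) := by
    intro x
    have hm1 : Measurable fun y => κ₁ (x - y) * ∫⁻ v, ENNReal.ofReal (g (y, v)) :=
      (hκ₁.comp (measurable_const.sub measurable_id)).mul hρ
    rw [lintegral_phase_eq hgm, ← lintegral_const_mul' _ _ hc, ← lintegral_add_left hm1]
    refine lintegral_mono fun y => ?_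
    rw [← add_mul]
    exact mul_le_mul' (hκ _) le_rfl
  calc interaction κ g ω k
      ≤ ∫⁻ x, ((∫⁻ v, ENNReal.ofReal (g (x, v) * ω (x, v) ^ k))
          * ((∫⁻ y, κ₁ (x - y) * ∫⁻ v, ENNReal.ofReal (g (y, v)))
            + c * ∫⁻ z, ENNReal.ofReal (g z))) :=
        lintegral_mono fun x => mul_le_mul' le_rfl (hin x)
    _ = interaction κ₁ g ω k
        + ∫⁻ x, (∫⁻ v, ENNReal.ofReal (g (x, v) * ω (x, v) ^ k))
          * (c * ∫⁻ z, ENNReal.ofReal (g z)) := by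
        simp only [mul_add]
        rw [lintegral_add_right _ (hm.mul_const _)]
        rfl
    _ = _ := by
        rw [lintegral_mul_const _ hm, ← lintegral_phase_eq hgω]
        ring

end General

/-! ### The interaction in dimension two -/

section Planar

/-- The planar vector product with a fixed field strength, as a linear map. -/
noncomputable def planarWedgeCLM (β : ℝ) : Space 2 →L[ℝ] Space 2 :=
  LinearMap.toContinuousLinearMap
    { toFun := fun v => planarWedge v β
      map_add' := fun v w => by
        ext i
        fin_cases i <;> simp [planarWedge] <;> ring
      map_smul' := fun c v => by
        ext i
        fin_cases i <;> simp [planarWedge] <;> ring }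

theorem planarWedgeCLM_apply (β : ℝ) (v : Space 2) : planarWedgeCLM β v = planarWedge v β := rfl

theorem inner_planarWedge (β : ℝ) (v : Space 2) : inner ℝ (planarWedgeCLM β v) v = 0 := by
  rw [planarWedgeCLM_apply]
  simp [planarWedge, PiLp.inner_apply, Fin.sum_univ_two]
  ring

/-- The gradient 1/|z| has no integrable power on the whole plane, so it is cut at a radius R. The
near part is handled by interpolation, the far part by the mass, and the choice of R makes both
linear in the moment of order k+1. -/
theorem planar_interaction_le (k : ℕ) {A : ℝ} (hA : 0 < A) : ∃ C : ℝ≥0∞, C ≠ ⊤ ∧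
    ∀ (σ : ℝ) (g : Phase 2 → ℝ), (σ = 1 ∨ σ = -1) → Continuous g → (∀ z, 0 ≤ g z) →
      (∀ z, g z ≤ A) → (∫⁻ z, ENNReal.ofReal (g z) ≤ ENNReal.ofReal A) →
      vMoment (k + 1) g ≠ ⊤ →
      interaction (fun z => ‖gradient (coulombKernel σ) z‖ₑ) g (fun z => bracket z.2) k
        ≤ C * (vMoment (k + 1) g + 1) := by
  have hk3 : (0 : ℝ) < (k : ℝ) + 3 := by positivity
  have hk2 : (0 : ℝ) < (k : ℝ) + 2 := by positivity
  have hk1 : (0 : ℝ) < (k : ℝ) + 1 := by positivity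
  -- The exponent 1/β that Young's inequality prescribes for j = k+1; it is below 2, so |z|^(-q) is
  -- locally integrable.
  set q : ℝ := ((k : ℝ) + 3) / (k + 2) with hq
  set β : ℝ := ((k : ℝ) + 2) / (k + 3) with hβ
  have hβ0 : 0 < β := by positivity
  have hq2 : q < 2 := by
    rw [hq, div_lt_iff₀ hk2]
    linarith
  obtain ⟨D, hD0, hD⟩ := lintegral_ball_norm_inv_rpow_le hq2
  set Ae := ENNReal.ofReal A
  refine ⟨interpConst 2 ^ 2 * (Ae ^ (1 / ((k : ℝ) + 1 + (2 : ℕ)))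
      * Ae ^ (((k + 1 : ℕ) : ℝ) / ((k + 1 : ℕ) + (2 : ℕ)))) * ENNReal.ofReal (D ^ β)
      + Ae * (Ae + 1), ?_, ?_⟩
  · refine ENNReal.add_ne_top.2 ⟨ENNReal.mul_ne_top (ENNReal.mul_ne_top
      (ENNReal.pow_ne_top (interpConst_ne_top 2)) (ENNReal.mul_ne_top ?_ ?_)) (by simp),
      ENNReal.mul_ne_top ENNReal.ofReal_ne_top (by simp [Ae])⟩
    · exact ENNReal.rpow_ne_top_of_nonneg (by positivity) ENNReal.ofReal_ne_top
    · exact ENNReal.rpow_ne_top_of_nonneg (by positivity) ENNReal.ofReal_ne_top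
  intro σ g hσ hg h0 hgA hgm hMt
  set M := vMoment (k + 1) g with hM
  have hLt : M + 1 ≠ ⊤ := by simp [hMt]
  set L : ℝ := (M + 1).toReal with hL
  have hL' : ENNReal.ofReal L = M + 1 := ENNReal.ofReal_toReal hLt
  have hL1 : 1 ≤ L := by
    rw [hL, ← ENNReal.ofReal_le_iff_le_toReal hLt]
    simp
  have hL0 : 0 < L := by linarith
  -- The near part scales as L^((k+4)/(k+3)) R^((k+1)/(k+3)), which is L for this radius. The shift
  -- L = M + 1 keeps R well defined when M vanishes.
  set R : ℝ := L ^ (-(1 / ((k : ℝ) + 1))) with hR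
  have hR0 : 0 < R := by positivity
  set κ₁ : Space 2 → ℝ≥0∞ := (Metric.ball 0 R).indicator fun z => ‖z‖ₑ⁻¹ with hκ₁
  have hκ₁m : Measurable κ₁ :=
    (measurable_enorm.inv).indicator Metric.isOpen_ball.measurableSet
  have hsplit : ∀ z, ‖gradient (coulombKernel σ) z‖ₑ ≤ κ₁ z + ENNReal.ofReal R⁻¹ := by
    intro z
    refine (enorm_gradient_coulombKernel_le hσ z).trans ?_
    by_cases hz : z ∈ Metric.ball (0 : Space 2) R
    · rw [hκ₁, indicator_of_mem hz]
      exact le_self_add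
    · refine le_add_left ?_
      rw [ENNReal.ofReal_inv_of_pos hR0, ENNReal.inv_le_inv, ← ofReal_norm]
      refine ENNReal.ofReal_le_ofReal ?_
      simpa using hz
  refine (interaction_add_const_le hg continuous_bracket_snd hκ₁m ENNReal.ofReal_ne_top hsplit
    k).trans ?_
  rw [add_mul]
  refine add_le_add ?_ ?_
  · refine (interaction_le hg h0 hA hgA continuous_bracket_snd continuous_bracket_snd
      norm_sub_zero_le_bracket norm_sub_zero_le_bracket hκ₁m k (k + 1) two_pos (β := β) hβ0 ?_
      ?_).trans ?_
    · rw [hβ, div_le_one hk3]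
      linarith
    · rw [hβ]
      push_cast
      field_simp
      ring
    · rw [mul_assoc _ (ENNReal.ofReal (D ^ β))]
      refine mul_le_mul' le_rfl ?_
      have hMle : M ≤ ENNReal.ofReal L := hL' ▸ le_self_add
      have hnear : (∫⁻ z, κ₁ z ^ (1 / β)) ≤ ENNReal.ofReal (D * R ^ (2 - q)) := by
        refine le_trans (le_of_eq ?_) (hD R hR0)
        rw [← lintegral_indicator Metric.isOpen_ball.measurableSet]
        refine lintegral_congr fun z => ?_
        have hq1 : 1 / β = q := by rw [hβ, hq, one_div_div]
        rw [hq1, hκ₁]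
        by_cases hz : z ∈ Metric.ball (0 : Space 2) R
        · rw [indicator_of_mem hz, indicator_of_mem hz]
        · rw [indicator_of_notMem hz, indicator_of_notMem hz, ENNReal.zero_rpow_of_pos (by positivity)]
      rw [← hL']
      calc _ ≤ ENNReal.ofReal L ^ (((k : ℝ) + (2 : ℕ)) / (k + 1 + (2 : ℕ)))
            * ENNReal.ofReal (D * R ^ (2 - q)) ^ β
            * ENNReal.ofReal L ^ (((2 : ℕ) : ℝ) / ((k + 1 : ℕ) + (2 : ℕ))) :=
            mul_le_mul' (mul_le_mul' (ENNReal.rpow_le_rpow hMle (by positivity))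
              (ENNReal.rpow_le_rpow hnear hβ0.le)) (ENNReal.rpow_le_rpow hMle (by positivity))
        _ = ENNReal.ofReal (D ^ β) * ENNReal.ofReal L := by
            rw [ENNReal.ofReal_rpow_of_pos hL0, ENNReal.ofReal_rpow_of_pos hL0,
              ENNReal.ofReal_rpow_of_nonneg (by positivity) hβ0.le,
              ← ENNReal.ofReal_mul (by positivity), ← ENNReal.ofReal_mul (by positivity),
              ← ENNReal.ofReal_mul (by positivity)]
            congr 1
            rw [Real.mul_rpow hD0 (by positivity), hR, ← Real.rpow_mul hL0.le, ← Real.rpow_mul hL0.le]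
            have e : L ^ (((k : ℝ) + (2 : ℕ)) / (k + 1 + (2 : ℕ)))
                * L ^ (-(1 / ((k : ℝ) + 1)) * (2 - q) * β)
                * L ^ (((2 : ℕ) : ℝ) / ((k + 1 : ℕ) + (2 : ℕ))) = L := by
              rw [← Real.rpow_add hL0, ← Real.rpow_add hL0]
              conv_rhs => rw [← Real.rpow_one L]
              congr 1
              rw [hq, hβ]
              push_cast
              field_simp
              ring
            calc _ = D ^ β * (L ^ (((k : ℝ) + (2 : ℕ)) / (k + 1 + (2 : ℕ)))
                * L ^ (-(1 / ((k : ℝ) + 1)) * (2 - q) * β)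
                * L ^ (((2 : ℕ) : ℝ) / ((k + 1 : ℕ) + (2 : ℕ)))) := by ring
              _ = _ := by rw [e]
  · set S : ℝ := R⁻¹ with hS
    have hS0 : 0 < S := by positivity
    have hSL : S ^ (k + 1) = L := by
      rw [hS, hR, ← Real.rpow_neg hL0.le, neg_neg, ← Real.rpow_natCast, ← Real.rpow_mul hL0.le]
      push_cast
      rw [one_div_mul_cancel hk1.ne', Real.rpow_one]
    have hlow : ENNReal.ofReal S * ∫⁻ z, ENNReal.ofReal (g z * bracket z.2 ^ k)
        ≤ (Ae + 1) * (M + 1) := by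
      have hgm' : Measurable fun z : Phase 2 => ENNReal.ofReal L * ENNReal.ofReal (g z) :=
        hg.measurable.ennreal_ofReal.const_mul _
      calc ENNReal.ofReal S * ∫⁻ z, ENNReal.ofReal (g z * bracket z.2 ^ k)
          = ∫⁻ z : Phase 2, ENNReal.ofReal S * ENNReal.ofReal (g z * bracket z.2 ^ k) :=
            (lintegral_const_mul' _ _ ENNReal.ofReal_ne_top).symm
        _ ≤ ∫⁻ z : Phase 2, (ENNReal.ofReal L * ENNReal.ofReal (g z)
            + ENNReal.ofReal (g z * bracket z.2 ^ (k + 1))) := by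
            refine lintegral_mono fun z => ?_
            have hb := bracket_pos z.2
            rw [← ENNReal.ofReal_mul hS0.le, ← ENNReal.ofReal_mul hL0.le,
              ← ENNReal.ofReal_add (mul_nonneg hL0.le (h0 z)) (mul_nonneg (h0 z) (by positivity))]
            refine ENNReal.ofReal_le_ofReal ?_
            -- With S^(k+1) = L, compare S with ⟨v⟩: the product is at most the larger of the two to
            -- the power k+1.
            have h1 : S * bracket z.2 ^ k ≤ L + bracket z.2 ^ (k + 1) := by
              rw [← hSL]
              rcases le_total S (bracket z.2) with h | h
              · have := mul_le_mul_of_nonneg_right h (pow_nonneg hb.le k)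
                have h2 : 0 ≤ S ^ (k + 1) := by positivity
                rw [pow_succ' (bracket z.2)]
                linarith
              · have := mul_le_mul_of_nonneg_left (pow_le_pow_left₀ hb.le h k) hS0.le
                have h2 : 0 ≤ bracket z.2 ^ (k + 1) := by positivity
                rw [pow_succ' S]
                linarith
            have := mul_le_mul_of_nonneg_left h1 (h0 z)
            linarith
        _ = ENNReal.ofReal L * (∫⁻ z, ENNReal.ofReal (g z)) + M := by
            rw [lintegral_add_left hgm', lintegral_const_mul' _ _ ENNReal.ofReal_ne_top]
            rfl
        _ ≤ (M + 1) * Ae + (M + 1) := by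
            rw [hL']
            exact add_le_add (mul_le_mul' le_rfl hgm) le_self_add
        _ = _ := by ring
    calc _ = (∫⁻ z, ENNReal.ofReal (g z))
          * (ENNReal.ofReal S * ∫⁻ z, ENNReal.ofReal (g z * bracket z.2 ^ k)) := by ring
      _ ≤ Ae * ((Ae + 1) * (M + 1)) := mul_le_mul' hgm hlow
      _ = _ := by ring

end Planar

/-! ### Propagation of moments in dimension two -/

section PlanarTheorem

theorem vMoment_initial_le {d : ℕ} {g : Phase d → ℝ} (hg : Continuous g) (h0 : ∀ z, 0 ≤ g z)
    {n : ℕ} {F M : ℝ} (hF0 : 0 ≤ F) (hM0 : 0 ≤ M)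
    (hF : ∫⁻ z, ENNReal.ofReal (g z) ≤ ENNReal.ofReal F)
    (hM : velocityMoment n g ≤ ENNReal.ofReal M) :
    vMoment n g ≤ ENNReal.ofReal (2 ^ n * (F + M)) := by
  refine (lintegral_bracket_le hg.measurable h0 n Prod.snd).trans ?_
  rw [ENNReal.ofReal_mul (by positivity), ENNReal.ofReal_add hF0 hM0, ENNReal.ofReal_pow (by simp),
    ENNReal.ofReal_ofNat]
  exact mul_le_mul' le_rfl (add_le_add hF hM)

theorem xMoment_initial_le {d : ℕ} {g : Phase d → ℝ} (hg : Continuous g) (h0 : ∀ z, 0 ≤ g z)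
    {n : ℕ} {F M : ℝ} (hF0 : 0 ≤ F) (hM0 : 0 ≤ M)
    (hF : ∫⁻ z, ENNReal.ofReal (g z) ≤ ENNReal.ofReal F)
    (hM : positionMoment n g ≤ ENNReal.ofReal M) :
    xMoment n g ≤ ENNReal.ofReal (2 ^ n * (F + M)) := by
  refine (lintegral_bracket_le hg.measurable h0 n Prod.fst).trans ?_
  rw [ENNReal.ofReal_mul (by positivity), ENNReal.ofReal_add hF0 hM0, ENNReal.ofReal_pow (by simp),
    ENNReal.ofReal_ofNat]
  exact mul_le_mul' le_rfl (add_le_add hF hM)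

theorem planar_velocityMoment_bound (n : ℕ) (σ : ℝ) (hσ : σ = 1 ∨ σ = -1) :
    ∃ Φ : ℝ → ℝ → ℝ → ℝ, (∀ F M, Continuous (Φ F M)) ∧
      ∀ (T : ℝ) (B : ℝ → Space 2 → ℝ) (fin : Phase 2 → ℝ) (f : ℝ → Phase 2 → ℝ)
        (Min : ℕ → ℝ), 0 < T → (∀ z, 0 ≤ fin z) → MemLp fin 1 volume → MemLp fin ⊤ volume →
        (∀ k ≤ n, 0 < Min k ∧ velocityMoment k fin ≤ ENNReal.ofReal (Min k)) →
        IsClassicalSolution (coulombKernel σ) (fun t x v => planarWedge v (B t x)) T fin f →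
        ∀ t ∈ Icc 0 T, velocityMoment n (f t) ≤
          ENNReal.ofReal (Φ (normLinfL1 fin).toReal (Min n) t) := by
  -- Order zero is the mass, which is bounded directly; Gronwall serves the orders k+1.
  rcases n with _ | k
  · refine ⟨fun F _ _ => F, fun _ _ => continuous_const, ?_⟩
    intro T B fin f Min hT h0 h1 h2 hMin hf t ht
    have := (hf.bounds (J := fun t x => planarWedgeCLM (B t x)) (fun _ _ _ => rfl)
      (fun t x v => inner_planarWedge _ v) h1 h2 ht).2
    simpa [velocityMoment] using this
  -- The value |F| + 1 is positive for every real F, so the constant is defined without conditions,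
  -- and it dominates F.
  choose C hCt hC using fun F : ℝ => planar_interaction_le k (A := |F| + 1) (by positivity)
  set c : ℝ → ℝ := fun F => ((k + 1 : ℕ) : ℝ) * (C F).toReal + 1 with hc
  refine ⟨fun F M t => 2 * (2 ^ (k + 1) * (F + M) + 1) * Real.exp (2 * c F * t),
    fun F M => by fun_prop, ?_⟩
  intro T B fin f Min hT h0 h1 h2 hMin hf t ht
  set J : ℝ → Space 2 → Space 2 →L[ℝ] Space 2 := fun t x => planarWedgeCLM (B t x)
  have hJ : ∀ t x v, planarWedge v (B t x) = J t x v := fun _ _ _ => rfl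
  have hskew : ∀ t x v, inner ℝ (J t x v) v = 0 := fun t x v => inner_planarWedge _ v
  have hb : ∀ τ ∈ Icc 0 T, _ := fun τ hτ => hf.bounds hJ hskew h1 h2 hτ
  obtain ⟨C₀, hg⟩ := hf.exists_transported hJ hskew
  set F : ℝ := (normLinfL1 fin).toReal with hF
  have hF0 : 0 ≤ F := ENNReal.toReal_nonneg
  have hM0 : 0 < Min (k + 1) := (hMin (k + 1) le_rfl).1
  have hT0 : (0 : ℝ) ∈ Icc 0 T := ⟨le_rfl, hT.le⟩
  have hFA : F ≤ |F| + 1 := by linarith [le_abs_self F]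
  have hcpos : 0 < c F := by
    have : 0 ≤ (C F).toReal := ENNReal.toReal_nonneg
    simp only [hc]
    positivity
  have hin : vMoment (k + 1) (f 0) ≤ ENNReal.ofReal (2 ^ (k + 1) * (F + Min (k + 1))) :=
    vMoment_initial_le (g := f 0) (hg.continuous_slice hT0) (hg.nonneg 0 hT0) hF0 hM0.le (hb 0 hT0).2
      (by rw [hf.initial]; exact (hMin (k + 1) le_rfl).2)
  obtain ⟨A, hAt, hA⟩ := hg.exists_vMoment_bound (n := k + 1)
    (ne_top_of_le_ne_top ENNReal.ofReal_ne_top hin)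
  dsimp only at hA
  have hineq : ∀ r ∈ Icc 0 T, vMoment (k + 1) (f r) + 1 ≤ (vMoment (k + 1) (f 0) + 1)
      + ∫⁻ τ in Ioo 0 r, ENNReal.ofReal (c F) * (vMoment (k + 1) (f τ) + 1) := by
    intro r hr
    have h3 := hg.vMoment_le (k + 1) le_rfl hr.1 hr.2
    rw [add_right_comm]
    refine add_le_add (h3.trans (add_le_add le_rfl ?_)) le_rfl
    refine setLIntegral_mono' measurableSet_Ioo fun τ hτ => ?_
    have hτ' : τ ∈ Icc 0 T := ⟨hτ.1.le, hτ.2.le.trans hr.2⟩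
    refine (lintegral_weight_mul_field_le (ω := fun z => bracket z.2) (hg.nonneg τ hτ')
      (Nat.cast_nonneg (k + 1)) k).trans ?_
    refine (mul_le_mul' le_rfl (hC F σ (f τ) hσ (hg.continuous_slice hτ') (hg.nonneg τ hτ')
      (fun z => ((hb τ hτ').1 z).trans hFA)
      ((hb τ hτ').2.trans (ENNReal.ofReal_le_ofReal hFA))
      (ne_top_of_le_ne_top hAt (hA τ hτ')))).trans ?_
    rw [← mul_assoc]
    refine mul_le_mul' ?_ le_rfl
    rw [← ENNReal.ofReal_toReal (hCt F), ← ENNReal.ofReal_mul (by positivity)]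
    exact ENNReal.ofReal_le_ofReal (by simp only [hc]; linarith)
  have hgr := gronwall_lintegral (M := fun r => vMoment (k + 1) (f r) + 1) hcpos
    (ENNReal.add_ne_top.2 ⟨hAt, ENNReal.one_ne_top⟩)
    (fun r hr => add_le_add (hA r hr) le_rfl) hineq t ht
  calc velocityMoment (k + 1) (f t) ≤ vMoment (k + 1) (f t) :=
        velocityMoment_le_vMoment (hg.nonneg t ht) _
    _ ≤ vMoment (k + 1) (f t) + 1 := le_self_add
    _ ≤ _ := hgr
    _ ≤ 2 * (ENNReal.ofReal (2 ^ (k + 1) * (F + Min (k + 1))) + 1)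
        * ENNReal.ofReal (Real.exp (2 * c F * (t - 0))) :=
        mul_le_mul' (mul_le_mul' le_rfl (add_le_add hin le_rfl)) le_rfl
    _ = _ := by
        have e1 : (0 : ℝ) ≤ 2 ^ (k + 1) * (F + Min (k + 1)) := by positivity
        rw [sub_zero, ENNReal.ofReal_mul (q := Real.exp _) (by linarith),
          ENNReal.ofReal_mul (p := 2) (by norm_num), ENNReal.ofReal_add e1 zero_le_one,
          ENNReal.ofReal_one, ENNReal.ofReal_ofNat]

end PlanarTheorem

/-! ### The magnetic force in dimension three -/

section Wedge

/-- The vector product with a fixed vector, as a linear map. -/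
noncomputable def wedgeCLM (b : Space 3) : Space 3 →L[ℝ] Space 3 :=
  LinearMap.toContinuousLinearMap
    { toFun := fun v => wedge v b
      map_add' := fun v w => by simp [wedge]
      map_smul' := fun c v => by simp [wedge] }

theorem wedgeCLM_apply (b v : Space 3) : wedgeCLM b v = wedge v b := rfl

theorem inner_wedge_self (b v : Space 3) : inner ℝ (wedgeCLM b v) v = 0 := by
  rw [wedgeCLM_apply]
  simp [wedge, PiLp.inner_apply, Fin.sum_univ_three, crossProduct]
  ring

/-- The magnetic force is orthogonal to `x - t v` up to the component controlled by `x ∧ b`. -/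
theorem inner_smul_wedge_eq (t : ℝ) (x v b : Space 3) :
    inner ℝ (x - t • v) (t • wedgeCLM b v) = inner ℝ (x - t • v) (wedge x b) := by
  have h1 : wedge x b = wedgeCLM b (x - t • v) + t • wedgeCLM b v := by
    rw [← map_smul, ← map_add, sub_add_cancel, wedgeCLM_apply]
  rw [h1, inner_add_right, real_inner_comm (wedgeCLM b (x - t • v)), inner_wedge_self, zero_add]

end Wedge

/-! ### The moment in x - tv -/

section Spread

variable {d : ℕ}

theorem contDiff_spread : ContDiff ℝ 1 fun p : ℝ × Phase d => (‖p.2.1 - p.1 • p.2.2‖ ^ 2) ^ 2 := by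
  refine (ContDiff.norm_sq ℝ ?_).pow 2
  exact (contDiff_fst.comp contDiff_snd).sub
    (contDiff_fst.smul (contDiff_snd.comp contDiff_snd))

/-- The quantity x - tv is constant under free transport, so only the force contributes, multiplied
by t. -/
theorem fderiv_spread (t : ℝ) (x v a : Space d) :
    fderiv ℝ (fun p : ℝ × Phase d => (‖p.2.1 - p.1 • p.2.2‖ ^ 2) ^ 2) (t, (x, v)) (1, (v, -a))
      = 4 * ‖x - t • v‖ ^ 2 * inner ℝ (x - t • v) (t • a) := by
  refine fderiv_eq_of_hasDerivAt_line (contDiff_spread.differentiable one_ne_zero _) ?_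
  have ht : HasDerivAt (fun s : ℝ => t + s * 1) 1 0 := by
    simpa using ((hasDerivAt_id (0 : ℝ)).const_add t)
  have hu := (hasDerivAt_line x v).sub (ht.smul (hasDerivAt_line v (-a)))
  have h2 := (hu.norm_sq).pow 2
  refine HasDerivAt.congr_deriv (f := fun s : ℝ =>
    (‖x + s • v - (t + s * 1) • (v + s • (-a))‖ ^ 2) ^ 2) h2 ?_
  simp
  ring

/-- The moment of order four in `x - t v`. -/
noncomputable def spreadMoment (t : ℝ) (g : Phase d → ℝ) : ℝ≥0∞ :=
  ∫⁻ z, ENNReal.ofReal (g z * ‖z.1 - t • z.2‖ ^ 4)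

theorem spreadMoment_le {t : ℝ} (ht : 0 ≤ t) {g : Phase d → ℝ} (hg : Continuous g)
    (h0 : ∀ z, 0 ≤ g z) :
    spreadMoment t g ≤ 8 * (xMoment 4 g + ENNReal.ofReal (t ^ 4) * vMoment 4 g) := by
  have hm : Measurable fun z : Phase d => ENNReal.ofReal (g z * bracket z.1 ^ 4) :=
    (hg.mul (continuous_bracket_fst.pow 4)).measurable.ennreal_ofReal
  rw [spreadMoment, xMoment, vMoment, ← lintegral_const_mul' _ _ ENNReal.ofReal_ne_top,
    ← lintegral_add_left hm, ← lintegral_const_mul' _ _ (by simp)]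
  refine lintegral_mono fun z => ?_
  have hx := bracket_pos z.1
  have hv := bracket_pos z.2
  have hz := h0 z
  rw [← ENNReal.ofReal_mul (by positivity), ← ENNReal.ofReal_add (by positivity) (by positivity),
    show (8 : ℝ≥0∞) = ENNReal.ofReal 8 by simp, ← ENNReal.ofReal_mul (by norm_num)]
  refine ENNReal.ofReal_le_ofReal ?_
  have h1 : ‖z.1 - t • z.2‖ ≤ bracket z.1 + t * bracket z.2 := by
    refine (norm_sub_le _ _).trans (add_le_add (norm_le_bracket _) ?_)
    rw [norm_smul, Real.norm_of_nonneg ht]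
    exact mul_le_mul_of_nonneg_left (norm_le_bracket _) ht
  have h2 : ‖z.1 - t • z.2‖ ^ 4 ≤ 8 * (bracket z.1 ^ 4 + t ^ 4 * bracket z.2 ^ 4) := by
    refine (pow_le_pow_left₀ (norm_nonneg _) h1 4).trans ?_
    rw [← mul_pow]
    simpa using add_pow_le hx.le (by positivity : 0 ≤ t * bracket z.2) 4 |>.trans (by norm_num)
  have := mul_le_mul_of_nonneg_left h2 hz
  linarith

end Spread

/-! ### Interaction and growth of moments in dimension three -/

section SpatialInteraction

/-- The condition β > 2/3 says that the kernel exponent 1/β is below 3/2. The same β is the total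
power of the supremum bound in the two interpolations. -/
theorem spatial_interaction_le {σ κ : ℝ} (hσ : σ = 1 ∨ σ = -1) (hκ : 0 < κ) (k j : ℕ) {β : ℝ}
    (hβ : β = 1 / ((k : ℝ) + 4) + (j : ℝ) / (j + 3)) (hβ1 : 2 / 3 < β) (hβ2 : β ≤ 1) :
    ∃ C : ℝ, 0 ≤ C ∧ ∀ (A : ℝ) (g ω ω' : Phase 3 → ℝ) (a a' : Space 3 → Space 3), 0 < A →
      Continuous g → (∀ z, 0 ≤ g z) → (∀ z, g z ≤ A) → Continuous ω → Continuous ω' →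
      (∀ x v, ‖v - a x‖ ≤ ω (x, v)) → (∀ x v, ‖v - a' x‖ ≤ ω' (x, v)) →
      interaction (fun z => ‖gradient (screenedKernel σ κ) z‖ₑ) g ω k
        ≤ ENNReal.ofReal (C * A ^ β)
          * ((∫⁻ z, ENNReal.ofReal (g z * ω z ^ (k + 1))) ^ (((k : ℝ) + 3) / (k + 4))
          * (∫⁻ z, ENNReal.ofReal (g z * ω' z ^ j)) ^ ((3 : ℝ) / (j + 3))) := by
  have hβ0 : 0 < β := by linarith
  have hq : 1 / β < 3 / 2 := by
    rw [div_lt_iff₀ hβ0]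
    linarith
  have hI := lintegral_screenedKernel_ne_top hσ hκ (one_div_pos.2 hβ0) hq
  set I := ∫⁻ z : Space 3, ‖gradient (screenedKernel σ κ) z‖ₑ ^ (1 / β)
  have hCt : interpConst 3 ^ 2 * I ^ β ≠ ⊤ := ENNReal.mul_ne_top
    (ENNReal.pow_ne_top (interpConst_ne_top 3)) (ENNReal.rpow_ne_top_of_nonneg hβ0.le hI)
  refine ⟨(interpConst 3 ^ 2 * I ^ β).toReal, ENNReal.toReal_nonneg, ?_⟩
  intro A g ω ω' a a' hA hg h0 hgA hω hω' hωa hωa'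
  have hA0 : ENNReal.ofReal A ≠ 0 := by simpa using hA
  have h := interaction_le hg h0 hA hgA hω hω' hωa hωa'
    ((measurable_gradient (screenedKernel σ κ)).enorm) k j (by norm_num : 0 < 3) hβ0 hβ2 (by
      rw [hβ]
      push_cast
      field_simp
      ring)
  refine h.trans (le_of_eq ?_)
  rw [ENNReal.ofReal_mul ENNReal.toReal_nonneg, ENNReal.ofReal_toReal hCt,
    ← ENNReal.ofReal_rpow_of_pos hA, hβ, ENNReal.rpow_add _ _ hA0 ENNReal.ofReal_ne_top]
  push_cast
  rw [show (k : ℝ) + 1 + 3 = k + 4 by ring, ← hβ]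
  ring

theorem Transported.vMoment_le_interaction {d : ℕ} {K : Space d → ℝ} {T C : ℝ}
    {J : ℝ → Space d → Space d →L[ℝ] Space d} {f : ℝ → Phase d → ℝ}
    (hg : Transported T C (fun t => field K (f t)) J (fun p => f p.1 p.2))
    (k : ℕ) {t : ℝ} (ht : t ∈ Icc 0 T) :
    vMoment (k + 1) (f t) ≤ vMoment (k + 1) (f 0) + ∫⁻ τ in Ioo 0 t,
      ENNReal.ofReal ((k + 1 : ℕ) : ℝ)
        * interaction (fun z => ‖gradient K z‖ₑ) (f τ) (fun z => bracket z.2) k := by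
  refine (hg.vMoment_le (k + 1) le_rfl ht.1 ht.2).trans (add_le_add le_rfl ?_)
  refine setLIntegral_mono' measurableSet_Ioo fun τ hτ => ?_
  exact lintegral_weight_mul_field_le (ω := fun z => bracket z.2)
    (hg.nonneg τ ⟨hτ.1.le, hτ.2.le.trans ht.2⟩) (Nat.cast_nonneg (k + 1)) k

theorem rpow_le_add_one (M : ℝ≥0∞) {α : ℝ} (hα0 : 0 ≤ α) (hα : α ≤ 1) : M ^ α ≤ M + 1 := by
  rcases le_total M 1 with h | h
  · exact (ENNReal.rpow_le_one h hα0).trans le_add_self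
  · refine le_add_right ?_
    conv_rhs => rw [← ENNReal.rpow_one M]
    exact ENNReal.rpow_le_rpow_of_exponent_le h hα

/-- Exponential growth of a velocity moment, given a bound on a lower moment in suitable weights. -/
theorem spatial_growth {σ κ : ℝ} (hσ : σ = 1 ∨ σ = -1) (hκ : 0 < κ) (k j : ℕ) {β : ℝ}
    (hβ : β = 1 / ((k : ℝ) + 4) + (j : ℝ) / (j + 3)) (hβ1 : 2 / 3 < β) (hβ2 : β ≤ 1) :
    ∃ C : ℝ, 0 ≤ C ∧ ∀ (T C₀ t D : ℝ) (J : ℝ → Space 3 → Space 3 →L[ℝ] Space 3)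
      (f : ℝ → Phase 3 → ℝ),
      Transported T C₀ (fun t => field (screenedKernel σ κ) (f t)) J (fun p => f p.1 p.2) →
      t ∈ Icc 0 T → 1 ≤ D → (∀ τ ∈ Icc 0 T, ∀ z, f τ z ≤ 1) → vMoment (k + 1) (f 0) ≠ ⊤ →
      (∀ τ ∈ Ioo 0 t, ∃ (ω' : Phase 3 → ℝ) (a' : Space 3 → Space 3), Continuous ω' ∧
        (∀ x v, ‖v - a' x‖ ≤ ω' (x, v)) ∧
        ∫⁻ z, ENNReal.ofReal (f τ z * ω' z ^ j) ≤ ENNReal.ofReal D) →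
      vMoment (k + 1) (f t) + 1
        ≤ 2 * (vMoment (k + 1) (f 0) + 1) * ENNReal.ofReal (Real.exp (2 * (C * D + 1) * t)) := by
  obtain ⟨C, hC0, hC⟩ := spatial_interaction_le hσ hκ k j hβ hβ1 hβ2
  refine ⟨((k + 1 : ℕ) : ℝ) * C, by positivity, ?_⟩
  intro T C₀ t D J f hg ht hD hb hfin hlow
  obtain ⟨A, hAt, hA⟩ := hg.exists_vMoment_bound (n := k + 1) hfin
  have hsub : ∀ r ∈ Icc 0 t, r ∈ Icc 0 T := fun r hr => ⟨hr.1, hr.2.trans ht.2⟩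
  have hineq : ∀ r ∈ Icc 0 t, vMoment (k + 1) (f r) + 1 ≤ (vMoment (k + 1) (f 0) + 1)
      + ∫⁻ τ in Ioo 0 r, ENNReal.ofReal (((k + 1 : ℕ) : ℝ) * C * D + 1)
        * (vMoment (k + 1) (f τ) + 1) := by
    intro r hr
    rw [add_right_comm]
    refine add_le_add ((hg.vMoment_le_interaction k (hsub r hr)).trans (add_le_add le_rfl ?_)) le_rfl
    refine setLIntegral_mono' measurableSet_Ioo fun τ hτ => ?_
    have hτ' : τ ∈ Icc 0 T := hsub τ ⟨hτ.1.le, hτ.2.le.trans hr.2⟩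
    obtain ⟨ω', a', hω', hωa', hlow'⟩ := hlow τ ⟨hτ.1, hτ.2.trans_le hr.2⟩
    refine (mul_le_mul' le_rfl (hC 1 (f τ) (fun z => bracket z.2) ω' (fun _ => 0) a' one_pos
      (hg.continuous_slice hτ') (hg.nonneg τ hτ') (hb τ hτ') continuous_bracket_snd hω'
      norm_sub_zero_le_bracket hωa')).trans ?_
    rw [Real.one_rpow, mul_one, ← mul_assoc, ← ENNReal.ofReal_mul (by positivity)]
    -- The exponent is below one, so the inequality is linear in the moment plus one.
    have e1 : (∫⁻ z, ENNReal.ofReal (f τ z * bracket z.2 ^ (k + 1))) ^ (((k : ℝ) + 3) / (k + 4))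
        ≤ vMoment (k + 1) (f τ) + 1 := by
      refine rpow_le_add_one _ (by positivity) ?_
      rw [div_le_one (by positivity)]
      linarith
    have e2 : (∫⁻ z, ENNReal.ofReal (f τ z * ω' z ^ j)) ^ ((3 : ℝ) / (j + 3))
        ≤ ENNReal.ofReal D := by
      refine (ENNReal.rpow_le_rpow hlow' (by positivity)).trans ?_
      conv_rhs => rw [← ENNReal.rpow_one (ENNReal.ofReal D)]
      refine ENNReal.rpow_le_rpow_of_exponent_le (by simpa using hD) ?_
      rw [div_le_one (by positivity)]
      linarith [Nat.cast_nonneg (α := ℝ) j]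
    calc _ ≤ ENNReal.ofReal (((k + 1 : ℕ) : ℝ) * C) * ((vMoment (k + 1) (f τ) + 1)
          * ENNReal.ofReal D) := mul_le_mul' le_rfl (mul_le_mul' e1 e2)
      _ = ENNReal.ofReal (((k + 1 : ℕ) : ℝ) * C * D) * (vMoment (k + 1) (f τ) + 1) := by
          rw [ENNReal.ofReal_mul (q := D) (by positivity)]
          ring
      _ ≤ _ := mul_le_mul' (ENNReal.ofReal_le_ofReal (by linarith)) le_rfl
  have hgr := gronwall_lintegral (M := fun r => vMoment (k + 1) (f r) + 1) (s := 0) (T := t)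
    (c := ((k + 1 : ℕ) : ℝ) * C * D + 1) (by positivity)
    (ENNReal.add_ne_top.2 ⟨hAt, ENNReal.one_ne_top⟩)
    (fun r hr => add_le_add (hA r (hsub r hr)) le_rfl) hineq t ⟨ht.1, le_rfl⟩
  simpa using hgr

/-- Exponential growth of a position moment. -/
theorem Transported.xMoment_growth {d : ℕ} {T C : ℝ} {e : ℝ → Space d → Space d}
    {J : ℝ → Space d → Space d →L[ℝ] Space d} {g : ℝ × Phase d → ℝ} (hg : Transported T C e J g)
    {n : ℕ} (hn : 0 < n) {t : ℝ} (ht : t ∈ Icc 0 T) {Ψ : ℝ≥0∞} (hΨ : Ψ ≠ ⊤)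
    (hv : ∀ τ ∈ Icc 0 t, vMoment n (fun z => g (τ, z)) ≤ Ψ)
    (hx : xMoment n (fun z => g (0, z)) ≠ ⊤) :
    xMoment n (fun z => g (t, z)) ≤ 2 * (xMoment n (fun z => g (0, z)) + Ψ)
      * ENNReal.ofReal (Real.exp (2 * n * t)) := by
  obtain ⟨A, hAt, hA⟩ := hg.exists_xMoment_bound (n := n)
    (ne_top_of_le_ne_top hΨ (hv 0 ⟨le_rfl, ht.1⟩)) hx
  have hsub : ∀ r ∈ Icc 0 t, r ∈ Icc 0 T := fun r hr => ⟨hr.1, hr.2.trans ht.2⟩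
  have hgr := gronwall_lintegral (M := fun r => xMoment n (fun z => g (r, z)) + Ψ) (s := 0) (T := t)
    (c := (n : ℝ)) (by exact_mod_cast hn) (a := xMoment n (fun z => g (0, z)) + Ψ)
    (ENNReal.add_ne_top.2 ⟨hAt, hΨ⟩)
    (fun r hr => add_le_add (hA r (hsub r hr)) le_rfl) ?_ t ⟨ht.1, le_rfl⟩
  · refine le_trans le_self_add (hgr.trans (le_of_eq ?_))
    rw [sub_zero]
  · intro r hr
    rw [add_right_comm]
    refine add_le_add ((hg.xMoment_le n le_rfl hr.1 (hsub r hr).2).trans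
      (add_le_add le_rfl ?_)) le_rfl
    refine setLIntegral_mono' measurableSet_Ioo fun τ hτ => ?_
    rw [ENNReal.ofReal_natCast]
    exact mul_le_mul' le_rfl (add_le_add le_rfl (hv τ ⟨hτ.1.le, hτ.2.le.trans hr.2⟩))

end SpatialInteraction

/-! ### Small data: short time and dispersion -/

section SmallData

/-- The bound of the interaction of the moments of order three and zero by those of order four. -/
def QuarticInteractionBound (K : Space 3 → ℝ) (C : ℝ) : Prop :=
  ∀ (A : ℝ) (g ω : Phase 3 → ℝ) (a : Space 3 → Space 3), 0 < A → Continuous g → (∀ z, 0 ≤ g z) →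
    (∀ z, g z ≤ A) → Continuous ω → (∀ x v, ‖v - a x‖ ≤ ω (x, v)) →
    interaction (fun z => ‖gradient K z‖ₑ) g ω 3
      ≤ ENNReal.ofReal (C * A ^ (5 / 7 : ℝ))
        * ((∫⁻ z, ENNReal.ofReal (g z * ω z ^ 4)) ^ (6 / 7 : ℝ)
        * (∫⁻ z, ENNReal.ofReal (g z * ω z ^ 4)) ^ (3 / 7 : ℝ))

theorem exists_quarticInteractionBound {σ κ : ℝ} (hσ : σ = 1 ∨ σ = -1) (hκ : 0 < κ) :
    ∃ C : ℝ, 0 ≤ C ∧ QuarticInteractionBound (screenedKernel σ κ) C := by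
  -- Here β = 1/7 + 4/7, so the kernel is taken in L^(7/5).
  obtain ⟨C, hC0, hC⟩ := spatial_interaction_le hσ hκ 3 4 (β := 5 / 7) (by norm_num) (by norm_num)
    (by norm_num)
  refine ⟨C, hC0, fun A g ω a hA hg h0 hgA hω hωa => ?_⟩
  have := hC A g ω ω a a hA hg h0 hgA hω hω hωa hωa
  norm_num at this
  exact this

theorem rpow_mul_rpow_mono (α γ : ℝ) (hα : 0 ≤ α) (hγ : 0 ≤ γ) (b : ℝ≥0∞) :
    Monotone fun M : ℝ≥0∞ => b * (M ^ α * M ^ γ) := fun _ _ h =>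
  mul_le_mul' le_rfl (mul_le_mul' (ENNReal.rpow_le_rpow h hα) (ENNReal.rpow_le_rpow h hγ))

theorem rpow_mul_rpow_ne_top {α γ : ℝ} (hα : 0 ≤ α) (hγ : 0 ≤ γ) {b M : ℝ≥0∞} (hb : b ≠ ⊤)
    (hM : M ≠ ⊤) : b * (M ^ α * M ^ γ) ≠ ⊤ :=
  ENNReal.mul_ne_top hb (ENNReal.mul_ne_top (ENNReal.rpow_ne_top_of_nonneg hα hM)
    (ENNReal.rpow_ne_top_of_nonneg hγ hM))

/-- For small data the velocity moment of order four remains small up to time one. -/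
theorem vMoment_four_le_of_small {K : Space 3 → ℝ} {C : ℝ} (hC0 : 0 ≤ C)
    (hC : QuarticInteractionBound K C) {T C₀ : ℝ}
    {J : ℝ → Space 3 → Space 3 →L[ℝ] Space 3} {f : ℝ → Phase 3 → ℝ}
    (hg : Transported T C₀ (fun t => field K (f t)) J (fun p => f p.1 p.2))
    {A : ℝ} (hA : 0 < A) (hb : ∀ τ ∈ Icc 0 T, ∀ z, f τ z ≤ A) {m δ : ℝ} (hm0 : 0 ≤ m)
    (hm : vMoment 4 (f 0) ≤ ENNReal.ofReal m) (hδ1 : δ ≤ 1)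
    (hlt : m + 4 * (C * A ^ (5 / 7 : ℝ)) < δ) {t : ℝ} (ht : t ∈ Icc 0 T) (ht1 : t ≤ 1) :
    vMoment 4 (f t) ≤ ENNReal.ofReal δ := by
  obtain ⟨M, hMt, hM⟩ := hg.exists_vMoment_bound (n := 4)
    (ne_top_of_le_ne_top ENNReal.ofReal_ne_top hm)
  set b : ℝ := 4 * (C * A ^ (5 / 7 : ℝ)) with hbdef
  have hb0 : 0 ≤ b := by positivity
  have hδ0 : 0 < δ := by linarith
  have hsub : ∀ r ∈ Icc 0 t, r ∈ Icc 0 T := fun r hr => ⟨hr.1, hr.2.trans ht.2⟩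
  refine barrier_lintegral (M := fun r => vMoment 4 (f r)) (s := 0) (T := t) (θ := fun _ => 1)
    (H := fun M => ENNReal.ofReal b * (M ^ (6 / 7 : ℝ) * M ^ (3 / 7 : ℝ)))
    (a := ENNReal.ofReal m) (A := M) (Θ := 1)
    (rpow_mul_rpow_mono _ _ (by norm_num) (by norm_num) _) (fun _ _ => le_rfl) ?_
    (rpow_mul_rpow_ne_top (by norm_num) (by norm_num) ENNReal.ofReal_ne_top hMt)
    (rpow_mul_rpow_ne_top (by norm_num) (by norm_num) ENNReal.ofReal_ne_top ENNReal.ofReal_ne_top)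
    (fun r hr => hM r (hsub r hr)) ?_ ?_ t ⟨ht.1, le_rfl⟩
  · simpa using ht1
  · intro r hr
    refine (hg.vMoment_le_interaction 3 (hsub r hr)).trans (add_le_add hm ?_)
    refine setLIntegral_mono' measurableSet_Ioo fun τ hτ => ?_
    have hτ' : τ ∈ Icc 0 T := hsub τ ⟨hτ.1.le, hτ.2.le.trans hr.2⟩
    rw [one_mul, hbdef, ENNReal.ofReal_mul (by norm_num), mul_assoc]
    refine mul_le_mul' (ENNReal.ofReal_le_ofReal (by norm_num)) ?_
    exact hC A (f τ) (fun z => bracket z.2) (fun _ => 0) hA (hg.continuous_slice hτ')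
      (hg.nonneg τ hτ') (hb τ hτ') continuous_bracket_snd norm_sub_zero_le_bracket
  · have h1 : ENNReal.ofReal δ ≤ 1 := by simpa using hδ1
    rw [one_mul]
    calc _ ≤ ENNReal.ofReal m + ENNReal.ofReal b * (1 * 1) := by
          refine add_le_add le_rfl (mul_le_mul' le_rfl (mul_le_mul' ?_ ?_))
          · exact ENNReal.rpow_le_one h1 (by norm_num)
          · exact ENNReal.rpow_le_one h1 (by norm_num)
      _ = ENNReal.ofReal (m + b) := by rw [mul_one, mul_one, ENNReal.ofReal_add hm0 hb0]
      _ < _ := (ENNReal.ofReal_lt_ofReal_iff hδ0).2 hlt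

theorem lintegral_Ioo_rpow_le {a t : ℝ} (ha : 1 < a) :
    ∫⁻ τ in Ioo 1 t, ENNReal.ofReal (τ ^ (-a)) ≤ ENNReal.ofReal (1 / (a - 1)) := by
  have hi : IntegrableOn (fun τ : ℝ => τ ^ (-a)) (Ioi 1) :=
    integrableOn_Ioi_rpow_of_lt (by linarith) one_pos
  calc ∫⁻ τ in Ioo 1 t, ENNReal.ofReal (τ ^ (-a))
      ≤ ∫⁻ τ in Ioi (1 : ℝ), ENNReal.ofReal (τ ^ (-a)) := lintegral_mono_set Ioo_subset_Ioi_self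
    _ = ENNReal.ofReal (∫ τ in Ioi (1 : ℝ), τ ^ (-a)) := by
        rw [ofReal_integral_eq_lintegral_ofReal hi]
        refine (ae_restrict_iff' measurableSet_Ioi).2 (Eventually.of_forall fun τ hτ => ?_)
        exact Real.rpow_nonneg (zero_le_one.trans (le_of_lt (mem_Ioi.1 hτ))) _
    _ = _ := by
        rw [integral_Ioi_rpow_of_lt (by linarith) one_pos, Real.one_rpow]
        congr 1
        have : a - 1 ≠ 0 := by linarith
        have : -a + 1 ≠ 0 := by linarith
        field_simp
        ring

/-- Split |x - tv|^3 at size 1/η. The small mass takes the large constant η^(-3), and the moment of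
order four comes with the small factor η. -/
theorem lintegral_spread_cube_le {g : Phase 3 → ℝ} (hg : Continuous g) (h0 : ∀ z, 0 ≤ g z)
    (t : ℝ) {η : ℝ} (hη : 0 < η) :
    ∫⁻ z, ENNReal.ofReal (g z * ‖z.1 - t • z.2‖ ^ 3)
      ≤ ENNReal.ofReal (η⁻¹ ^ 3) * (∫⁻ z, ENNReal.ofReal (g z))
        + ENNReal.ofReal η * spreadMoment t g := by
  have hm : Measurable fun z : Phase 3 => ENNReal.ofReal (η⁻¹ ^ 3) * ENNReal.ofReal (g z) :=
    hg.measurable.ennreal_ofReal.const_mul _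
  rw [spreadMoment, ← lintegral_const_mul' _ _ ENNReal.ofReal_ne_top,
    ← lintegral_const_mul' _ _ ENNReal.ofReal_ne_top, ← lintegral_add_left hm]
  refine lintegral_mono fun z => ?_
  have hz := h0 z
  rw [← ENNReal.ofReal_mul (by positivity), ← ENNReal.ofReal_mul (by positivity),
    ← ENNReal.ofReal_add (by positivity) (by positivity)]
  refine ENNReal.ofReal_le_ofReal ?_
  set y := ‖z.1 - t • z.2‖
  have hy : 0 ≤ y := norm_nonneg _
  have h1 : y ^ 3 ≤ η⁻¹ ^ 3 + η * y ^ 4 := by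
    rcases le_total y η⁻¹ with h | h
    · have := pow_le_pow_left₀ hy h 3
      have h2 : 0 ≤ η * y ^ 4 := by positivity
      linarith
    · have h2 : 1 ≤ η * y := by
        rw [← mul_inv_cancel₀ hη.ne']
        exact mul_le_mul_of_nonneg_left h hη.le
      have h3 := mul_le_mul_of_nonneg_right h2 (pow_nonneg hy 3)
      have h4 : 0 ≤ η⁻¹ ^ 3 := by positivity
      nlinarith
  have := mul_le_mul_of_nonneg_left h1 hz
  linarith

theorem lintegral_spread_four_eq {g : Phase 3 → ℝ} {τ : ℝ} (hτ : 0 < τ) :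
    ∫⁻ z, ENNReal.ofReal (g z * ‖z.2 - τ⁻¹ • z.1‖ ^ 4)
      = ENNReal.ofReal ((τ ^ 4)⁻¹) * spreadMoment τ g := by
  rw [spreadMoment, ← lintegral_const_mul' _ _ ENNReal.ofReal_ne_top]
  refine lintegral_congr fun z => ?_
  rw [← ENNReal.ofReal_mul (by positivity)]
  congr 1
  have : z.1 - τ • z.2 = -(τ • (z.2 - τ⁻¹ • z.1)) := by
    rw [smul_sub, smul_inv_smul₀ hτ.ne', neg_sub]
  rw [this, norm_neg, norm_smul, Real.norm_of_nonneg hτ.le]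
  field_simp

theorem norm_spread_eq {τ : ℝ} (hτ : 0 < τ) (x v : Space 3) :
    ‖x - τ • v‖ = τ * ‖v - τ⁻¹ • x‖ := by
  have : x - τ • v = -(τ • (v - τ⁻¹ • x)) := by
    rw [smul_sub, smul_inv_smul₀ hτ.ne', neg_sub]
  rw [this, norm_neg, norm_smul, Real.norm_of_nonneg hτ.le]

/-- The integral inequality for the moment of order four in `x - t v`. -/
theorem spreadMoment_le_lintegral {K : Space 3 → ℝ} {C : ℝ}
    (hC : QuarticInteractionBound K C) {T C₀ c B₀ : ℝ} {B : ℝ → Space 3 → Space 3}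
    {f : ℝ → Phase 3 → ℝ}
    (hg : Transported T C₀ (fun t => field K (f t)) (fun t x => wedgeCLM (B t x))
      (fun p => f p.1 p.2))
    (hB : MagneticDecay c B₀ T B) (hB0 : 0 < B₀) (hc : 3 / c - 1 ≤ 8 / 7)
    {A : ℝ} (hA : 0 < A) (hb : ∀ τ ∈ Icc 0 T, ∀ z, f τ z ≤ A)
    (hb1 : ∀ τ ∈ Icc 0 T, ∫⁻ z, ENNReal.ofReal (f τ z) ≤ ENNReal.ofReal A)
    {η : ℝ} (hη : 0 < η) {t : ℝ} (ht : t ∈ Icc 1 T) :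
    spreadMoment t (f t) ≤ spreadMoment 1 (f 1)
      + ∫⁻ τ in Ioo 1 t, ENNReal.ofReal (τ ^ (-(3 / c - 1)))
        * (ENNReal.ofReal (4 * (C * A ^ (5 / 7 : ℝ)))
            * (spreadMoment τ (f τ) ^ (6 / 7 : ℝ) * spreadMoment τ (f τ) ^ (3 / 7 : ℝ))
          + ENNReal.ofReal (4 * B₀)
            * (ENNReal.ofReal (η⁻¹ ^ 3 * A) + ENNReal.ofReal η * spreadMoment τ (f τ))) := by
  set a : ℝ := 3 / c - 1
  have h := hg.lintegral_weight_le (contDiff_spread (d := 3)).contDiffOn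
    (fun _ _ _ => sq_nonneg _) zero_le_one ht.1 ht.2
    (G := fun τ z => 4 * ‖z.1 - τ • z.2‖ ^ 3 * (τ * ‖field K (f τ) z.1‖)
      + 4 * B₀ * τ ^ (-a) * ‖z.1 - τ • z.2‖ ^ 3)
    (fun τ hτ z => by
      have h1 : 0 < τ := one_pos.trans hτ.1
      positivity) ?_
  · have e : ∀ r : ℝ, ∫⁻ z : Phase 3, ENNReal.ofReal (f r z * (‖z.1 - r • z.2‖ ^ 2) ^ 2)
        = spreadMoment r (f r) := fun r => by
      simp only [← pow_mul]
      rfl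
    simp only [e] at h
    refine h.trans (add_le_add le_rfl (setLIntegral_mono' measurableSet_Ioo fun τ hτ => ?_))
    have hτ0 : 0 < τ := one_pos.trans hτ.1
    have hτ' : τ ∈ Icc 0 T := ⟨hτ0.le, hτ.2.le.trans ht.2⟩
    have hfc : Continuous (f τ) := hg.continuous_slice hτ'
    have hf0 : ∀ z, 0 ≤ f τ z := hg.nonneg τ hτ'
    have hsec : Measurable fun z : Phase 3 =>
        ENNReal.ofReal (f τ z * (4 * B₀ * τ ^ (-a) * ‖z.1 - τ • z.2‖ ^ 3)) := by
      have : Continuous fun z : Phase 3 => ‖z.1 - τ • z.2‖ ^ 3 := by fun_prop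
      exact (hfc.mul (continuous_const.mul this)).measurable.ennreal_ofReal
    set ω : Phase 3 → ℝ := fun z => ‖z.2 - τ⁻¹ • z.1‖ with hω
    have hωc : Continuous ω := by fun_prop
    have hfirst : ∫⁻ x, ∫⁻ v, ENNReal.ofReal (f τ (x, v)
          * (4 * ‖x - τ • v‖ ^ 3 * (τ * ‖field K (f τ) x‖)))
        ≤ ENNReal.ofReal (τ ^ (-a)) * (ENNReal.ofReal (4 * (C * A ^ (5 / 7 : ℝ)))
            * (spreadMoment τ (f τ) ^ (6 / 7 : ℝ) * spreadMoment τ (f τ) ^ (3 / 7 : ℝ))) := by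
      have e1 : ∀ x v, f τ (x, v) * (4 * ‖x - τ • v‖ ^ 3 * (τ * ‖field K (f τ) x‖))
          = f τ (x, v) * ((4 * τ ^ 4) * ω (x, v) ^ 3 * ‖field K (f τ) x‖) := fun x v => by
        rw [norm_spread_eq hτ0, hω]
        ring
      simp only [e1]
      refine (lintegral_weight_mul_field_le hf0 (by positivity) 3).trans ?_
      refine (mul_le_mul' le_rfl (hC A (f τ) ω (fun x => τ⁻¹ • x) hA hfc hf0 (hb τ hτ') hωc
        (fun _ _ => le_rfl))).trans ?_
      rw [hω, lintegral_spread_four_eq hτ0, ENNReal.mul_rpow_of_nonneg _ _ (by norm_num),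
        ENNReal.mul_rpow_of_nonneg _ _ (by norm_num), ENNReal.ofReal_rpow_of_pos (by positivity),
        ENNReal.ofReal_rpow_of_pos (by positivity)]
      set L := spreadMoment τ (f τ)
      -- The exponent is 4 - 4 · 9/7 = -8/7, at most -a because a ≤ 8/7; this uses τ ≥ 1.
      have hp : τ ^ 4 * ((τ ^ 4)⁻¹ ^ (6 / 7 : ℝ) * (τ ^ 4)⁻¹ ^ (3 / 7 : ℝ)) ≤ τ ^ (-a) := by
        have e2 : (τ ^ 4)⁻¹ = τ ^ (-4 : ℝ) := by
          rw [Real.rpow_neg hτ0.le]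
          norm_cast
        have e3 : τ ^ 4 = τ ^ (4 : ℝ) := by norm_cast
        rw [e2, e3, ← Real.rpow_mul hτ0.le, ← Real.rpow_mul hτ0.le, ← Real.rpow_add hτ0,
          ← Real.rpow_add hτ0]
        refine Real.rpow_le_rpow_of_exponent_le hτ.1.le ?_
        linarith
      calc _ = ENNReal.ofReal (τ ^ 4 * ((τ ^ 4)⁻¹ ^ (6 / 7 : ℝ) * (τ ^ 4)⁻¹ ^ (3 / 7 : ℝ)))
            * (ENNReal.ofReal (4 * (C * A ^ (5 / 7 : ℝ))) * (L ^ (6 / 7 : ℝ) * L ^ (3 / 7 : ℝ))) := by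
            rw [ENNReal.ofReal_mul (p := 4) (by norm_num), ENNReal.ofReal_mul (p := τ ^ 4) (by positivity),
              ENNReal.ofReal_mul (p := 4) (by norm_num),
              ENNReal.ofReal_mul (p := (τ ^ 4)⁻¹ ^ (6 / 7 : ℝ)) (by positivity)]
            ring
        _ ≤ _ := mul_le_mul' (ENNReal.ofReal_le_ofReal hp) le_rfl
    have hsecond : ∫⁻ x, ∫⁻ v, ENNReal.ofReal (f τ (x, v)
          * (4 * B₀ * τ ^ (-a) * ‖x - τ • v‖ ^ 3))
        ≤ ENNReal.ofReal (τ ^ (-a)) * (ENNReal.ofReal (4 * B₀)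
            * (ENNReal.ofReal (η⁻¹ ^ 3 * A) + ENNReal.ofReal η * spreadMoment τ (f τ))) := by
      rw [← lintegral_phase_eq hsec]
      have e1 : ∀ z : Phase 3, ENNReal.ofReal (f τ z * (4 * B₀ * τ ^ (-a) * ‖z.1 - τ • z.2‖ ^ 3))
          = ENNReal.ofReal (4 * B₀ * τ ^ (-a)) * ENNReal.ofReal (f τ z * ‖z.1 - τ • z.2‖ ^ 3) :=
        fun z => by
          rw [← ENNReal.ofReal_mul (by positivity)]
          congr 1
          ring
      simp only [e1]
      rw [lintegral_const_mul' _ _ ENNReal.ofReal_ne_top]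
      refine (mul_le_mul' le_rfl (lintegral_spread_cube_le hfc hf0 τ hη)).trans ?_
      rw [mul_comm (4 * B₀), ENNReal.ofReal_mul (by positivity), mul_assoc,
        ENNReal.ofReal_mul (p := η⁻¹ ^ 3) (by positivity)]
      exact mul_le_mul' le_rfl (mul_le_mul' le_rfl (add_le_add (mul_le_mul' le_rfl (hb1 τ hτ')) le_rfl))
    rw [mul_add]
    refine le_trans ?_ (add_le_add hfirst hsecond)
    rw [← lintegral_add_right _ hsec.lintegral_prod_right']
    refine lintegral_mono fun x => ?_
    have hsx : Measurable fun v =>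
        ENNReal.ofReal (f τ (x, v) * (4 * B₀ * τ ^ (-a) * ‖x - τ • v‖ ^ 3)) :=
      hsec.comp measurable_prodMk_left
    dsimp only
    rw [← lintegral_add_right _ hsx]
    refine lintegral_mono fun v => ?_
    rw [mul_add]
    exact ENNReal.ofReal_add_le
  · intro τ hτ
    have hτ0 : 0 < τ := one_pos.trans hτ.1
    filter_upwards [(hB τ ⟨hτ0, hτ.2.le.trans ht.2⟩).1] with x hx v
    rw [fderiv_spread]
    set u := x - τ • v
    -- The factor τ in front of the magnetic force disappears in favour of x ∧ B, which decays by
    -- hypothesis.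
    rw [smul_add, inner_add_right, inner_smul_wedge_eq]
    have h1 : inner ℝ u (τ • field K (f τ) x) ≤ ‖u‖ * (τ * ‖field K (f τ) x‖) := by
      refine (real_inner_le_norm _ _).trans (le_of_eq ?_)
      rw [norm_smul, Real.norm_of_nonneg hτ0.le]
    have h2 : inner ℝ u (wedge x (B τ x)) ≤ ‖u‖ * (B₀ * τ ^ (-a)) :=
      (real_inner_le_norm _ _).trans (mul_le_mul_of_nonneg_left hx (norm_nonneg _))
    calc 4 * ‖u‖ ^ 2 * (inner ℝ u (τ • field K (f τ) x) + inner ℝ u (wedge x (B τ x)))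
        ≤ 4 * ‖u‖ ^ 2 * (‖u‖ * (τ * ‖field K (f τ) x‖) + ‖u‖ * (B₀ * τ ^ (-a))) := by gcongr
      _ = _ := by ring

/-- For small data the moment of order four in `x - t v` remains bounded after time one. -/
theorem spreadMoment_le_one_of_small {K : Space 3 → ℝ} {C : ℝ} (hC0 : 0 ≤ C)
    (hC : QuarticInteractionBound K C) {T C₀ c B₀ : ℝ} {B : ℝ → Space 3 → Space 3}
    {f : ℝ → Phase 3 → ℝ}
    (hg : Transported T C₀ (fun t => field K (f t)) (fun t x => wedgeCLM (B t x))
      (fun p => f p.1 p.2))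
    (hB : MagneticDecay c B₀ T B) (hB0 : 0 < B₀) (hc1 : 1 < 3 / c - 1) (hc : 3 / c - 1 ≤ 8 / 7)
    {A : ℝ} (hA : 0 < A) (hb : ∀ τ ∈ Icc 0 T, ∀ z, f τ z ≤ A)
    (hb1 : ∀ τ ∈ Icc 0 T, ∫⁻ z, ENNReal.ofReal (f τ z) ≤ ENNReal.ofReal A)
    (hv : vMoment 4 (f 0) ≠ ⊤) (hx : xMoment 4 (f 0) ≠ ⊤)
    {η l : ℝ} (hη : 0 < η) (hl0 : 0 ≤ l) (hl : spreadMoment 1 (f 1) ≤ ENNReal.ofReal l)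
    (hlt : l + 1 / (3 / c - 1 - 1)
      * (4 * (C * A ^ (5 / 7 : ℝ)) + 4 * B₀ * (η⁻¹ ^ 3 * A + η)) < 1)
    {t : ℝ} (ht : t ∈ Icc 1 T) : spreadMoment t (f t) ≤ 1 := by
  obtain ⟨V, hVt, hV⟩ := hg.exists_vMoment_bound (n := 4) hv
  obtain ⟨X, hXt, hX⟩ := hg.exists_xMoment_bound (n := 4) hv hx
  dsimp only at hV hX
  set a : ℝ := 3 / c - 1
  set H : ℝ≥0∞ → ℝ≥0∞ := fun L => ENNReal.ofReal (4 * (C * A ^ (5 / 7 : ℝ)))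
      * (L ^ (6 / 7 : ℝ) * L ^ (3 / 7 : ℝ))
    + ENNReal.ofReal (4 * B₀) * (ENNReal.ofReal (η⁻¹ ^ 3 * A) + ENNReal.ofReal η * L) with hH
  have hHmono : Monotone H := fun L L' h =>
    add_le_add (rpow_mul_rpow_mono _ _ (by norm_num) (by norm_num) _ h)
      (mul_le_mul' le_rfl (add_le_add le_rfl (mul_le_mul' le_rfl h)))
  have hHt : ∀ L ≠ ⊤, H L ≠ ⊤ := fun L hL => ENNReal.add_ne_top.2
    ⟨rpow_mul_rpow_ne_top (by norm_num) (by norm_num) ENNReal.ofReal_ne_top hL,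
      ENNReal.mul_ne_top ENNReal.ofReal_ne_top (ENNReal.add_ne_top.2 ⟨ENNReal.ofReal_ne_top,
        ENNReal.mul_ne_top ENNReal.ofReal_ne_top hL⟩)⟩
  have hT : 1 ≤ T := ht.1.trans ht.2
  have hsub : ∀ r ∈ Icc 1 T, r ∈ Icc 0 T := fun r hr => ⟨zero_le_one.trans hr.1, hr.2⟩
  -- A crude finite bound on [1, T], depending on T, needed only to start the barrier argument.
  set U : ℝ≥0∞ := 8 * (X + ENNReal.ofReal (T ^ 4) * V) with hU
  have hUt : U ≠ ⊤ := ENNReal.mul_ne_top (by simp) (ENNReal.add_ne_top.2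
    ⟨hXt, ENNReal.mul_ne_top ENNReal.ofReal_ne_top hVt⟩)
  refine barrier_lintegral (M := fun r => spreadMoment r (f r)) (s := 1) (T := T)
    (θ := fun τ => ENNReal.ofReal (τ ^ (-a))) (H := H) (a := ENNReal.ofReal l) (A := U)
    (Θ := ENNReal.ofReal (1 / (a - 1))) hHmono ?_ (lintegral_Ioo_rpow_le hc1) (hHt U hUt)
    (hHt 1 ENNReal.one_ne_top) ?_ ?_ ?_ t ht
  · intro τ hτ
    rw [ENNReal.ofReal_le_one]
    exact Real.rpow_le_one_of_one_le_of_nonpos hτ.1.le (by linarith)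
  · intro r hr
    have hr' := hsub r hr
    refine (spreadMoment_le hr'.1 (hg.continuous_slice hr') (hg.nonneg r hr')).trans ?_
    refine mul_le_mul' le_rfl (add_le_add (hX r hr') (mul_le_mul' ?_ (hV r hr')))
    exact ENNReal.ofReal_le_ofReal (pow_le_pow_left₀ hr'.1 hr.2 4)
  · intro r hr
    exact (spreadMoment_le_lintegral hC hg hB hB0 hc hA hb hb1 hη hr).trans
      (add_le_add hl le_rfl)
  · have ha : 0 < a - 1 := by linarith
    have e1 : H 1 = ENNReal.ofReal (4 * (C * A ^ (5 / 7 : ℝ)) + 4 * B₀ * (η⁻¹ ^ 3 * A + η)) := by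
      simp only [hH]
      rw [ENNReal.one_rpow, ENNReal.one_rpow, mul_one, mul_one, mul_one,
        ← ENNReal.ofReal_add (by positivity) hη.le, ← ENNReal.ofReal_mul (by positivity),
        ← ENNReal.ofReal_add (by positivity) (by positivity)]
    rw [e1, ← ENNReal.ofReal_mul (by positivity), ← ENNReal.ofReal_add hl0 (by positivity)]
    rwa [ENNReal.ofReal_lt_one]

end SmallData

/-! ### Propagation of moments in dimension three -/

section SpatialTheorem

/-- The order of choice matters: δ makes the spread moment at time one small, η absorbs the size of
the magnetic field, and only then is ε sent to zero, which also defeats the constant η^(-3). -/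
theorem exists_small_parameters {C B₀ Θ : ℝ} (hB : 0 < B₀) (hΘ : 0 < Θ) :
    ∃ δ η ε : ℝ, 0 < δ ∧ δ ≤ 1 ∧ 0 < η ∧ 0 < ε ∧ ε ≤ 1 ∧
      16 * ε + 4 * (C * ε ^ (5 / 7 : ℝ)) < δ ∧
      8 * (2 * (16 * ε + δ) * Real.exp 8 + δ)
        + Θ * (4 * (C * ε ^ (5 / 7 : ℝ)) + 4 * B₀ * (η⁻¹ ^ 3 * ε + η)) < 1 := by
  set e : ℝ := Real.exp 8 with he
  have he1 : 1 ≤ e := Real.one_le_exp (by norm_num)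
  set δ : ℝ := 1 / (160 * e) with hδ
  set η : ℝ := 1 / (32 * Θ * B₀) with hη
  have hδ0 : 0 < δ := by positivity
  have hη0 : 0 < η := by positivity
  have hδe : δ * e = 1 / 160 := by rw [hδ]; field_simp
  have hδle : δ ≤ 1 / 160 := by nlinarith
  have hηe : Θ * (4 * B₀ * η) = 1 / 8 := by rw [hη]; field_simp; norm_num
  have hp : Continuous fun ε : ℝ => ε ^ (5 / 7 : ℝ) := Real.continuous_rpow_const (by norm_num)
  have h1 : ∀ᶠ ε : ℝ in 𝓝 0, 16 * ε + 4 * (C * ε ^ (5 / 7 : ℝ)) < δ := by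
    have hc : Continuous fun ε : ℝ => 16 * ε + 4 * (C * ε ^ (5 / 7 : ℝ)) := by fun_prop
    refine hc.continuousAt.eventually_lt_const ?_
    beta_reduce
    rw [Real.zero_rpow (by norm_num)]
    simpa using hδ0
  have h2 : ∀ᶠ ε : ℝ in 𝓝 0, 8 * (2 * (16 * ε + δ) * e + δ)
      + Θ * (4 * (C * ε ^ (5 / 7 : ℝ)) + 4 * B₀ * (η⁻¹ ^ 3 * ε + η)) < 1 := by
    have hc : Continuous fun ε : ℝ => 8 * (2 * (16 * ε + δ) * e + δ)
      + Θ * (4 * (C * ε ^ (5 / 7 : ℝ)) + 4 * B₀ * (η⁻¹ ^ 3 * ε + η)) := by fun_prop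
    refine hc.continuousAt.eventually_lt_const ?_
    beta_reduce
    rw [Real.zero_rpow (by norm_num)]
    simp only [mul_zero, zero_add]
    rw [hηe]
    nlinarith
  have h3 : ∀ᶠ ε : ℝ in 𝓝 0, ε < 1 := eventually_lt_nhds one_pos
  obtain ⟨ε, ⟨⟨h1, h2⟩, h3⟩, h4⟩ :=
    ((((h1.and h2).and h3).filter_mono nhdsWithin_le_nhds).and
      (self_mem_nhdsWithin (a := (0 : ℝ)) (s := Ioi 0))).exists
  exact ⟨δ, η, ε, hδ0, by linarith, hη0, h4, h3.le, h1, h2⟩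

theorem vMoment_mono {d : ℕ} {g : Phase d → ℝ} (h0 : ∀ z, 0 ≤ g z) {m n : ℕ} (h : m ≤ n) :
    vMoment m g ≤ vMoment n g :=
  lintegral_mono fun z => ENNReal.ofReal_le_ofReal <|
    mul_le_mul_of_nonneg_left (pow_le_pow_right₀ (one_le_bracket _) h) (h0 z)

/-- Some weight above a translate of the speed has a moment of order `j` at most `D`. -/
def HasDominatedMoment {d : ℕ} (g : Phase d → ℝ) (j : ℕ) (D : ℝ) : Prop :=
  ∃ (ω : Phase d → ℝ) (a : Space d → Space d), Continuous ω ∧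
    (∀ x v, ‖v - a x‖ ≤ ω (x, v)) ∧ ∫⁻ z, ENNReal.ofReal (g z * ω z ^ j) ≤ ENNReal.ofReal D

theorem hasDominatedMoment_of_vMoment_le {d : ℕ} {g : Phase d → ℝ} {j : ℕ} {D : ℝ}
    (h : vMoment j g ≤ ENNReal.ofReal D) : HasDominatedMoment g j D :=
  ⟨fun z => bracket z.2, fun _ => 0, continuous_bracket_snd, norm_sub_zero_le_bracket, h⟩

theorem hasDominatedMoment_of_spreadMoment_le {g : Phase 3 → ℝ} {t : ℝ} (ht : 1 ≤ t)
    (h : spreadMoment t g ≤ 1) : HasDominatedMoment g 4 1 := by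
  refine ⟨fun z => ‖z.2 - t⁻¹ • z.1‖, fun x => t⁻¹ • x, by fun_prop, fun _ _ => le_rfl, ?_⟩
  rw [lintegral_spread_four_eq (one_pos.trans_le ht), ENNReal.ofReal_one]
  refine mul_le_one' ?_ h
  rw [ENNReal.ofReal_le_one]
  exact inv_le_one_of_one_le₀ (one_le_pow₀ ht)

/-- The spatial density of a small solution disperses. -/
theorem exists_smallness_threshold (σ κ c B₀ : ℝ) (hσ : σ = 1 ∨ σ = -1) (hκ : 0 < κ)
    (hc : c ∈ Ioo (7 / 5 : ℝ) (3 / 2)) (hB₀ : 0 < B₀) :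
    ∃ ε : ℝ, 0 < ε ∧ ε ≤ 1 ∧ ∀ (T C₀ : ℝ) (B : ℝ → Space 3 → Space 3) (f : ℝ → Phase 3 → ℝ),
      MagneticDecay c B₀ T B →
      Transported T C₀ (fun t => field (screenedKernel σ κ) (f t)) (fun t x => wedgeCLM (B t x))
        (fun p => f p.1 p.2) →
      (∀ τ ∈ Icc 0 T, ∀ z, f τ z ≤ ε) →
      (∀ τ ∈ Icc 0 T, ∫⁻ z, ENNReal.ofReal (f τ z) ≤ ENNReal.ofReal ε) →
      vMoment 4 (f 0) ≤ ENNReal.ofReal (16 * ε) → xMoment 4 (f 0) ≤ ENNReal.ofReal (16 * ε) →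
      ∀ τ ∈ Icc 0 T, HasDominatedMoment (f τ) 4 1 := by
  obtain ⟨C, hC0, hC⟩ := exists_quarticInteractionBound hσ hκ
  have hc0 : 0 < c := by linarith [hc.1]
  -- The bound c < 3/2 makes τ^(-a) integrable at infinity, and c > 7/5 makes it dominate the rate
  -- τ^(-8/7) of the field term.
  have ha1 : 1 < 3 / c - 1 := by
    have : 2 < 3 / c := by rw [lt_div_iff₀ hc0]; linarith [hc.2]
    linarith
  have ha2 : 3 / c - 1 ≤ 8 / 7 := by
    have : 3 / c ≤ 15 / 7 := by rw [div_le_iff₀ hc0]; linarith [hc.1]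
    linarith
  obtain ⟨δ, η, ε, hδ0, hδ1, hη, hε, hε1, hlt1, hlt2⟩ := exists_small_parameters (C := C) hB₀
    (show 0 < 1 / (3 / c - 1 - 1) from one_div_pos.2 (by linarith))
  refine ⟨ε, hε, hε1, fun T C₀ B f hB hg hb hb1 hv hx => ?_⟩
  have hshort : ∀ τ ∈ Icc 0 T, τ ≤ 1 → vMoment 4 (f τ) ≤ ENNReal.ofReal δ := fun τ hτ hτ1 =>
    vMoment_four_le_of_small hC0 hC hg hε hb (by positivity) hv hδ1 hlt1 hτ hτ1
  intro τ hτ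
  rcases le_total τ 1 with hτ1 | hτ1
  · exact hasDominatedMoment_of_vMoment_le
      ((hshort τ hτ hτ1).trans (ENNReal.ofReal_le_ofReal hδ1))
  · refine hasDominatedMoment_of_spreadMoment_le hτ1 ?_
    have h1 : (1 : ℝ) ∈ Icc 0 T := ⟨zero_le_one, hτ1.trans hτ.2⟩
    -- The factor exp 8 is the growth exp(2nt) of the position moment for n = 4 and t = 1.
    have hx1 : xMoment 4 (f 1) ≤ ENNReal.ofReal (2 * (16 * ε + δ) * Real.exp 8) := by
      refine (hg.xMoment_growth (n := 4) (by norm_num) h1 (Ψ := ENNReal.ofReal δ)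
        ENNReal.ofReal_ne_top (fun r hr => hshort r ⟨hr.1, hr.2.trans h1.2⟩ hr.2)
        (ne_top_of_le_ne_top ENNReal.ofReal_ne_top hx)).trans ?_
      rw [ENNReal.ofReal_mul (by positivity), ENNReal.ofReal_mul (by norm_num),
        ENNReal.ofReal_add (by positivity) hδ0.le, ENNReal.ofReal_ofNat,
        show 2 * ((4 : ℕ) : ℝ) * 1 = 8 by norm_num]
      exact mul_le_mul' (mul_le_mul' le_rfl (add_le_add hx le_rfl)) le_rfl
    refine spreadMoment_le_one_of_small hC0 hC hg hB hB₀ ha1 ha2 hε hb hb1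
      (ne_top_of_le_ne_top ENNReal.ofReal_ne_top hv) (ne_top_of_le_ne_top ENNReal.ofReal_ne_top hx)
      hη (by positivity) ?_ hlt2 ⟨hτ1, hτ.2⟩
    refine (spreadMoment_le zero_le_one (hg.continuous_slice h1) (hg.nonneg 1 h1)).trans ?_
    rw [one_pow, ENNReal.ofReal_one, one_mul, ENNReal.ofReal_mul (by norm_num),
      ENNReal.ofReal_add (by positivity) hδ0.le, ENNReal.ofReal_ofNat]
    exact mul_le_mul' le_rfl (add_le_add hx1 (hshort 1 h1 le_rfl))

/-- `Ψ` bounds the velocity moment of order `n` of a dispersing solution by its initial value. -/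
structure IsVelocityBound (σ κ : ℝ) (n : ℕ) (Ψ : ℝ → ℝ → ℝ) : Prop where
  continuous : ∀ m, Continuous (Ψ m)
  nonneg : ∀ m, 0 ≤ m → ∀ t, 0 ≤ Ψ m t
  mono : ∀ m, 0 ≤ m → ∀ s t, 0 ≤ s → s ≤ t → Ψ m s ≤ Ψ m t
  bound : ∀ (T C₀ m : ℝ) (J : ℝ → Space 3 → Space 3 →L[ℝ] Space 3) (f : ℝ → Phase 3 → ℝ),
    Transported T C₀ (fun t => field (screenedKernel σ κ) (f t)) J (fun p => f p.1 p.2) →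
    (∀ τ ∈ Icc 0 T, ∀ z, f τ z ≤ 1) → 0 ≤ m → vMoment n (f 0) ≤ ENNReal.ofReal m →
    (∀ τ ∈ Icc 0 T, HasDominatedMoment (f τ) 4 1) →
    ∀ t ∈ Icc 0 T, vMoment n (f t) ≤ ENNReal.ofReal (Ψ m t)

/-- One step of the induction on orders: a dominated moment of order j makes the inequality for
order k+1 linear. Monotonicity of `D` in time lets its value at t serve for all earlier times. -/
theorem exists_isVelocityBound_of_dominated {σ κ : ℝ} (hσ : σ = 1 ∨ σ = -1) (hκ : 0 < κ)
    (k j : ℕ) (hβ1 : 2 / 3 < 1 / ((k : ℝ) + 4) + (j : ℝ) / (j + 3))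
    (hβ2 : 1 / ((k : ℝ) + 4) + (j : ℝ) / (j + 3) ≤ 1) {D : ℝ → ℝ → ℝ}
    (hDc : ∀ m, Continuous (D m)) (hD1 : ∀ m, 0 ≤ m → ∀ t, 1 ≤ D m t)
    (hDm : ∀ m, 0 ≤ m → ∀ s t, 0 ≤ s → s ≤ t → D m s ≤ D m t)
    (hD : ∀ (T C₀ m : ℝ) (J : ℝ → Space 3 → Space 3 →L[ℝ] Space 3) (f : ℝ → Phase 3 → ℝ),
      Transported T C₀ (fun t => field (screenedKernel σ κ) (f t)) J (fun p => f p.1 p.2) →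
      (∀ τ ∈ Icc 0 T, ∀ z, f τ z ≤ 1) → 0 ≤ m → vMoment (k + 1) (f 0) ≤ ENNReal.ofReal m →
      (∀ τ ∈ Icc 0 T, HasDominatedMoment (f τ) 4 1) →
      ∀ t ∈ Icc 0 T, HasDominatedMoment (f t) j (D m t)) :
    ∃ Ψ, IsVelocityBound σ κ (k + 1) Ψ := by
  obtain ⟨C, hC0, hC⟩ := spatial_growth hσ hκ k j rfl hβ1 hβ2
  refine ⟨fun m t => 2 * (m + 1) * Real.exp (2 * (C * D m t + 1) * t), ?_, ?_, ?_, ?_⟩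
  · intro m
    have := hDc m
    fun_prop
  · intro m hm t
    positivity
  · intro m hm s t hs hst
    have h1 := hDm m hm s t hs hst
    have h2 := hD1 m hm t
    have h3 : 0 ≤ C * D m t := by positivity
    gcongr
  · intro T C₀ m J f hg hb hm hv hdom t ht
    have hlow : ∀ τ ∈ Ioo 0 t, HasDominatedMoment (f τ) j (D m t) := by
      intro τ hτ
      obtain ⟨ω, a, h1, h2, h3⟩ := hD T C₀ m J f hg hb hm hv hdom τ
        ⟨hτ.1.le, hτ.2.le.trans ht.2⟩
      exact ⟨ω, a, h1, h2, h3.trans (ENNReal.ofReal_le_ofReal (hDm m hm τ t hτ.1.le hτ.2.le))⟩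
    refine le_self_add.trans ((hC T C₀ t (D m t) J f hg ht (hD1 m hm t) hb
      (ne_top_of_le_ne_top ENNReal.ofReal_ne_top hv) hlow).trans ?_)
    rw [ENNReal.ofReal_mul (by positivity), ENNReal.ofReal_mul (by norm_num),
      ENNReal.ofReal_add hm zero_le_one, ENNReal.ofReal_one, ENNReal.ofReal_ofNat]
    gcongr

/-- With j = 4 the condition β > 2/3 reads 1/(k+4) > 2/21, that is k ≤ 6, giving orders up to seven.
With j = 7 the term 7/10 alone exceeds 2/3, so all higher orders follow in one further step. -/
theorem exists_isVelocityBound {σ κ : ℝ} (hσ : σ = 1 ∨ σ = -1) (hκ : 0 < κ) {n : ℕ}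
    (hn : 4 ≤ n) : ∃ Ψ, IsVelocityBound σ κ n Ψ := by
  have hlow : ∀ k : ℕ, 3 ≤ k → k ≤ 6 → ∃ Ψ, IsVelocityBound σ κ (k + 1) Ψ := by
    intro k hk hk6
    have h1 : (3 : ℝ) ≤ k := by exact_mod_cast hk
    have h2 : (k : ℝ) ≤ 6 := by exact_mod_cast hk6
    have h3 : 1 / ((k : ℝ) + 4) ≤ 1 / 7 := one_div_le_one_div_of_le (by norm_num) (by linarith)
    have h4 : 1 / 10 ≤ 1 / ((k : ℝ) + 4) := one_div_le_one_div_of_le (by linarith) (by linarith)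
    refine exists_isVelocityBound_of_dominated hσ hκ k 4 (D := fun _ _ => 1) ?_ ?_
      (fun _ => continuous_const) (fun _ _ _ => le_rfl) (fun _ _ _ _ _ _ => le_rfl)
      (fun T C₀ m J f _ _ _ _ hdom => hdom)
    · push_cast
      linarith
    · push_cast
      linarith
  obtain ⟨k, rfl⟩ : ∃ k, n = k + 1 := ⟨n - 1, by omega⟩
  rcases le_total k 6 with hk | hk
  · exact hlow k (by omega) hk
  obtain ⟨Ψ, hΨ⟩ := hlow 6 (by norm_num) le_rfl
  have h1 : (6 : ℝ) ≤ k := by exact_mod_cast hk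
  have h3 : 1 / ((k : ℝ) + 4) ≤ 1 / 10 := one_div_le_one_div_of_le (by norm_num) (by linarith)
  have h4 : 0 < 1 / ((k : ℝ) + 4) := by positivity
  refine exists_isVelocityBound_of_dominated hσ hκ k 7 (D := fun m t => max 1 (Ψ m t)) ?_ ?_
    (fun m => continuous_const.max (hΨ.continuous m)) (fun _ _ _ => le_max_left _ _)
    (fun m hm s t hs hst => max_le_max le_rfl (hΨ.mono m hm s t hs hst)) ?_
  · push_cast
    linarith
  · push_cast
    linarith
  · intro T C₀ m J f hg hb hm hv hdom t ht
    refine hasDominatedMoment_of_vMoment_le ((hΨ.bound T C₀ m J f hg hb hm ?_ hdom t ht).trans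
      (ENNReal.ofReal_le_ofReal (le_max_right _ _)))
    exact (vMoment_mono (hg.nonneg 0 ⟨le_rfl, ht.1.trans ht.2⟩) (by omega)).trans hv

theorem spatial_moment_bound (σ κ c B₀ : ℝ) (hσ : σ = 1 ∨ σ = -1) (hκ : 0 < κ)
    (hc : c ∈ Ioo (7 / 5 : ℝ) (3 / 2)) (hB₀ : 0 < B₀) :
    ∃ ε₀ : ℝ, 0 < ε₀ ∧ ∀ n : ℕ, 4 ≤ n →
      ∃ Φ : ℝ → ℝ → ℝ → ℝ → ℝ, (∀ F M N, Continuous (Φ F M N)) ∧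
        ∀ (T : ℝ) (B : ℝ → Space 3 → Space 3) (fin : Phase 3 → ℝ) (f : ℝ → Phase 3 → ℝ)
          (Min Nin : ℕ → ℝ), 0 < T → (∀ z, 0 ≤ fin z) → MemLp fin 1 volume → MemLp fin ⊤ volume →
          (∀ k ≤ n, 0 < Min k ∧ velocityMoment k fin ≤ ENNReal.ofReal (Min k)) →
          (∀ k ≤ n, 0 < Nin k ∧ positionMoment k fin ≤ ENNReal.ofReal (Nin k)) →
          MagneticDecay c B₀ T B →
          IsClassicalSolution (screenedKernel σ κ) (fun t x v => wedge v (B t x)) T fin f →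
          normLinfL1 fin + velocityMoment 4 fin + positionMoment 4 fin ≤ ENNReal.ofReal ε₀ →
          ∀ t ∈ Icc 0 T,
            velocityMoment n (f t) ≤
              ENNReal.ofReal (Φ (normLinfL1 fin).toReal (Min n) (Nin n) t) ∧
            positionMoment n (f t) ≤
              ENNReal.ofReal (Φ (normLinfL1 fin).toReal (Min n) (Nin n) t) := by
  obtain ⟨ε, hε, hε1, hsmall⟩ := exists_smallness_threshold σ κ c B₀ hσ hκ hc hB₀
  refine ⟨ε, hε, fun n hn => ?_⟩
  obtain ⟨Ψ, hΨ⟩ := exists_isVelocityBound hσ hκ hn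
  -- The first summand bounds the velocity moment and the second the position moment; 2^n converts
  -- plain moments into bracket moments.
  refine ⟨fun F M N t => Ψ (2 ^ n * (F + M)) t + 2 * (2 ^ n * (F + N) + Ψ (2 ^ n * (F + M)) t)
    * Real.exp (2 * n * t), fun F M N => ?_, ?_⟩
  · have := hΨ.continuous (2 ^ n * (F + M))
    fun_prop
  intro T B fin f Min Nin hT h0 h1 h2 hMin hNin hB hf hlt t ht
  have hJ : ∀ t x v, wedge v (B t x) = wedgeCLM (B t x) v := fun _ _ _ => rfl
  have hskew : ∀ t x v, inner ℝ (wedgeCLM (B t x) v) v = 0 := fun t x v => inner_wedge_self _ v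
  have hb : ∀ τ ∈ Icc 0 T, _ := fun τ hτ => hf.bounds hJ hskew h1 h2 hτ
  obtain ⟨C₀, hg⟩ := hf.exists_transported hJ hskew
  set F : ℝ := (normLinfL1 fin).toReal
  have hF0 : 0 ≤ F := ENNReal.toReal_nonneg
  have hFε : F ≤ ε := ENNReal.toReal_le_of_le_ofReal hε.le
    ((le_self_add.trans le_self_add).trans hlt)
  have hT0 : (0 : ℝ) ∈ Icc 0 T := ⟨le_rfl, hT.le⟩
  have hc0 : Continuous (f 0) := hg.continuous_slice hT0
  have hn0 : ∀ z, 0 ≤ f 0 z := hg.nonneg 0 hT0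
  obtain ⟨hM0, hM⟩ := hMin n le_rfl
  obtain ⟨hN0, hN⟩ := hNin n le_rfl
  rw [← hf.initial] at hM hN
  set m : ℝ := 2 ^ n * (F + Min n)
  have hm0 : 0 ≤ m := by positivity
  have hv := vMoment_initial_le hc0 hn0 hF0 hM0.le (hb 0 hT0).2 hM
  have hx := xMoment_initial_le hc0 hn0 hF0 hN0.le (hb 0 hT0).2 hN
  have hnorm : normLinfL1 fin = ENNReal.ofReal F :=
    (ENNReal.ofReal_toReal (ENNReal.add_ne_top.2 ⟨h2.2.ne, h1.2.ne⟩)).symm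
  rw [hnorm] at hlt
  -- Keeping the remainder ε - F, rather than ε, makes the bracket moment at most 2^4 (F + (ε - F))
  -- = 16 ε, the form of the threshold.
  have hM4 : velocityMoment 4 (f 0) ≤ ENNReal.ofReal (ε - F) := by
    rw [hf.initial, ENNReal.ofReal_sub _ hF0]
    exact ENNReal.le_sub_of_add_le_left ENNReal.ofReal_ne_top (le_self_add.trans hlt)
  have hN4 : positionMoment 4 (f 0) ≤ ENNReal.ofReal (ε - F) := by
    rw [hf.initial, ENNReal.ofReal_sub _ hF0]
    exact ENNReal.le_sub_of_add_le_left ENNReal.ofReal_ne_top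
      ((add_le_add le_self_add le_rfl).trans hlt)
  have hε16 : (2 : ℝ) ^ 4 * (F + (ε - F)) = 16 * ε := by ring
  have hv4 := vMoment_initial_le hc0 hn0 hF0 (sub_nonneg.2 hFε) (hb 0 hT0).2 hM4
  have hx4 := xMoment_initial_le hc0 hn0 hF0 (sub_nonneg.2 hFε) (hb 0 hT0).2 hN4
  rw [hε16] at hv4 hx4
  have hdom := hsmall T C₀ B f hB hg (fun τ hτ z => ((hb τ hτ).1 z).trans hFε)
    (fun τ hτ => (hb τ hτ).2.trans (ENNReal.ofReal_le_ofReal hFε)) hv4 hx4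
  have hvel := hΨ.bound T C₀ m _ f hg (fun τ hτ z => ((hb τ hτ).1 z).trans (hFε.trans hε1))
    hm0 hv hdom
  have hpos := hg.xMoment_growth (n := n) (by omega) ht (Ψ := ENNReal.ofReal (Ψ m t))
    ENNReal.ofReal_ne_top (fun τ hτ => (hvel τ ⟨hτ.1, hτ.2.trans ht.2⟩).trans
      (ENNReal.ofReal_le_ofReal (hΨ.mono m hm0 τ t hτ.1 hτ.2)))
    (ne_top_of_le_ne_top ENNReal.ofReal_ne_top hx)
  have hΨ0 := hΨ.nonneg m hm0 t
  have hX0 : 0 ≤ 2 * (2 ^ n * (F + Nin n) + Ψ m t) * Real.exp (2 * n * t) := by positivity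
  refine ⟨(velocityMoment_le_vMoment (hg.nonneg t ht) n).trans ((hvel t ht).trans
    (ENNReal.ofReal_le_ofReal (by linarith))), ?_⟩
  refine (positionMoment_le_xMoment (hg.nonneg t ht) n).trans (hpos.trans (le_trans ?_
    (ENNReal.ofReal_le_ofReal (le_add_of_nonneg_left hΨ0))))
  rw [ENNReal.ofReal_mul (by positivity), ENNReal.ofReal_mul (by norm_num),
    ENNReal.ofReal_add (by positivity) hΨ0, ENNReal.ofReal_ofNat]
  exact mul_le_mul' (mul_le_mul' le_rfl (add_le_add hx le_rfl)) le_rfl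

end SpatialTheorem

end MagneticVlasov

theorem theorem1 :
    -- dimension two, Coulomb kernel, arbitrary magnetic field
    (∀ (n : ℕ) (σ : ℝ), (σ = 1 ∨ σ = -1) →
      ∃ Φ : ℝ → ℝ → ℝ → ℝ, (∀ F M, Continuous (Φ F M)) ∧
        ∀ (T : ℝ) (B : ℝ → MagneticVlasov.Space 2 → ℝ)
          (fin : MagneticVlasov.Phase 2 → ℝ) (f : ℝ → MagneticVlasov.Phase 2 → ℝ)
          (Min : ℕ → ℝ),
          0 < T →
          (∀ z, 0 ≤ fin z) → MemLp fin 1 volume → MemLp fin ⊤ volume →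
          (∀ k ≤ n, 0 < Min k ∧
            MagneticVlasov.velocityMoment k fin ≤ ENNReal.ofReal (Min k)) →
          MagneticVlasov.IsClassicalSolution (MagneticVlasov.coulombKernel σ)
            (fun t x v => MagneticVlasov.planarWedge v (B t x)) T fin f →
          ∀ t ∈ Icc 0 T, MagneticVlasov.velocityMoment n (f t) ≤
            ENNReal.ofReal (Φ (MagneticVlasov.normLinfL1 fin).toReal (Min n) t)) ∧
    -- dimension three, screened Coulomb kernel, decaying magnetic field, small data
    (∀ (σ κ c B₀ : ℝ), (σ = 1 ∨ σ = -1) → 0 < κ → c ∈ Ioo (7 / 5 : ℝ) (3 / 2) → 0 < B₀ →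
      ∃ ε₀ : ℝ, 0 < ε₀ ∧ ∀ n : ℕ, 4 ≤ n →
        ∃ Φ : ℝ → ℝ → ℝ → ℝ → ℝ, (∀ F M N, Continuous (Φ F M N)) ∧
          ∀ (T : ℝ) (B : ℝ → MagneticVlasov.Space 3 → MagneticVlasov.Space 3)
            (fin : MagneticVlasov.Phase 3 → ℝ) (f : ℝ → MagneticVlasov.Phase 3 → ℝ)
            (Min Nin : ℕ → ℝ),
            0 < T →
            (∀ z, 0 ≤ fin z) → MemLp fin 1 volume → MemLp fin ⊤ volume →
            (∀ k ≤ n, 0 < Min k ∧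
              MagneticVlasov.velocityMoment k fin ≤ ENNReal.ofReal (Min k)) →
            (∀ k ≤ n, 0 < Nin k ∧
              MagneticVlasov.positionMoment k fin ≤ ENNReal.ofReal (Nin k)) →
            MagneticVlasov.MagneticDecay c B₀ T B →
            MagneticVlasov.IsClassicalSolution (MagneticVlasov.screenedKernel σ κ)
              (fun t x v => MagneticVlasov.wedge v (B t x)) T fin f →
            MagneticVlasov.normLinfL1 fin + MagneticVlasov.velocityMoment 4 fin
              + MagneticVlasov.positionMoment 4 fin ≤ ENNReal.ofReal ε₀ →
            ∀ t ∈ Icc 0 T,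
              MagneticVlasov.velocityMoment n (f t) ≤
                ENNReal.ofReal (Φ (MagneticVlasov.normLinfL1 fin).toReal (Min n) (Nin n) t) ∧
              MagneticVlasov.positionMoment n (f t) ≤
                ENNReal.ofReal (Φ (MagneticVlasov.normLinfL1 fin).toReal (Min n) (Nin n) t)) :=
  ⟨MagneticVlasov.planar_velocityMoment_bound, MagneticVlasov.spatial_moment_bound⟩
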